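/- For real $R>1$ put $G(R):=\sum_{m\le R}\mu(m)^2/\varphi(m)$. For $q\ge 1$ let $\mathbb{Z}_q^*$ be the set of reduced residue classes modulo $q$, put $e(\theta):=e^{2\pi i\theta}$, and let $$s(a/q):=\frac{1}{\varphi(q)}\sum_{m\in\mathbb{Z}_q^*}e(am/q),\qquad \alpha_R(n):=\sum_{q\le R}\ \sum_{a\in\mathbb{Z}_q^*}s(a/q)\,e(-an/q).$$ The Selberg majorant is $\beta_R(n):=|\alpha_R(n)|^2/G(R)$, and the Goldston–Yıldırım majorant is $$\beta'_R(n):=G(R)\Big(\sum_{d\mid n,\ d\le R}\lambda^{\mathrm{GY}}_d\Big)^2,\qquad \lambda^{\mathrm{GY}}_d:=\frac{\mu(d)\log(R/d)}{\log R}.$$ **Lemma.** Suppose that $R\ll N^{1/2-\varepsilon}$ for some $\varepsilon>0$. Then $\beta_R$ and $\beta'_R$ are close in $L^1$: $$\frac1N\sum_{n\le N}|\beta'_R(n)-\beta_R(n)|=O\big((\log R)^{-1/2}\big).$$ Explicitly: for every $C>0$ there is a constant $K>0$ depending only on $C$ such that for all $\varepsilon>0$, all integers $N\ge 1$ and all real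 $R>1$ with $R\le C N^{1/2-\varepsilon}$, $$\frac1N\sum_{n=1}^N|\beta'_R(n)-\beta_R(n)|\le K(\log R)^{-1/2}.$$ -/

import Mathlib

namespace SelbergSieve

noncomputable section

/-- `e(θ) = exp(2πiθ)`. -/
def e (θ : ℝ) : ℂ := Complex.exp (2 * Real.pi * θ * Complex.I)

/-- The reduced residues modulo `q`, represented in `{1, …, q}`. For `F(n) = n` this is both the
locally sieved set `X_q = {n ∈ ℤ/q : (q, F(n)) = 1}` and the group `(ℤ/q)^*`. -/
def reducedResidues (q : ℕ) : Finset ℕ := (Finset.Icc 1 q).filter fun a => Nat.Coprime a q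

/-- `s(a/q)`, the average of `e(am/q)` over `m ∈ X_q`. -/
def s (a q : ℕ) : ℂ :=
  (∑ m ∈ reducedResidues q, e ((a : ℝ) * m / q)) / ((reducedResidues q).card : ℂ)

/-- `α_R(n) = ∑_{q ≤ R} ∑_{a ∈ (ℤ/q)^*} s(a/q) e(-an/q)`. -/
def alpha (R : ℝ) (n : ℕ) : ℂ :=
  ∑ q ∈ Finset.Icc 1 ⌊R⌋₊, ∑ a ∈ reducedResidues q, s a q * e (-((a : ℝ) * n / q))

/-- `G(R) = ∑_{m ≤ R} μ(m)² / φ(m)`. -/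
def G (R : ℝ) : ℝ :=
  ∑ m ∈ Finset.Icc 1 ⌊R⌋₊, (ArithmeticFunction.moebius m : ℝ) ^ 2 / (Nat.totient m : ℝ)

/-- The Selberg majorant (enveloping sieve for the primes) `β_R(n) = |α_R(n)|² / G(R)`. -/
def beta (R : ℝ) (n : ℕ) : ℝ := ‖alpha R n‖ ^ 2 / G R

/-- The weights `λ^{GY}_d = μ(d) log(R/d) / log R`. -/
def lambdaGY (R : ℝ) (d : ℕ) : ℝ :=
  (ArithmeticFunction.moebius d : ℝ) * Real.log (R / d) / Real.log R

/-- The Goldston–Yıldırım majorant `β'_R(n) = G(R) (∑_{d ∣ n, d ≤ R} λ^{GY}_d)²`. -/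
def betaGY (R : ℝ) (n : ℕ) : ℝ :=
  G R * (∑ d ∈ (Finset.Icc 1 ⌊R⌋₊).filter (fun d => d ∣ n), lambdaGY R d) ^ 2

end

end SelbergSieve

/-! ### Analytic continuation of (s − 1)ζ(s) and a growth bound for Re s > 3/4. -/

section

open Complex

namespace SelbergSieve

/-! Both majorants are G(R) times the squared modulus of a combination Σ_{q ≤ R} b_q c_q(−n) of
Ramanujan sums. For the Selberg majorant b_q = μ(q)/(φ(q)G(R)), since s(a/q) = μ(q)/φ(q). For the
Goldston–Yıldırım majorant b_q = Σ_{q ∣ d} λ_d/d, since 1_{d ∣ n} = d⁻¹ Σ_{q ∣ d} c_q(n). Farey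
fractions of order R are at least R⁻² ≫ 1/N apart, so the large sieve
(`exists_sum_norm_ramanujanSum_sq_le`) bounds the mean square of such a combination over n ≤ N by
O(Σ φ(q) b_q²). This form equals 1/G at the Selberg coefficients; let D be its value at the
difference of the two coefficient sequences (`coeffDist`). Cauchy–Schwarz bounds the L¹ distance by
O(√(GD) + GD). As G = log R + O(1), it remains to prove D ≪ 1/log² R (`exists_coeffDist_le`); the
bounded range R < 2 is trivial because there D = 0.

Put M(x) = Σ_{m ≤ x} μ(m)/m · log(x/m). Möbius inversion (`moebius_mul_log_mul_gyCoeff`) turns μ(q)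
log R times the Goldston–Yıldırım coefficient into Σ n⁻¹ M(R/n) over n ≤ R with radical q. Since M
is close to 1 and all the 1/n with radical q add up to 1/φ(q), the coefficient is close to
μ(q)/(φ(q) log R). After summation over q the errors reduce to two bounded quantities: the sum of
1/n over rad n ≤ R < n (`exists_sum_sub_radSum_le`, which also evaluates G), and Σ_{n ≤ R} n⁻¹
(M(R/n) − 1)² (`exists_sum_logMoebius_sub_one_sq_le`).

With u = log x the second quantity becomes an L² norm of M(e^u) − 1 + e^{−u}. Plancherel on the
lines Re s = σ, with σ tending to 0, reduces it to a uniform L² bound for 1/(s²ζ(1+s)) − 1/(s(1+s)).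
A polynomial lower bound |ζ(1+σ+it)| ≫ |t|^{−4/3} suffices for that (`exists_le_norm_riemannZeta`).
It follows from the 3-4-1 inequality and a growth bound for ζ; no zero-free region is needed. -/

/-- The `n`-th term of the Euler–Maclaurin series for `(s - 1) ζ(s)`. -/
noncomputable def zetaTerm (n : ℕ) (s : ℂ) : ℂ :=
  (s - 1) * ((n : ℂ) + 1) ^ (-s) + ((n : ℂ) + 2) ^ (1 - s) - ((n : ℂ) + 1) ^ (1 - s)

lemma hasDerivAt_ofReal_cpow_neg (s : ℂ) {x : ℝ} (hx : 0 < x) :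
    HasDerivAt (fun y : ℝ => (y : ℂ) ^ (-s)) (-s * (x : ℂ) ^ (-s - 1)) x := by
  have h := ((hasDerivAt_id (x : ℂ)).cpow_const (c := -s) (Or.inl (by simpa using hx))).comp_ofReal
  simpa using h

lemma norm_cpow_neg_sub_le {s : ℂ} (hs : 0 < s.re) {a x : ℝ} (ha : 0 < a) (hax : a ≤ x)
    (hx : x ≤ a + 1) :
    ‖(a : ℂ) ^ (-s) - (x : ℂ) ^ (-s)‖ ≤ ‖s‖ * a ^ (-s.re - 1) := by
  have key := (convex_Icc a (a + 1)).norm_image_sub_le_of_norm_hasDerivWithin_le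
    (f := fun y : ℝ => (y : ℂ) ^ (-s)) (f' := fun y : ℝ => -s * (y : ℂ) ^ (-s - 1))
    (C := ‖s‖ * a ^ (-s.re - 1)) (x := x) (y := a) ?_ ?_ ⟨hax, hx⟩ ⟨le_rfl, by linarith⟩
  · refine key.trans ?_
    have : ‖a - x‖ ≤ 1 := by rw [Real.norm_eq_abs, abs_le]; constructor <;> linarith
    exact mul_le_of_le_one_right (by positivity) this
  · intro y hy
    exact (hasDerivAt_ofReal_cpow_neg s (ha.trans_le hy.1)).hasDerivWithinAt
  · intro y hy
    have hy0 := ha.trans_le hy.1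
    rw [norm_mul, norm_neg, norm_cpow_eq_rpow_re_of_pos hy0]
    gcongr
    simp only [sub_re, neg_re, one_re]
    exact Real.rpow_le_rpow_of_nonpos ha hy.1 (by linarith)

lemma norm_cpow_neg_sub_le_two {s : ℂ} (hs : 0 < s.re) {a x : ℝ} (ha : 0 < a) (hax : a ≤ x) :
    ‖(a : ℂ) ^ (-s) - (x : ℂ) ^ (-s)‖ ≤ 2 * a ^ (-s.re) := by
  refine (norm_sub_le _ _).trans ?_
  rw [norm_cpow_eq_rpow_re_of_pos ha, norm_cpow_eq_rpow_re_of_pos (ha.trans_le hax), neg_re]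
  have := Real.rpow_le_rpow_of_nonpos ha hax (z := -s.re) (by linarith)
  linarith

lemma min_le_rpow_third {u v w : ℝ} (hw : 0 ≤ w) (h1 : w ≤ u) (h2 : w ≤ v) :
    w ≤ u ^ (1 / 3 : ℝ) * v ^ (2 / 3 : ℝ) := by
  calc w = w ^ (1 / 3 : ℝ) * w ^ (2 / 3 : ℝ) := by
        rw [← Real.rpow_add' hw (by norm_num)]; norm_num
    _ ≤ _ := by
      have := hw.trans h1
      gcongr

/-- Interpolation between the mean value bound (weight 1/3) and the trivial bound (weight 2/3). Only
‖s‖^{1/3} is lost, and the decay exponent 3/4 + 1/3 = 13/12 still exceeds 1. -/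
lemma norm_cpow_neg_sub_le_third {s : ℂ} (hs : 3 / 4 < s.re) {a x : ℝ} (ha : 1 ≤ a) (hax : a ≤ x)
    (hx : x ≤ a + 1) :
    ‖(a : ℂ) ^ (-s) - (x : ℂ) ^ (-s)‖ ≤ 2 * ‖s‖ ^ (1 / 3 : ℝ) * a ^ (-13 / 12 : ℝ) := by
  have ha0 : 0 < a := by linarith
  refine (min_le_rpow_third (norm_nonneg _) (norm_cpow_neg_sub_le (by linarith) ha0 hax hx)
    (norm_cpow_neg_sub_le_two (by linarith) ha0 hax)).trans ?_
  rw [Real.mul_rpow (norm_nonneg _) (by positivity), Real.mul_rpow (by norm_num) (by positivity),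
    ← Real.rpow_mul ha0.le, ← Real.rpow_mul ha0.le]
  calc _ = (2 : ℝ) ^ (2 / 3 : ℝ) * ‖s‖ ^ (1 / 3 : ℝ) *
        (a ^ ((-s.re - 1) * (1 / 3)) * a ^ (-s.re * (2 / 3))) := by ring
    _ ≤ 2 * ‖s‖ ^ (1 / 3 : ℝ) * a ^ (-13 / 12 : ℝ) := by
      rw [← Real.rpow_add ha0]
      gcongr
      · exact Real.rpow_le_self_of_one_le (by norm_num) (by norm_num)
      linarith

/-- With a = n + 1, the term is (s − 1) ∫_a^{a+1} (a^{−s} − y^{−s}) dy. The mean value inequality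
for the primitive stands in for the integral. -/
lemma norm_zetaTerm_le (n : ℕ) {s : ℂ} (hs : 3 / 4 < s.re) :
    ‖zetaTerm n s‖ ≤ 2 * ‖s - 1‖ * ‖s‖ ^ (1 / 3 : ℝ) * ((n : ℝ) + 1) ^ (-13 / 12 : ℝ) := by
  have ha : (1 : ℝ) ≤ (n : ℝ) + 1 := by linarith [n.cast_nonneg (α := ℝ)]
  set a : ℝ := (n : ℝ) + 1 with hadef
  have hd : ∀ y ∈ Set.Icc a (a + 1), HasDerivWithinAt
      (fun y : ℝ => (s - 1) * (a : ℂ) ^ (-s) * (y : ℂ) + (y : ℂ) ^ (-(s - 1)))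
      ((s - 1) * ((a : ℂ) ^ (-s) - (y : ℂ) ^ (-s))) (Set.Icc a (a + 1)) y := by
    intro y hy
    have hy0 : 0 < y := by linarith [hy.1]
    have h1 := (hasDerivAt_ofReal_cpow_neg (s - 1) hy0)
    have h2 := ((hasDerivAt_id y).ofReal_comp).const_mul ((s - 1) * (a : ℂ) ^ (-s))
    convert! (h2.add h1).hasDerivWithinAt using 1
    rw [show -(s - 1) - 1 = -s by ring]
    push_cast
    ring
  have key := (convex_Icc a (a + 1)).norm_image_sub_le_of_norm_hasDerivWithin_le
    (C := ‖s - 1‖ * (2 * ‖s‖ ^ (1 / 3 : ℝ) * a ^ (-13 / 12 : ℝ))) (x := a) (y := a + 1) hd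
    (fun y hy => by
      rw [norm_mul]
      gcongr
      exact norm_cpow_neg_sub_le_third hs ha hy.1 hy.2) ⟨le_rfl, by linarith⟩ ⟨by linarith, le_rfl⟩
  have e1 : zetaTerm n s = ((s - 1) * (a : ℂ) ^ (-s) * ((a + 1 : ℝ) : ℂ) +
      ((a + 1 : ℝ) : ℂ) ^ (-(s - 1))) - ((s - 1) * (a : ℂ) ^ (-s) * (a : ℂ) + (a : ℂ) ^ (-(s - 1))) := by
    rw [zetaTerm, hadef]
    push_cast
    rw [show -(s - 1) = 1 - s by ring, show (n : ℂ) + 1 + 1 = n + 2 by ring]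
    ring
  rw [e1]
  refine key.trans (le_of_eq ?_)
  simp
  ring

lemma summable_rpow_zetaTerm : Summable fun n : ℕ => ((n : ℝ) + 1) ^ (-13 / 12 : ℝ) := by
  have := (summable_nat_add_iff 1).mpr (Real.summable_nat_rpow (p := (-13 / 12 : ℝ)) |>.mpr (by norm_num))
  simpa using this

lemma differentiable_zetaTerm (n : ℕ) : Differentiable ℂ (zetaTerm n) := by
  have h1 : (n : ℂ) + 1 ≠ 0 := Nat.cast_add_one_ne_zero n
  have h2 : (n : ℂ) + 2 ≠ 0 := by
    have := Nat.cast_add_one_ne_zero (R := ℂ) (n + 1)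
    push_cast at this
    rwa [add_assoc, one_add_one_eq_two] at this
  intro s
  unfold zetaTerm
  refine DifferentiableAt.sub (DifferentiableAt.add (DifferentiableAt.mul (by fun_prop) ?_) ?_) ?_
  · exact DifferentiableAt.const_cpow (by fun_prop) (Or.inl h1)
  · exact DifferentiableAt.const_cpow (by fun_prop) (Or.inl h2)
  · exact DifferentiableAt.const_cpow (by fun_prop) (Or.inl h1)

/-- The differences of (n+1)^{1−s} telescope to −1, which cancels the constant term 1. -/
lemma riemannZeta₁_eq_of_one_lt_re {s : ℂ} (hs : 1 < s.re) :
    riemannZeta₁ s = 1 + ∑' n, zetaTerm n s := by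
  have hs1 : s ≠ 1 := by rintro rfl; simp at hs
  have hz := zeta_eq_tsum_one_div_nat_add_one_cpow hs
  have hsum : Summable fun n : ℕ => 1 / ((n : ℂ) + 1) ^ s := by
    have := (summable_nat_add_iff 1).mpr (Complex.summable_one_div_nat_cpow.mpr hs)
    simpa using this
  have ht : HasSum (fun n : ℕ => ((n : ℂ) + 2) ^ (1 - s) - ((n : ℂ) + 1) ^ (1 - s)) (0 - 1) := by
    have hsm : Summable fun n : ℕ => ((n : ℂ) + 2) ^ (1 - s) - ((n : ℂ) + 1) ^ (1 - s) := by
      have h1 : Summable fun n => zetaTerm n s :=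
        Summable.of_norm_bounded (summable_rpow_zetaTerm.mul_left _)
          (fun n => norm_zetaTerm_le n (by linarith))
      refine (h1.sub (hsum.mul_left (s - 1))).congr fun n => ?_
      rw [zetaTerm, cpow_neg]; ring
    refine (hsm.hasSum_iff_tendsto_nat).mpr ?_
    have : ∀ N : ℕ, ∑ n ∈ Finset.range N, (((n : ℂ) + 2) ^ (1 - s) - ((n : ℂ) + 1) ^ (1 - s))
        = ((N : ℂ) + 1) ^ (1 - s) - 1 := by
      intro N
      have := Finset.sum_range_sub (fun n : ℕ => ((n : ℂ) + 1) ^ (1 - s)) N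
      simp only [Nat.cast_add, Nat.cast_one, add_assoc, one_add_one_eq_two] at this
      rw [this]; simp
    simp_rw [this]
    refine Filter.Tendsto.sub_const ?_ 1
    rw [tendsto_zero_iff_norm_tendsto_zero]
    have h3 : Filter.Tendsto (fun n : ℕ => ((n + 1 : ℕ) : ℝ) ^ (-(s.re - 1))) Filter.atTop (nhds 0) :=
      ((tendsto_rpow_neg_atTop (by linarith : 0 < s.re - 1)).comp tendsto_natCast_atTop_atTop).comp
        (Filter.tendsto_add_atTop_nat 1)
    refine h3.congr fun n => ?_
    have := norm_cpow_eq_rpow_re_of_pos (x := ((n + 1 : ℕ) : ℝ)) (by positivity) (1 - s)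
    push_cast at this ⊢
    rw [this]; simp
  have h2 : HasSum (fun n => zetaTerm n s) ((s - 1) * riemannZeta s + (0 - 1)) := by
    rw [hz]
    refine ((hsum.hasSum.mul_left (s - 1)).add ht).congr_fun ?_
    intro n
    rw [zetaTerm, cpow_neg]; ring
  rw [h2.tsum_eq, riemannZeta_eq_inv_sub_mul hs1]
  field_simp [sub_ne_zero.mpr hs1]
  ring

lemma riemannZeta₁_eq {s : ℂ} (hs : 3 / 4 < s.re) :
    riemannZeta₁ s = 1 + ∑' n, zetaTerm n s := by
  set M : ℝ := ‖s‖ + 3 with hM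
  -- The ball makes the term bounds uniform on `U`; its radius lets it contain both s and the base
  -- point 2.
  set U : Set ℂ := {z | 3 / 4 < z.re} ∩ Metric.ball 0 M with hU
  have hUo : IsOpen U := (isOpen_lt continuous_const continuous_re).inter Metric.isOpen_ball
  have hUc : Convex ℝ U := (convex_halfSpace_re_gt _).inter (convex_ball _ _)
  have hd : DifferentiableOn ℂ (fun z => 1 + ∑' n, zetaTerm n z) U := by
    refine DifferentiableOn.const_add 1 ?_
    refine differentiableOn_tsum_of_summable_norm
      (u := fun n => 2 * (M + 1) * M ^ (1 / 3 : ℝ) * ((n : ℝ) + 1) ^ (-13 / 12 : ℝ))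
      (summable_rpow_zetaTerm.mul_left _) (fun n => (differentiable_zetaTerm n).differentiableOn) hUo ?_
    intro n z hz
    have hzM : ‖z‖ ≤ M := by simpa using (Metric.mem_ball.mp hz.2).le
    refine (norm_zetaTerm_le n hz.1).trans ?_
    gcongr
    calc ‖z - 1‖ ≤ ‖z‖ + ‖(1 : ℂ)‖ := norm_sub_le _ _
      _ ≤ M + 1 := by simpa using hzM
  have h2 : (2 : ℂ) ∈ U := by
    refine ⟨by norm_num, ?_⟩
    simp [hM]; linarith [norm_nonneg s]
  have := (differentiable_riemannZeta₁.differentiableOn.analyticOnNhd hUo).eqOn_of_preconnected_of_eventuallyEq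
    (hd.analyticOnNhd hUo) hUc.isPreconnected h2 (by
      filter_upwards [(isOpen_lt continuous_const continuous_re).mem_nhds
        (show (1 : ℝ) < (2 : ℂ).re by norm_num)] with z hz
      exact riemannZeta₁_eq_of_one_lt_re hz)
  exact this ⟨hs, by simp [hM]⟩

/-- A convexity-type bound for `ζ` to the right of the line `Re s = 3/4`. -/
lemma exists_norm_riemannZeta_le : ∃ B : ℝ, 1 ≤ B ∧ ∀ s : ℂ, 3 / 4 < s.re → 1 / 2 ≤ ‖s - 1‖ →
    ‖riemannZeta s‖ ≤ B * ‖s‖ ^ (1 / 3 : ℝ) := by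
  set S := ∑' n : ℕ, ((n : ℝ) + 1) ^ (-13 / 12 : ℝ)
  have hS : 0 ≤ S := tsum_nonneg fun n => by positivity
  refine ⟨4 + 2 * S, by linarith, fun s hs h1 => ?_⟩
  have hs1 : s ≠ 1 := by rintro rfl; norm_num at h1
  have h0 : 0 < ‖s - 1‖ := by linarith
  have hb : ‖∑' n, zetaTerm n s‖ ≤ 2 * ‖s - 1‖ * ‖s‖ ^ (1 / 3 : ℝ) * S := by
    rw [← tsum_mul_left]
    exact tsum_of_norm_bounded (summable_rpow_zetaTerm.mul_left _).hasSum
      fun n => norm_zetaTerm_le n hs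
  have hs3 : 1 / 2 ≤ ‖s‖ ^ (1 / 3 : ℝ) := by
    have : (3 / 4 : ℝ) ≤ ‖s‖ := by
      have := (abs_re_le_norm s); linarith [le_abs_self s.re]
    calc (1 / 2 : ℝ) ≤ (3 / 4 : ℝ) ^ (1 : ℝ) := by norm_num
      _ ≤ (3 / 4 : ℝ) ^ (1 / 3 : ℝ) :=
        Real.rpow_le_rpow_of_exponent_ge (by norm_num) (by norm_num) (by norm_num)
      _ ≤ _ := by gcongr
  rw [riemannZeta_eq_inv_sub_mul hs1, riemannZeta₁_eq hs, norm_mul, norm_inv,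
    inv_mul_le_iff₀ h0]
  calc _ ≤ ‖(1 : ℂ)‖ + ‖∑' n, zetaTerm n s‖ := norm_add_le _ _
    _ ≤ 1 + 2 * ‖s - 1‖ * ‖s‖ ^ (1 / 3 : ℝ) * S := by simpa using hb
    _ ≤ 4 * (‖s - 1‖ * ‖s‖ ^ (1 / 3 : ℝ)) + 2 * ‖s - 1‖ * ‖s‖ ^ (1 / 3 : ℝ) * S := by
      have : 1 / 2 * (1 / 2) ≤ ‖s - 1‖ * ‖s‖ ^ (1 / 3 : ℝ) := by gcongr
      linarith
    _ = _ := by ring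

end SelbergSieve

end

/-! ### Derivative bound and a polynomial lower bound for ζ to the right of Re s = 1. -/

section

open Complex

namespace SelbergSieve

/-- Cauchy's estimate on a circle of radius 1/5, which stays in Re > 3/4 and at distance at least
1/2 from the pole. -/
lemma exists_norm_deriv_riemannZeta_le : ∃ B : ℝ, 1 ≤ B ∧ ∀ s : ℂ, 1 ≤ s.re → 1 ≤ |s.im| →
    ‖deriv riemannZeta s‖ ≤ B * ‖s‖ ^ (1 / 3 : ℝ) := by
  obtain ⟨B, hB1, hB⟩ := exists_norm_riemannZeta_le
  refine ⟨10 * B, by linarith, fun s hs ht => ?_⟩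
  have hs1 : 1 ≤ ‖s‖ := hs.trans ((le_abs_self _).trans (abs_re_le_norm s))
  have him : ∀ z ∈ Metric.closedBall s (1 / 5), 1 / 2 ≤ ‖z - 1‖ := by
    intro z hz
    have h1 : |(z - s).im| ≤ 1 / 5 := (abs_im_le_norm _).trans (by simpa [dist_eq] using hz)
    have h2 : |s.im| ≤ |(z - 1).im| + |(z - s).im| := by
      have := abs_sub (z - 1).im (z - s).im
      simpa using this
    linarith [abs_im_le_norm (z - 1)]
  have key := norm_deriv_le_of_forall_mem_sphere_norm_le (f := riemannZeta) (c := s) (R := 1 / 5)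
    (C := 2 * B * ‖s‖ ^ (1 / 3 : ℝ)) (by norm_num) ?_ ?_
  · refine key.trans (le_of_eq ?_)
    ring
  · refine (DifferentiableOn.diffContOnCl_ball (U := {1}ᶜ) ?_ ?_)
    · intro z hz
      exact (differentiableAt_riemannZeta hz).differentiableWithinAt
    · intro z hz h1
      have := him z hz
      rw [Set.mem_singleton_iff] at h1
      rw [h1] at this
      norm_num at this
  · intro z hz
    have hzs : ‖z - s‖ ≤ 1 / 5 := by simpa [dist_eq] using hz.le
    have hre : 3 / 4 < z.re := by
      have := (abs_le.mp ((abs_re_le_norm (z - s)).trans hzs)).1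
      simp at this; linarith
    refine (hB z hre (him z (Metric.sphere_subset_closedBall hz))).trans ?_
    have hz2 : ‖z‖ ≤ 2 * ‖s‖ := by
      calc ‖z‖ = ‖s + (z - s)‖ := by ring_nf
        _ ≤ ‖s‖ + ‖z - s‖ := norm_add_le _ _
        _ ≤ _ := by linarith
    calc B * ‖z‖ ^ (1 / 3 : ℝ) ≤ B * (2 * ‖s‖) ^ (1 / 3 : ℝ) := by gcongr
      _ = 2 ^ (1 / 3 : ℝ) * B * ‖s‖ ^ (1 / 3 : ℝ) := by
        rw [Real.mul_rpow (by norm_num) (norm_nonneg _)]; ring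
      _ ≤ 2 * B * ‖s‖ ^ (1 / 3 : ℝ) := by
        gcongr
        exact Real.rpow_le_self_of_one_le (by norm_num) (by norm_num)

lemma norm_le_three_mul {σ : ℝ} {t : ℝ} (h0 : 0 ≤ σ) (h1 : σ ≤ 1) (ht : 1 ≤ |t|) :
    ‖(1 + σ + I * t : ℂ)‖ ≤ 3 * |t| := by
  calc ‖(1 + σ + I * t : ℂ)‖ ≤ ‖(1 + σ : ℂ)‖ + ‖I * t‖ := norm_add_le _ _
    _ = (1 + σ) + |t| := by
      have : (1 + σ : ℂ) = ((1 + σ : ℝ) : ℂ) := by push_cast; rfl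
      rw [this, norm_real, Real.norm_of_nonneg (by linarith)]; simp
    _ ≤ _ := by linarith

lemma norm_riemannZeta_product_ge_one {x : ℝ} (hx : 0 < x) (y : ℝ) :
    1 ≤ ‖riemannZeta (1 + x)‖ ^ 3 * ‖riemannZeta (1 + x + I * y)‖ ^ 4 *
      ‖riemannZeta (1 + x + 2 * I * y)‖ := by
  have := DirichletCharacter.norm_LFunction_product_ge_one (N := 1) 1 hx y
  simpa [DirichletCharacter.LFunctionTrivChar, DirichletCharacter.LFunction_modOne_eq] using this

lemma exists_norm_riemannZeta_one_add_le : ∃ B : ℝ, 1 ≤ B ∧ ∀ x : ℝ, 0 < x → x ≤ 1 →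
    ‖riemannZeta (1 + x)‖ ≤ B / x := by
  have hc : ContinuousOn (fun x : ℝ => riemannZeta₁ (1 + x)) (Set.Icc 0 1) :=
    (differentiable_riemannZeta₁.continuous.comp (by fun_prop)).continuousOn
  obtain ⟨B, hB⟩ := isCompact_Icc.exists_bound_of_continuousOn hc
  refine ⟨max B 1, le_max_right _ _, fun x hx hx1 => ?_⟩
  have h1 : (1 + x : ℂ) ≠ 1 := by simpa using hx.ne'
  rw [riemannZeta_eq_inv_sub_mul h1, norm_mul, norm_inv]
  have := hB x ⟨hx.le, hx1⟩
  simp only [add_sub_cancel_left, norm_real, Real.norm_of_nonneg hx.le]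
  rw [inv_mul_eq_div]
  gcongr
  exact this.trans (le_max_left _ _)

/-- A quantitative form of the non-vanishing of `ζ` on the line `Re s = 1`. -/
lemma exists_le_norm_riemannZeta : ∃ c : ℝ, 0 < c ∧ ∀ σ : ℝ, 0 < σ → σ ≤ 1 → ∀ t : ℝ, 1 ≤ |t| →
    c * |t| ^ (-4 / 3 : ℝ) ≤ ‖riemannZeta (1 + σ + I * t)‖ := by
  obtain ⟨B₁, hB₁, hz⟩ := exists_norm_riemannZeta_le
  obtain ⟨B₂, hB₂, hd⟩ := exists_norm_deriv_riemannZeta_le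
  obtain ⟨B₃, hB₃, h1⟩ := exists_norm_riemannZeta_one_add_le
  -- This is the constant for which 3-4-1 reads |ζ(1+σ+it)| ≥ c₁ σ^{3/4} |t|^{−1/12}.
  set c₁ : ℝ := ((B₃ ^ 3 * (6 * B₁))⁻¹) ^ (1 / 4 : ℝ) with hc₁
  have hc₁0 : 0 < c₁ := by positivity
  have hc₁4 : c₁ ^ 4 = (B₃ ^ 3 * (6 * B₁))⁻¹ := by
    rw [hc₁, ← Real.rpow_natCast, ← Real.rpow_mul (by positivity)]; norm_num
  have hc₁1 : c₁ ≤ 1 := by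
    apply Real.rpow_le_one (by positivity) _ (by norm_num)
    apply inv_le_one_of_one_le₀
    have : 1 ≤ B₃ ^ 3 := one_le_pow₀ hB₃
    nlinarith
  -- At σ = ρ⁴|t|^{−5/3} both the 3-4-1 bound σ^{3/4}|t|^{−1/12} and the possible variation
  -- σ|t|^{1/3} have order |t|^{−4/3}. The value of ρ makes the variation at most half of the lower
  -- bound.
  set ρ : ℝ := c₁ / (6 * B₂) with hρ
  have hρ0 : 0 < ρ := by positivity
  have hρ1 : ρ ≤ 1 := by
    rw [hρ, div_le_one (by positivity)]; linarith
  have hρB : ρ * (3 * B₂) = c₁ / 2 := by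
    rw [hρ]; field_simp; norm_num
  -- the bound for `σ` not too small
  have main : ∀ t : ℝ, 1 ≤ |t| → ∀ σ : ℝ, ρ ^ 4 * |t| ^ (-5 / 3 : ℝ) ≤ σ → σ ≤ 1 →
      c₁ * ρ ^ 3 * |t| ^ (-4 / 3 : ℝ) ≤ ‖riemannZeta (1 + σ + I * t)‖ := by
    intro t ht σ hσ hσ1
    have ht0 : 0 < |t| := by linarith
    have hσ0 : 0 < σ := lt_of_lt_of_le (by positivity) hσ
    have h341 := norm_riemannZeta_product_ge_one hσ0 t
    have e2 : (1 + σ + 2 * I * t : ℂ) = 1 + σ + I * (2 * t : ℝ) := by push_cast; ring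
    have ht2 : 1 ≤ |2 * t| := by rw [abs_mul, abs_two]; linarith
    have hz2 : ‖riemannZeta (1 + σ + 2 * I * t)‖ ≤ 6 * B₁ * |t| ^ (1 / 3 : ℝ) := by
      rw [e2]
      refine (hz _ (by simp; linarith) ?_).trans ?_
      · have := abs_im_le_norm ((1 + σ + I * (2 * t : ℝ) : ℂ) - 1)
        simp only [sub_im, add_im, one_im, ofReal_im, mul_im, I_re, I_im, ofReal_re] at this
        simp only [zero_mul, one_mul, zero_add, sub_zero] at this
        linarith
      · have := norm_le_three_mul hσ0.le hσ1 ht2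
        rw [abs_mul, abs_two, ← mul_assoc] at this
        calc B₁ * ‖(1 + σ + I * (2 * t : ℝ) : ℂ)‖ ^ (1 / 3 : ℝ)
            ≤ B₁ * (3 * 2 * |t|) ^ (1 / 3 : ℝ) := by gcongr
          _ = (6 : ℝ) ^ (1 / 3 : ℝ) * B₁ * |t| ^ (1 / 3 : ℝ) := by
            rw [Real.mul_rpow (by norm_num) ht0.le]; norm_num; ring
          _ ≤ _ := by
            gcongr
            exact Real.rpow_le_self_of_one_le (by norm_num) (by norm_num)
    have h5 : (c₁ * ρ ^ 3 * |t| ^ (-4 / 3 : ℝ)) ^ 4 ≤ ‖riemannZeta (1 + σ + I * t)‖ ^ 4 := by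
      have hA : 1 ≤ (B₃ / σ) ^ 3 * ‖riemannZeta (1 + σ + I * t)‖ ^ 4 *
          (6 * B₁ * |t| ^ (1 / 3 : ℝ)) := by
        refine h341.trans ?_
        gcongr
        exact h1 σ hσ0 hσ1
      have hB : (ρ ^ 4 * |t| ^ (-5 / 3 : ℝ)) ^ 3 ≤ σ ^ 3 := by gcongr
      have e3 : (c₁ * ρ ^ 3 * |t| ^ (-4 / 3 : ℝ)) ^ 4 * |t| ^ (1 / 3 : ℝ) =
          c₁ ^ 4 * (ρ ^ 4 * |t| ^ (-5 / 3 : ℝ)) ^ 3 := by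
        have : (|t| ^ (-4 / 3 : ℝ)) ^ 4 * |t| ^ (1 / 3 : ℝ) = (|t| ^ (-5 / 3 : ℝ)) ^ 3 := by
          rw [← Real.rpow_natCast, ← Real.rpow_natCast, ← Real.rpow_mul ht0.le,
            ← Real.rpow_mul ht0.le, ← Real.rpow_add ht0]
          norm_num
        linear_combination c₁ ^ 4 * ρ ^ 12 * this
      have hpos : 0 < |t| ^ (1 / 3 : ℝ) := by positivity
      refine le_of_mul_le_mul_right ?_ hpos
      rw [e3, hc₁4]
      refine (mul_le_mul_of_nonneg_left hB (by positivity)).trans ?_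
      have e4 : (B₃ / σ) ^ 3 * ‖riemannZeta (1 + σ + I * t)‖ ^ 4 * (6 * B₁ * |t| ^ (1 / 3 : ℝ)) =
        (B₃ ^ 3 * (6 * B₁)) / σ ^ 3 * (‖riemannZeta (1 + σ + I * t)‖ ^ 4 * |t| ^ (1 / 3 : ℝ)) := by
        field_simp
      rw [e4] at hA
      have h6 : 0 < B₃ ^ 3 * (6 * B₁) := by positivity
      rw [inv_mul_le_iff₀ h6]
      rw [div_mul_eq_mul_div, le_div_iff₀ (by positivity)] at hA
      linarith
    exact le_of_pow_le_pow_left₀ (by norm_num) (norm_nonneg _) h5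
  refine ⟨c₁ * ρ ^ 3 / 2, by positivity, fun σ hσ0 hσ1 t ht => ?_⟩
  have ht0 : 0 < |t| := by linarith
  rcases le_total (ρ ^ 4 * |t| ^ (-5 / 3 : ℝ)) σ with h | h
  · refine le_trans ?_ (main t ht σ h hσ1)
    gcongr
    linarith [show 0 < c₁ * ρ ^ 3 by positivity]
  -- Below the threshold, ζ is compared with its value at abscissa 1 + η and the same height.
  · set η := ρ ^ 4 * |t| ^ (-5 / 3 : ℝ) with hη
    have hη1 : η ≤ 1 := by
      have h1 : ρ ^ 4 ≤ 1 := pow_le_one₀ hρ0.le hρ1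
      have h2 : |t| ^ (-5 / 3 : ℝ) ≤ 1 := Real.rpow_le_one_of_one_le_of_nonpos ht (by norm_num)
      exact mul_le_one₀ h1 (by positivity) h2
    have h2 := main t ht η le_rfl hη1
    have h3 : ‖riemannZeta (1 + η + I * t) - riemannZeta (1 + σ + I * t)‖ ≤
        3 * B₂ * |t| ^ (1 / 3 : ℝ) * (η - σ) := by
      have := (convex_Icc 0 (1 : ℝ)).norm_image_sub_le_of_norm_hasDerivWithin_le
        (f := fun x : ℝ => riemannZeta (1 + x + I * t))
        (f' := fun x : ℝ => deriv riemannZeta (1 + x + I * t))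
        (C := 3 * B₂ * |t| ^ (1 / 3 : ℝ)) (x := σ) (y := η) ?_ ?_ ⟨hσ0.le, hσ1⟩
        ⟨hσ0.le.trans h, hη1⟩
      · simpa [Real.norm_of_nonneg (sub_nonneg.mpr h)] using this
      · intro x hx
        have hne : (1 + x + I * t : ℂ) ≠ 1 := by
          intro h
          have := congrArg Complex.im h
          simp at this
          rw [this] at ht0
          simp at ht0
        have hd1 := (differentiableAt_riemannZeta hne).hasDerivAt
        have hd2 : HasDerivAt (fun z : ℂ => 1 + z + I * t) 1 (x : ℂ) := by
          simpa using ((hasDerivAt_id (x : ℂ)).const_add 1).add_const (I * t)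
        have := (HasDerivAt.comp (x : ℂ) hd1 hd2).comp_ofReal
        simpa using this.hasDerivWithinAt
      · intro x hx
        refine (hd _ (by simpa using hx.1) (by simpa using ht)).trans ?_
        calc B₂ * ‖(1 + x + I * t : ℂ)‖ ^ (1 / 3 : ℝ) ≤ B₂ * (3 * |t|) ^ (1 / 3 : ℝ) := by
              gcongr; exact norm_le_three_mul hx.1 hx.2 ht
          _ = (3 : ℝ) ^ (1 / 3 : ℝ) * B₂ * |t| ^ (1 / 3 : ℝ) := by
            rw [Real.mul_rpow (by norm_num) ht0.le]; ring
          _ ≤ _ := by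
            gcongr
            exact Real.rpow_le_self_of_one_le (by norm_num) (by norm_num)
    have h4 : 3 * B₂ * |t| ^ (1 / 3 : ℝ) * (η - σ) ≤ c₁ * ρ ^ 3 / 2 * |t| ^ (-4 / 3 : ℝ) := by
      calc 3 * B₂ * |t| ^ (1 / 3 : ℝ) * (η - σ) ≤ 3 * B₂ * |t| ^ (1 / 3 : ℝ) * η := by
            gcongr; linarith
        _ = ρ ^ 3 * (ρ * (3 * B₂)) * (|t| ^ (1 / 3 : ℝ) * |t| ^ (-5 / 3 : ℝ)) := by
          rw [hη]; ring
        _ = _ := by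
          rw [hρB, ← Real.rpow_add ht0, show (1 / 3 + -5 / 3 : ℝ) = -4 / 3 by norm_num]; ring
    have h5 := norm_sub_norm_le (riemannZeta (1 + η + I * t)) (riemannZeta (1 + σ + I * t))
    linarith

end SelbergSieve

end

/-! ### Bounds for `laplaceH` uniform in 0 < Re s ≤ 1. -/

section

open Complex

namespace SelbergSieve

/-- The Laplace transform of `∑ μ(m)/m (u - log m)₊ - (1 - e^{-u})`. -/
noncomputable def laplaceH (s : ℂ) : ℂ := 1 / (s ^ 2 * riemannZeta (1 + s)) - 1 / (s * (1 + s))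

lemma riemannZeta₁_one_add_ne_zero {s : ℂ} (hs : 0 ≤ s.re) : riemannZeta₁ (1 + s) ≠ 0 := by
  by_cases h : s = 0
  · simp [h]
  · have h1 : (1 + s) ≠ 1 := by simpa using h
    have h2 := riemannZeta_ne_zero_of_one_le_re (s := 1 + s) (by simpa using hs)
    rw [riemannZeta_eq_inv_sub_mul h1] at h2
    exact right_ne_zero_of_mul h2

/-- `laplaceH` is the difference quotient at 0 of (riemannZeta₁(1+s))⁻¹ − (1+s)⁻¹, which vanishes at
0, so there is no pole. Non-vanishing of ζ on Re s = 1 keeps the quotient continuous on a closed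
rectangle reaching Re s = 0. -/
lemma exists_norm_laplaceH_le_of_small : ∃ K : ℝ, 0 ≤ K ∧ ∀ s : ℂ, 0 < s.re → s.re ≤ 1 → |s.im| ≤ 1 →
    ‖laplaceH s‖ ≤ K := by
  set φ : ℂ → ℂ := fun s => (riemannZeta₁ (1 + s))⁻¹ - (1 + s)⁻¹ with hφ
  have hφ0 : φ 0 = 0 := by simp [hφ]
  have hne : ∀ s : ℂ, 0 ≤ s.re → 1 + s ≠ 0 := by
    intro s hs h
    have := congrArg re h
    simp at this; linarith
  have hd : ∀ s : ℂ, 0 ≤ s.re → DifferentiableAt ℂ φ s := by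
    intro s hs
    refine DifferentiableAt.sub (DifferentiableAt.inv ?_ (riemannZeta₁_one_add_ne_zero hs))
      (DifferentiableAt.inv (by fun_prop) (hne s hs))
    exact (differentiable_riemannZeta₁ (1 + s)).comp s (by fun_prop)
  have hc : ContinuousOn (dslope φ 0) (Set.Icc 0 1 ×ℂ Set.Icc (-1) 1) := by
    intro s hs
    have hre : 0 ≤ s.re := hs.1.1
    by_cases h : s = 0
    · subst h
      exact (continuousAt_dslope_same.mpr (hd 0 (by simp))).continuousWithinAt
    · exact ((continuousAt_dslope_of_ne h).mpr (hd s hre).continuousAt).continuousWithinAt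
  obtain ⟨K, hK⟩ := (isCompact_Icc.reProdIm isCompact_Icc).exists_bound_of_continuousOn hc
  refine ⟨max K 0, le_max_right _ _, fun s h0 h1 ht => ?_⟩
  have hs : s ≠ 0 := by rintro rfl; simp at h0
  have := hK s ⟨⟨h0.le, h1⟩, abs_le.mp ht⟩
  refine le_trans (le_of_eq ?_) (this.trans (le_max_left _ _))
  rw [dslope_of_ne _ hs, slope_def_field, hφ0, laplaceH, hφ]
  have h2 := riemannZeta₁_one_add_ne_zero h0.le
  have h3 := hne s h0.le
  rw [riemannZeta_eq_inv_sub_mul (by simpa using hs)]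
  congr 1
  simp only [add_sub_cancel_left]
  field_simp
  ring

lemma exists_norm_laplaceH_le_of_large : ∃ K : ℝ, 0 ≤ K ∧ ∀ s : ℂ, 0 < s.re → s.re ≤ 1 → 1 ≤ |s.im| →
    ‖laplaceH s‖ ≤ K * |s.im| ^ (-2 / 3 : ℝ) := by
  obtain ⟨c, hc, hz⟩ := exists_le_norm_riemannZeta
  refine ⟨c⁻¹ + 1, by positivity, fun s h0 h1 ht => ?_⟩
  have ht0 : 0 < |s.im| := by linarith
  have hs1 : |s.im| ≤ ‖s‖ := abs_im_le_norm s
  have hs2 : |s.im| ≤ ‖1 + s‖ := by simpa using abs_im_le_norm (1 + s)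
  have e : (1 + s.re + I * s.im : ℂ) = 1 + s := by
    rw [mul_comm, add_assoc, re_add_im]
  have hz' := hz s.re h0 h1 s.im ht
  rw [e] at hz'
  have hA : ‖1 / (s ^ 2 * riemannZeta (1 + s))‖ ≤ c⁻¹ * |s.im| ^ (-2 / 3 : ℝ) := by
    rw [norm_div, norm_one, norm_mul, norm_pow]
    have e3 : c⁻¹ * |s.im| ^ (-2 / 3 : ℝ) = 1 / (|s.im| ^ 2 * (c * |s.im| ^ (-4 / 3 : ℝ))) := by
      rw [← Real.rpow_natCast, mul_left_comm, ← Real.rpow_add ht0, one_div, mul_inv,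
        ← Real.rpow_neg ht0.le]
      norm_num
    rw [e3]
    gcongr
  have hB : ‖1 / (s * (1 + s))‖ ≤ 1 * |s.im| ^ (-2 / 3 : ℝ) := by
    rw [norm_div, norm_one, norm_mul, one_mul]
    calc 1 / (‖s‖ * ‖1 + s‖) ≤ 1 / (|s.im| * |s.im|) := by gcongr
      _ = |s.im| ^ (-2 : ℝ) := by
        rw [Real.rpow_neg ht0.le, one_div]; norm_num [sq]
      _ ≤ _ := Real.rpow_le_rpow_of_exponent_le ht (by norm_num)
  rw [laplaceH]
  refine (norm_sub_le _ _).trans ?_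
  linarith

/-- The exponent −4/3 = 2(−2 + 4/3) lies below −1, so the squares are integrable in Im s, uniformly
in Re s. -/
lemma exists_norm_laplaceH_sq_le : ∃ K : ℝ, 0 ≤ K ∧ ∀ s : ℂ, 0 < s.re → s.re ≤ 1 →
    ‖laplaceH s‖ ^ 2 ≤ K * (1 + |s.im|) ^ (-4 / 3 : ℝ) := by
  obtain ⟨K₁, hK₁, h₁⟩ := exists_norm_laplaceH_le_of_small
  obtain ⟨K₂, hK₂, h₂⟩ := exists_norm_laplaceH_le_of_large
  have h4 : (1 : ℝ) ≤ 4 * 2 ^ (-4 / 3 : ℝ) := by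
    have : (2 : ℝ) ^ (-2 : ℝ) ≤ 2 ^ (-4 / 3 : ℝ) :=
      Real.rpow_le_rpow_of_exponent_le (by norm_num) (by norm_num)
    have e : (2 : ℝ) ^ (-2 : ℝ) = 1 / 4 := by
      rw [Real.rpow_neg (by norm_num)]; norm_num
    linarith
  refine ⟨4 * (K₁ ^ 2 + K₂ ^ 2), by positivity, fun s h0 h1 => ?_⟩
  rcases le_total (|s.im|) 1 with ht | ht
  · calc ‖laplaceH s‖ ^ 2 ≤ K₁ ^ 2 := by gcongr; exact h₁ s h0 h1 ht
      _ ≤ (K₁ ^ 2 + K₂ ^ 2) * 1 := by nlinarith [sq_nonneg K₂]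
      _ ≤ (K₁ ^ 2 + K₂ ^ 2) * (4 * 2 ^ (-4 / 3 : ℝ)) := by gcongr
      _ = 4 * (K₁ ^ 2 + K₂ ^ 2) * 2 ^ (-4 / 3 : ℝ) := by ring
      _ ≤ _ := by
        gcongr 4 * (K₁ ^ 2 + K₂ ^ 2) * ?_
        exact Real.rpow_le_rpow_of_nonpos (by positivity) (by linarith) (by norm_num)
  · have ht0 : 0 < |s.im| := by linarith
    calc ‖laplaceH s‖ ^ 2 ≤ (K₂ * |s.im| ^ (-2 / 3 : ℝ)) ^ 2 := by gcongr; exact h₂ s h0 h1 ht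
      _ = K₂ ^ 2 * 1 * |s.im| ^ (-4 / 3 : ℝ) := by
        rw [mul_pow, ← Real.rpow_natCast (|s.im| ^ (-2 / 3 : ℝ)), ← Real.rpow_mul ht0.le]; norm_num
      _ ≤ (K₁ ^ 2 + K₂ ^ 2) * (4 * 2 ^ (-4 / 3 : ℝ)) * |s.im| ^ (-4 / 3 : ℝ) := by
        gcongr
        nlinarith [sq_nonneg K₁]
      _ = 4 * (K₁ ^ 2 + K₂ ^ 2) * (2 * |s.im|) ^ (-4 / 3 : ℝ) := by
        rw [Real.mul_rpow (by norm_num) ht0.le]; ring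
      _ ≤ _ := by
        gcongr 4 * (K₁ ^ 2 + K₂ ^ 2) * ?_
        exact Real.rpow_le_rpow_of_nonpos (by positivity) (by linarith) (by norm_num)

end SelbergSieve

end

/-! ### Plancherel's identity and the Laplace transform of a ramp. -/

section

open Complex MeasureTheory Filter
open scoped FourierTransform RealInnerProductSpace ArithmeticFunction.Moebius

namespace SelbergSieve

/-- Plancherel's identity for a continuous integrable function with integrable transform. -/
lemma integral_norm_sq_fourier_eq {f : ℝ → ℂ} (hc : Continuous f) (hf : Integrable f)
    (hF : Integrable (𝓕 f)) : ∫ ξ, ‖𝓕 f ξ‖ ^ 2 = ∫ x, ‖f x‖ ^ 2 := by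
  have h := VectorFourier.integral_sesq_fourierIntegral_eq_neg_flip (innerSL ℂ)
    (L := innerₗ ℝ) Real.continuous_fourierChar continuous_inner hf hF
  have h2 : ∫ ξ, inner ℂ (𝓕 f ξ) (𝓕 f ξ) = ∫ x, inner ℂ (f x) (𝓕⁻ (𝓕 f) x) := by
    rw [flip_innerₗ] at h
    exact h
  rw [hc.fourierInv_fourier_eq hf hF] at h2
  simp only [inner_self_eq_norm_sq_to_K] at h2
  apply ofReal_injective
  rw [← integral_complex_ofReal, ← integral_complex_ofReal]
  simpa using h2

/-- The kernel `v₊ e^{-sv}`. -/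
noncomputable def rampKernel (s : ℂ) (v : ℝ) : ℂ := (max v 0 : ℝ) * exp (-s * v)

lemma norm_rampKernel (s : ℂ) (v : ℝ) : ‖rampKernel s v‖ = max v 0 * Real.exp (-s.re * v) := by
  rw [rampKernel, norm_mul, norm_real, Real.norm_of_nonneg (le_max_right _ _), norm_exp]
  simp

lemma one_add_le_mul_exp {c : ℝ} (hc : 0 < c) {v : ℝ} (hv : 0 ≤ v) :
    1 + v ≤ (1 + c⁻¹) * Real.exp (c * v) := by
  have h1 : 1 ≤ Real.exp (c * v) := Real.one_le_exp (by positivity)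
  have h2 : c * v ≤ Real.exp (c * v) := by linarith [Real.add_one_le_exp (c * v)]
  have h3 : v ≤ c⁻¹ * Real.exp (c * v) := by rw [le_inv_mul_iff₀ hc]; exact h2
  linarith

lemma integrable_rampKernel {s : ℂ} (hs : 0 < s.re) : Integrable (rampKernel s) := by
  have hm : AEStronglyMeasurable (rampKernel s) volume := by
    apply Continuous.aestronglyMeasurable
    unfold rampKernel
    fun_prop
  rw [← integrableOn_univ, ← Set.Iic_union_Ioi (a := (0 : ℝ)), integrableOn_union]
  constructor
  · refine (integrableOn_zero).congr_fun (fun v hv => ?_) measurableSet_Iic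
    rw [rampKernel, max_eq_right hv]; simp
  · refine Integrable.mono' ((integrableOn_exp_mul_Ioi (a := -(s.re / 2)) (by linarith) 0).const_mul
      (1 + (s.re / 2)⁻¹)) hm.restrict ?_
    refine (ae_restrict_iff' measurableSet_Ioi).mpr (ae_of_all _ fun v hv => ?_)
    have hv : 0 < v := hv
    rw [norm_rampKernel, max_eq_left hv.le]
    have := one_add_le_mul_exp (half_pos hs) hv.le
    calc v * Real.exp (-s.re * v) ≤ (1 + (s.re / 2)⁻¹) * Real.exp (s.re / 2 * v) * Real.exp (-s.re * v) := by
          gcongr; linarith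
      _ = _ := by rw [mul_assoc, ← Real.exp_add]; ring_nf

lemma integral_rampKernel {s : ℂ} (hs : 0 < s.re) : ∫ v, rampKernel s v = 1 / s ^ 2 := by
  have hs0 : s ≠ 0 := by rintro rfl; simp at hs
  have h0 : ∫ v, rampKernel s v = ∫ v in Set.Ioi (0 : ℝ), rampKernel s v := by
    refine (setIntegral_eq_integral_of_forall_compl_eq_zero fun v hv => ?_).symm
    rw [rampKernel, max_eq_right (by simpa using hv)]; simp
  rw [h0]
  have hd : ∀ x ∈ Set.Ici (0 : ℝ), HasDerivAt
      (fun v : ℝ => -(((v : ℂ) / s + 1 / s ^ 2) * exp (-s * v))) (rampKernel s x) x := by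
    intro x hx
    have h1 : HasDerivAt (fun v : ℂ => -((v / s + 1 / s ^ 2) * exp (-s * v)))
        (x * exp (-s * x)) (x : ℂ) := by
      have a := ((hasDerivAt_id (x : ℂ)).div_const s).add_const (1 / s ^ 2)
      have b := (((hasDerivAt_id (x : ℂ)).const_mul (-s))).cexp
      convert! (a.mul b).neg using 1
      simp
      field_simp
      ring
    have h2 := h1.comp_ofReal
    rwa [rampKernel, max_eq_left hx]
  have ht : Tendsto (fun v : ℝ => -(((v : ℂ) / s + 1 / s ^ 2) * exp (-s * v))) atTop (nhds 0) := by
    rw [tendsto_zero_iff_norm_tendsto_zero]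
    set A := max (1 / ‖s‖) (1 / ‖s‖ ^ 2)
    have hlim : Tendsto (fun v : ℝ => A * (1 + (s.re / 2)⁻¹) * Real.exp (-(s.re / 2 * v)))
        atTop (nhds 0) := by
      have : Tendsto (fun v : ℝ => s.re / 2 * v) atTop atTop :=
        tendsto_id.const_mul_atTop (half_pos hs)
      simpa using (Real.tendsto_exp_neg_atTop_nhds_zero.comp this).const_mul (A * (1 + (s.re / 2)⁻¹))
    refine squeeze_zero' (Eventually.of_forall fun _ => norm_nonneg _) ?_ hlim
    filter_upwards [eventually_ge_atTop 0] with v hv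
    have hA : ‖(v : ℂ) / s + 1 / s ^ 2‖ ≤ A * (1 + v) := by
      refine (norm_add_le _ _).trans ?_
      rw [norm_div, norm_div, norm_real, Real.norm_of_nonneg hv, norm_one, norm_pow]
      have h1 : 1 / ‖s‖ ≤ A := le_max_left _ _
      have h2 : 1 / ‖s‖ ^ 2 ≤ A := le_max_right _ _
      calc v / ‖s‖ + 1 / ‖s‖ ^ 2 = v * (1 / ‖s‖) + 1 / ‖s‖ ^ 2 := by ring
        _ ≤ v * A + A := by gcongr
        _ = _ := by ring
    rw [norm_neg, norm_mul, norm_exp]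
    have h3 := one_add_le_mul_exp (half_pos hs) hv
    have hA0 : 0 ≤ A := le_trans (by positivity) (le_max_left _ _)
    calc _ ≤ A * ((1 + (s.re / 2)⁻¹) * Real.exp (s.re / 2 * v)) * Real.exp (-s * v).re := by
          gcongr
          exact hA.trans (by gcongr)
      _ = A * (1 + (s.re / 2)⁻¹) * (Real.exp (s.re / 2 * v) * Real.exp (-s * v).re) := by ring
      _ = _ := by
        rw [← Real.exp_add]
        congr 2
        simp; ring
  have := integral_Ioi_of_hasDerivAt_of_tendsto' hd (integrable_rampKernel hs).integrableOn ht
  rw [this]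
  simp

end SelbergSieve

end

/-! ### The smoothed Möbius sum, its error `moebiusErr`, and the Laplace transform of the error. -/

section

open Complex MeasureTheory Filter
open scoped FourierTransform RealInnerProductSpace ArithmeticFunction.Moebius

namespace SelbergSieve

/-- `∑_{m ≤ x} μ(m)/m log(x/m)`. -/
noncomputable def logMoebius (x : ℝ) : ℝ :=
  ∑ m ∈ Finset.Icc 1 ⌊x⌋₊, (μ m : ℝ) / m * Real.log (x / m)

/-- The difference between `∑_{m ≤ x} μ(m)/m log(x/m)` at `x = e^u` and `(1 - e^{-u})₊`. -/
noncomputable def moebiusErr (u : ℝ) : ℝ :=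
  logMoebius (Real.exp u) - (1 - Real.exp (-max u 0))

lemma abs_moebius_le_one (m : ℕ) : |(μ m : ℝ)| ≤ 1 := by
  exact_mod_cast ArithmeticFunction.abs_moebius_le_one (n := m)

lemma logMoebius_term_eq {u : ℝ} {m : ℕ} (hm : 1 ≤ m) (h : m ≤ ⌊Real.exp u⌋₊) :
    Real.log (Real.exp u / m) = max (u - Real.log m) 0 := by
  have hm0 : (0 : ℝ) < m := by exact_mod_cast hm
  have h1 : (m : ℝ) ≤ Real.exp u := (Nat.le_floor_iff (Real.exp_pos u).le).mp h
  have h2 : Real.log m ≤ u := by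
    rw [← Real.log_exp u]; exact Real.log_le_log hm0 h1
  rw [Real.log_div (Real.exp_pos u).ne' hm0.ne', Real.log_exp, max_eq_left (by linarith)]

lemma max_sub_log_eq_zero {u : ℝ} {m : ℕ} (h : ⌊Real.exp u⌋₊ < m) :
    max (u - Real.log m) 0 = 0 := by
  have h1 : Real.exp u < m := (Nat.floor_lt (Real.exp_pos u).le).mp h
  have h2 : u < Real.log m := by
    rw [← Real.log_exp u]; exact Real.log_lt_log (Real.exp_pos u) h1
  exact max_eq_right (by linarith)

lemma logMoebius_exp_eq {u : ℝ} {M : ℕ} (hM : ⌊Real.exp u⌋₊ ≤ M) :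
    logMoebius (Real.exp u) = ∑ m ∈ Finset.Icc 1 M, (μ m : ℝ) / m * max (u - Real.log m) 0 := by
  rw [logMoebius]
  have hsub : Finset.Icc 1 ⌊Real.exp u⌋₊ ⊆ Finset.Icc 1 M := Finset.Icc_subset_Icc_right hM
  rw [← Finset.sum_subset hsub]
  · refine Finset.sum_congr rfl fun m hm => ?_
    rw [Finset.mem_Icc] at hm
    rw [logMoebius_term_eq hm.1 hm.2]
  · intro m hm hm'
    rw [Finset.mem_Icc] at hm hm'
    rw [max_sub_log_eq_zero (by omega), mul_zero]

lemma hasSum_logMoebius_exp (u : ℝ) :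
    HasSum (fun m : ℕ => (μ m : ℝ) / m * max (u - Real.log m) 0) (logMoebius (Real.exp u)) := by
  rw [logMoebius_exp_eq le_rfl]
  refine hasSum_sum_of_ne_finset_zero fun m hm => ?_
  rw [Finset.mem_Icc, not_and_or] at hm
  rcases hm with hm | hm
  · have : m = 0 := by omega
    simp [this]
  · rw [max_sub_log_eq_zero (by omega), mul_zero]

/-- Locally the sum is a finite sum of ramps. Subtracting 1 − e^{−u} rather than 1 avoids a jump at
u = 0, and this gives the transform the |t|⁻² decay that Fourier inversion uses. -/
lemma continuous_moebiusErr : Continuous moebiusErr := by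
  have h : Continuous fun u => logMoebius (Real.exp u) := by
    rw [continuous_iff_continuousAt]
    intro u
    have hc : Continuous fun v : ℝ =>
        ∑ m ∈ Finset.Icc 1 ⌊Real.exp (u + 1)⌋₊, (μ m : ℝ) / m * max (v - Real.log m) 0 := by
      fun_prop
    refine hc.continuousAt.congr ?_
    filter_upwards [Iio_mem_nhds (show u < u + 1 by linarith)] with v hv
    exact (logMoebius_exp_eq (Nat.floor_le_floor (Real.exp_le_exp.mpr (le_of_lt hv)))).symm
  unfold moebiusErr
  fun_prop

lemma moebiusErr_of_nonpos {u : ℝ} (hu : u ≤ 0) : moebiusErr u = 0 := by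
  rw [moebiusErr, max_eq_right hu, logMoebius_exp_eq (M := 1)]
  · simp [hu]
  · exact Nat.floor_le_of_le (by simpa using hu)

lemma sum_Icc_inv_le {x : ℝ} (hx : 1 ≤ x) :
    ∑ m ∈ Finset.Icc 1 ⌊x⌋₊, (m : ℝ)⁻¹ ≤ 1 + Real.log x := by
  have := harmonic_floor_le_one_add_log x hx
  rw [harmonic_eq_sum_Icc] at this
  push_cast at this
  exact this

lemma log_le_sum_Icc_inv {x : ℝ} (hx : 0 ≤ x) :
    Real.log x ≤ ∑ m ∈ Finset.Icc 1 ⌊x⌋₊, (m : ℝ)⁻¹ := by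
  have := log_le_harmonic_floor x hx
  rw [harmonic_eq_sum_Icc] at this
  push_cast at this
  exact this

/-- A crude bound, sufficient for convergence of the Laplace integral in Re s > 0. -/
lemma abs_moebiusErr_le {u : ℝ} (hu : 0 ≤ u) : |moebiusErr u| ≤ (1 + u) ^ 2 := by
  have h1 : |logMoebius (Real.exp u)| ≤ (1 + u) * u := by
    have hsum := sum_Icc_inv_le (Real.one_le_exp hu)
    rw [Real.log_exp] at hsum
    rw [logMoebius_exp_eq le_rfl]
    calc _ ≤ ∑ m ∈ Finset.Icc 1 ⌊Real.exp u⌋₊, (m : ℝ)⁻¹ * u := by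
          refine (Finset.abs_sum_le_sum_abs _ _).trans (Finset.sum_le_sum fun m hm => ?_)
          rw [Finset.mem_Icc] at hm
          have hm1 : (1 : ℝ) ≤ m := by exact_mod_cast hm.1
          have hl : 0 ≤ Real.log m := Real.log_nonneg hm1
          rw [abs_mul, abs_div, abs_of_nonneg (show (0 : ℝ) ≤ m by linarith),
            abs_of_nonneg (le_max_right (u - Real.log m) 0), div_eq_mul_inv]
          have := abs_moebius_le_one m
          calc |(μ m : ℝ)| * (m : ℝ)⁻¹ * max (u - Real.log m) 0
              ≤ 1 * (m : ℝ)⁻¹ * u := by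
                gcongr
                exact max_le (by linarith) hu
            _ = _ := by ring
      _ ≤ _ := by
        rw [← Finset.sum_mul]
        gcongr
  have h2 : |1 - Real.exp (-max u 0)| ≤ 1 := by
    rw [abs_le]
    have := Real.exp_pos (-max u 0)
    have h3 : Real.exp (-max u 0) ≤ 1 := Real.exp_le_one_iff.mpr (by simp)
    constructor <;> linarith
  rw [moebiusErr]
  calc _ ≤ _ := abs_sub _ _
    _ ≤ (1 + u) ^ 2 := by nlinarith

lemma integrable_moebiusErr_mul_exp {s : ℂ} (hs : 0 < s.re) :
    Integrable fun u : ℝ => (moebiusErr u : ℂ) * exp (-s * u) := by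
  have hm : AEStronglyMeasurable (fun u : ℝ => (moebiusErr u : ℂ) * exp (-s * u)) volume := by
    apply Continuous.aestronglyMeasurable
    have := continuous_moebiusErr
    fun_prop
  rw [← integrableOn_univ, ← Set.Iic_union_Ioi (a := (0 : ℝ)), integrableOn_union]
  constructor
  · refine (integrableOn_zero).congr_fun (fun v hv => ?_) measurableSet_Iic
    rw [moebiusErr_of_nonpos hv]; simp
  · refine Integrable.mono' ((integrableOn_exp_mul_Ioi (a := -(s.re / 2)) (by linarith) 0).const_mul
      ((1 + (s.re / 4)⁻¹) ^ 2)) hm.restrict ?_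
    refine (ae_restrict_iff' measurableSet_Ioi).mpr (ae_of_all _ fun v hv => ?_)
    have hv : 0 < v := hv
    have h1 := one_add_le_mul_exp (show 0 < s.re / 4 by positivity) hv.le
    rw [norm_mul, norm_real, norm_exp]
    calc ‖moebiusErr v‖ * Real.exp (-s * v).re ≤
        ((1 + (s.re / 4)⁻¹) * Real.exp (s.re / 4 * v)) ^ 2 * Real.exp (-s * v).re := by
          gcongr
          exact (abs_moebiusErr_le hv.le).trans (by gcongr)
      _ = (1 + (s.re / 4)⁻¹) ^ 2 * (Real.exp (s.re / 4 * v) * Real.exp (s.re / 4 * v) *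
          Real.exp (-s * v).re) := by ring
      _ = _ := by
        rw [← Real.exp_add, ← Real.exp_add]
        congr 2
        simp; ring

lemma moebius_ramp_eq {s : ℂ} {m : ℕ} (u : ℝ) :
    ((μ m : ℝ) / m * max (u - Real.log m) 0 : ℝ) * exp (-s * u) =
      ((μ m : ℂ) / m * (m : ℂ) ^ (-s)) * rampKernel s (u - Real.log m) := by
  rcases Nat.eq_zero_or_pos m with rfl | hm
  · simp
  · have hm0 : (m : ℂ) ≠ 0 := by exact_mod_cast hm.ne'
    rw [rampKernel, cpow_def_of_ne_zero hm0]
    have : exp (-s * u) = exp (Complex.log m * -s) * exp (-s * ((u - Real.log m : ℝ) : ℂ)) := by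
      rw [← exp_add, ← natCast_log]
      push_cast
      ring_nf
    rw [this]
    push_cast
    ring

lemma hasSum_moebius_rpow {s : ℂ} (hs : 0 < s.re) :
    HasSum (fun m : ℕ => (μ m : ℂ) / m * (m : ℂ) ^ (-s)) (1 / riemannZeta (1 + s)) := by
  have h1 : 1 < (1 + s).re := by simpa using hs
  have hS := (ArithmeticFunction.LSeriesSummable_moebius_iff.mpr h1).LSeriesHasSum
  have h2 := LSeries_one_mul_Lseries_moebius h1
  rw [LSeries_one_eq_riemannZeta h1] at h2
  have h3 : LSeries (fun n => ((μ n : ℤ) : ℂ)) (1 + s) = 1 / riemannZeta (1 + s) :=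
    eq_one_div_of_mul_eq_one_right h2
  rw [LSeriesHasSum, h3] at hS
  refine hS.congr_fun fun m => ?_
  rcases Nat.eq_zero_or_pos m with rfl | hm
  · simp
  · have hm0 : (m : ℂ) ≠ 0 := by exact_mod_cast hm.ne'
    rw [LSeries.term_of_ne_zero hm.ne', cpow_add _ _ hm0, cpow_one, cpow_neg]
    field_simp

/-- The ramp starting at log m contributes μ(m) m^{−1−s}/s², and these add up to 1/(s²ζ(1+s)). The
part 1 − e^{−u} contributes 1/s − 1/(1+s). -/
lemma integral_moebiusErr_mul_exp {s : ℂ} (hs : 0 < s.re) :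
    ∫ u : ℝ, (moebiusErr u : ℂ) * exp (-s * u) = laplaceH s := by
  have hs0 : s ≠ 0 := by rintro rfl; simp at hs
  have hs1 : 1 + s ≠ 0 := by
    intro h
    have := congrArg re h
    simp at this; linarith
  set F : ℕ → ℝ → ℂ := fun m u => ((μ m : ℂ) / m * (m : ℂ) ^ (-s)) * rampKernel s (u - Real.log m)
  have hF : ∀ m, Integrable (F m) := fun m =>
    ((integrable_rampKernel hs).comp_sub_right (Real.log m)).const_mul _
  have hFn : ∀ m, ∫ u, ‖F m u‖ = ‖(μ m : ℂ) / m * (m : ℂ) ^ (-s)‖ * ∫ v, ‖rampKernel s v‖ := by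
    intro m
    simp only [F, norm_mul]
    rw [integral_const_mul, integral_sub_right_eq_self (fun v => ‖rampKernel s v‖)]
  have hsum : Summable fun m => ∫ u, ‖F m u‖ := by
    simp_rw [hFn]
    exact (hasSum_moebius_rpow hs).summable.norm.mul_right _
  have h1 := hasSum_integral_of_summable_integral_norm hF hsum
  have hFi : ∀ m, ∫ u, F m u = ((μ m : ℂ) / m * (m : ℂ) ^ (-s)) * (1 / s ^ 2) := by
    intro m
    simp only [F]
    rw [integral_const_mul, integral_sub_right_eq_self (fun v => rampKernel s v),
      integral_rampKernel hs]
  simp_rw [hFi] at h1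
  have h2 := h1.unique ((hasSum_moebius_rpow hs).mul_right (1 / s ^ 2))
  have hpt : ∀ u : ℝ, ∑' m, F m u = (logMoebius (Real.exp u) : ℂ) * exp (-s * u) := by
    intro u
    have := (hasSum_ofReal.mpr (hasSum_logMoebius_exp u)).mul_right (exp (-s * u))
    refine HasSum.tsum_eq (this.congr_fun fun m => ?_)
    exact (moebius_ramp_eq u).symm
  simp_rw [hpt] at h2
  set E : ℝ → ℂ := fun u => ((1 - Real.exp (-max u 0) : ℝ) : ℂ) * exp (-s * u) with hE
  have hE0 : ∀ u ∉ Set.Ioi (0 : ℝ), E u = 0 := by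
    intro u hu
    have hu : u ≤ 0 := not_lt.mp hu
    simp [hE, max_eq_right hu]
  have hEeq : Set.EqOn E (fun u : ℝ => exp (-s * u) - exp (-(1 + s) * u)) (Set.Ioi 0) := by
    intro u hu
    have hu : 0 < u := hu
    simp only [hE, max_eq_left hu.le]
    rw [show -(1 + s) * (u : ℂ) = -u + -s * u by ring, exp_add]
    push_cast
    ring
  have hsn : (-s).re < 0 := by simpa using hs
  have hsn1 : (-(1 + s)).re < 0 := by simp; linarith
  have i1 := integrableOn_exp_mul_complex_Ioi hsn 0
  have i2 := integrableOn_exp_mul_complex_Ioi hsn1 0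
  have hEint : Integrable E := by
    rw [← integrableOn_iff_integrable_of_support_subset (s := Set.Ioi (0 : ℝ))]
    · exact (i1.sub i2).congr_fun hEeq.symm measurableSet_Ioi
    · intro u hu
      by_contra h
      exact hu (hE0 u h)
  have hEI : ∫ u, E u = 1 / (s * (1 + s)) := by
    rw [← setIntegral_eq_integral_of_forall_compl_eq_zero hE0,
      setIntegral_congr_fun measurableSet_Ioi hEeq, integral_sub i1 i2,
      integral_exp_mul_complex_Ioi hsn, integral_exp_mul_complex_Ioi hsn1]
    simp only [ofReal_zero, mul_zero, exp_zero]
    field_simp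
    ring
  have hsplit : ∀ u : ℝ, (moebiusErr u : ℂ) * exp (-s * u) =
      (logMoebius (Real.exp u) : ℂ) * exp (-s * u) - E u := by
    intro u
    simp only [moebiusErr, hE]
    push_cast
    ring
  have hL : Integrable fun u : ℝ => (logMoebius (Real.exp u) : ℂ) * exp (-s * u) := by
    refine ((integrable_moebiusErr_mul_exp hs).add hEint).congr (ae_of_all _ fun u => ?_)
    simp only [Pi.add_apply, hsplit u]
    ring
  simp_rw [hsplit]
  rw [integral_sub hL hEint, h2, hEI, laplaceH]
  congr 1
  rw [one_div_mul_one_div, mul_comm]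

end SelbergSieve

end

/-! ### The L² bound for `moebiusErr` through Plancherel. -/

section

open Complex MeasureTheory Filter
open scoped FourierTransform RealInnerProductSpace ArithmeticFunction.Moebius

namespace SelbergSieve

lemma norm_moebius_term (s : ℂ) (m : ℕ) :
    ‖(μ m : ℂ) / m * (m : ℂ) ^ (-s)‖ = ‖(μ m : ℂ) / m * (m : ℂ) ^ (-(s.re : ℂ))‖ := by
  rcases Nat.eq_zero_or_pos m with rfl | hm
  · simp
  · rw [norm_mul, norm_mul, norm_natCast_cpow_of_pos hm, norm_natCast_cpow_of_pos hm]
    simp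

/-- The constant depends on σ, through the absolutely convergent series for 1/ζ(1+σ). This is
harmless, since only integrability of the transform on each single line is drawn from it. -/
lemma exists_norm_laplaceH_le_of_re {σ : ℝ} (h0 : 0 < σ) (h1 : σ ≤ 1) :
    ∃ A : ℝ, ∀ t : ℝ, ‖laplaceH (σ + t * I)‖ ≤ A * (1 + t ^ 2)⁻¹ := by
  set A := ∑' m : ℕ, ‖(μ m : ℂ) / m * (m : ℂ) ^ (-(σ : ℂ))‖
  refine ⟨(A + 1) / σ ^ 2, fun t => ?_⟩
  set s : ℂ := σ + t * I with hs
  have hre : s.re = σ := by simp [hs]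
  have him : s.im = t := by simp [hs]
  have hpos : 0 < s.re := by rwa [hre]
  have hA : ‖1 / riemannZeta (1 + s)‖ ≤ A := by
    rw [← (hasSum_moebius_rpow hpos).tsum_eq]
    refine (norm_tsum_le_tsum_norm (hasSum_moebius_rpow hpos).summable.norm).trans (le_of_eq ?_)
    refine tsum_congr fun m => ?_
    rw [norm_moebius_term, hre]
  have hn : σ ^ 2 * (1 + t ^ 2) ≤ ‖s‖ ^ 2 := by
    rw [← normSq_eq_norm_sq, normSq_apply, hre, him]
    nlinarith [mul_nonneg (sq_nonneg t) (show 0 ≤ 1 - σ ^ 2 by nlinarith)]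
  have hpos2 : 0 < σ ^ 2 * (1 + t ^ 2) := by positivity
  have hn1 : ‖s‖ ≤ ‖1 + s‖ := by
    apply abs_le_of_sq_le_sq' _ (norm_nonneg _) |>.2
    rw [← normSq_eq_norm_sq, ← normSq_eq_norm_sq, normSq_apply, normSq_apply]
    simp only [add_re, one_re, add_im, one_im]
    nlinarith
  have hs0 : 0 < ‖s‖ := by
    by_contra h
    have : ‖s‖ = 0 := le_antisymm (not_lt.mp h) (norm_nonneg _)
    rw [this] at hn; norm_num at hn; linarith
  have e1 : ‖1 / (s ^ 2 * riemannZeta (1 + s))‖ ≤ A * (σ ^ 2 * (1 + t ^ 2))⁻¹ := by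
    rw [mul_comm (s ^ 2), ← one_div_mul_one_div, norm_mul, norm_div _ (s ^ 2), norm_one, norm_pow, one_div (‖s‖ ^ 2)]
    have : 0 ≤ A := (norm_nonneg _).trans hA
    gcongr
  have e2 : ‖1 / (s * (1 + s))‖ ≤ (σ ^ 2 * (1 + t ^ 2))⁻¹ := by
    rw [norm_div, norm_one, norm_mul, one_div]
    refine inv_anti₀ hpos2 ?_
    calc _ ≤ ‖s‖ * ‖s‖ := by rw [← sq]; exact hn
      _ ≤ _ := by gcongr
  rw [laplaceH]
  refine (norm_sub_le _ _).trans ((add_le_add e1 e2).trans (le_of_eq ?_))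
  rw [mul_inv]
  ring

lemma fourier_moebiusErr {σ : ℝ} (h0 : 0 < σ) (ξ : ℝ) :
    𝓕 (fun u : ℝ => (moebiusErr u : ℂ) * exp (-σ * u)) ξ =
      laplaceH (σ + (2 * Real.pi * ξ : ℝ) * I) := by
  rw [Real.fourier_real_eq_integral_exp_smul, ← integral_moebiusErr_mul_exp (by simpa using h0)]
  congr 1
  ext u
  rw [smul_eq_mul, mul_left_comm, ← exp_add]
  congr 2
  push_cast
  ring

/-- The square of `moebiusErr` has bounded integrals. -/
lemma exists_integral_moebiusErr_sq_le :
    ∃ C : ℝ, 0 ≤ C ∧ ∀ U : ℝ, 0 ≤ U → ∫ u in (0 : ℝ)..U, moebiusErr u ^ 2 ≤ C := by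
  obtain ⟨K, hK, hH⟩ := exists_norm_laplaceH_sq_le
  have hint : Integrable fun ξ : ℝ => K * (1 + ‖ξ‖) ^ (-(4 / 3) : ℝ) :=
    (integrable_one_add_norm (by norm_num)).const_mul K
  set J := ∫ ξ : ℝ, K * (1 + ‖ξ‖) ^ (-(4 / 3) : ℝ)
  have hJ : 0 ≤ J := integral_nonneg fun ξ => by positivity
  refine ⟨Real.exp 2 * J, by positivity, fun U hU => ?_⟩
  -- With this σ the weight e^{−2σu} is at least e^{−2} on [0, U], while the bound on the transform
  -- does not depend on σ.
  set σ : ℝ := (1 + U)⁻¹ with hσ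
  have hσ0 : 0 < σ := by positivity
  have hσ1 : σ ≤ 1 := inv_le_one_of_one_le₀ (by linarith)
  set f : ℝ → ℂ := fun u => (moebiusErr u : ℂ) * exp (-σ * u) with hf
  have hfc : Continuous f := by
    have := continuous_moebiusErr
    fun_prop
  have hfi : Integrable f := integrable_moebiusErr_mul_exp (by simpa using hσ0)
  have hFc : AEStronglyMeasurable (𝓕 f) volume :=
    (VectorFourier.fourierIntegral_continuous Real.continuous_fourierChar
      continuous_inner hfi).aestronglyMeasurable
  have hFi : Integrable (𝓕 f) := by
    obtain ⟨A, hA⟩ := exists_norm_laplaceH_le_of_re hσ0 hσ1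
    refine Integrable.mono' (((integrable_inv_one_add_sq.comp_mul_left'
      (show 2 * Real.pi ≠ 0 by positivity))).const_mul A) hFc (ae_of_all _ fun ξ => ?_)
    rw [fourier_moebiusErr hσ0]
    exact hA _
  have hP := integral_norm_sq_fourier_eq hfc hfi hFi
  have hle : ∫ ξ, ‖𝓕 f ξ‖ ^ 2 ≤ J := by
    refine integral_mono_of_nonneg (ae_of_all _ fun ξ => by positivity) hint (ae_of_all _ fun ξ => ?_)
    simp only
    rw [fourier_moebiusErr hσ0]
    refine (hH _ (by simpa using hσ0) (by simpa using hσ1)).trans ?_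
    rw [neg_div]
    gcongr K * ?_
    refine Real.rpow_le_rpow_of_nonpos (by positivity) ?_ (by norm_num)
    have h2 : (1 : ℝ) ≤ 2 * Real.pi := by linarith [Real.pi_gt_three]
    simp only [add_im, ofReal_im, mul_im, ofReal_re, I_im, I_re, mul_one, mul_zero, add_zero, zero_add]
    rw [abs_mul, abs_of_pos (show 0 < 2 * Real.pi by positivity), Real.norm_eq_abs]
    nlinarith [abs_nonneg ξ]
  have hsq : ∀ u, ‖f u‖ ^ 2 = moebiusErr u ^ 2 * Real.exp (-2 * σ * u) := by
    intro u
    rw [hf]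
    simp only
    rw [norm_mul, norm_real, norm_exp, mul_pow, Real.norm_eq_abs, sq_abs, ← Real.exp_nat_mul]
    congr 2
    simp
    ring
  -- By Fourier inversion f is bounded by the L¹ norm of its transform, so |f|² is dominated by a
  -- multiple of |f|.
  have hfsq : Integrable fun u => ‖f u‖ ^ 2 := by
    refine Integrable.mono' ((integrable_moebiusErr_mul_exp (s := (σ : ℂ)) (by simpa using hσ0)).norm.const_mul
      (∫ ξ, ‖𝓕 f ξ‖)) (by fun_prop) (ae_of_all _ fun u => ?_)
    have hb : ‖f u‖ ≤ ∫ ξ, ‖𝓕 f ξ‖ := by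
      have h1 := congrFun (hfc.fourierInv_fourier_eq hfi hFi) u
      rw [← h1, Real.fourierInv_eq]
      refine (norm_integral_le_integral_norm _).trans (le_of_eq ?_)
      simp
    rw [Real.norm_of_nonneg (by positivity), sq]
    gcongr
  have hexp : ∀ u ∈ Set.Icc 0 U, moebiusErr u ^ 2 ≤ Real.exp 2 * ‖f u‖ ^ 2 := by
    intro u hu
    rw [hsq, mul_left_comm, ← Real.exp_add]
    refine le_mul_of_one_le_right (sq_nonneg _) (Real.one_le_exp ?_)
    have : σ * u ≤ 1 := by
      rw [hσ, inv_mul_le_iff₀ (by positivity)]; linarith [hu.2]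
    linarith
  calc ∫ u in (0 : ℝ)..U, moebiusErr u ^ 2 ≤ ∫ u in (0 : ℝ)..U, Real.exp 2 * ‖f u‖ ^ 2 := by
        refine intervalIntegral.integral_mono_on hU ?_ ?_ hexp
        · exact (continuous_moebiusErr.pow 2).intervalIntegrable _ _
        · exact (hfsq.const_mul _).intervalIntegrable
    _ = Real.exp 2 * ∫ u in (0 : ℝ)..U, ‖f u‖ ^ 2 := intervalIntegral.integral_const_mul _ _
    _ ≤ Real.exp 2 * ∫ u, ‖f u‖ ^ 2 := by
      gcongr
      rw [intervalIntegral.integral_of_le hU]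
      exact setIntegral_le_integral hfsq (ae_of_all _ fun u => by positivity)
    _ ≤ _ := by
      rw [← hP]
      gcongr

end SelbergSieve

end

/-! ### From the integral of `moebiusErr`² to a sum over integers n ≤ R. -/

section

open MeasureTheory Filter
open scoped ArithmeticFunction.Moebius

namespace SelbergSieve

lemma sum_moebius_mul_div {N : ℕ} (hN : 1 ≤ N) :
    ∑ m ∈ Finset.Icc 1 N, (μ m : ℝ) * ((N / m : ℕ) : ℝ) = 1 := by
  have h := ArithmeticFunction.sum_Ioc_mul_zeta_eq_sum μ N
  rw [ArithmeticFunction.moebius_mul_coe_zeta] at h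
  have h1 : ∑ n ∈ Finset.Ioc 0 N, (1 : ArithmeticFunction ℤ) n = 1 := by
    rw [Finset.sum_eq_single 1]
    · simp
    · intro b _ hb
      exact ArithmeticFunction.one_apply_ne hb
    · intro h
      exact absurd (Finset.mem_Ioc.mpr ⟨one_pos, hN⟩) h
  rw [h1] at h
  change 1 = ∑ m ∈ Finset.Icc 1 N, μ m * ((N / m : ℕ) : ℤ) at h
  have h2 := congrArg (Int.cast : ℤ → ℝ) h.symm
  rw [Int.cast_sum] at h2
  simpa only [Int.cast_mul, Int.cast_natCast, Int.cast_one] using h2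

/-- The partial sums of `μ(m)/m` are bounded by one. -/
lemma abs_sum_moebius_div_le_one (N : ℕ) : |∑ m ∈ Finset.Icc 1 N, (μ m : ℝ) / m| ≤ 1 := by
  rcases Nat.eq_zero_or_pos N with rfl | hN
  · simp
  have hN0 : (0 : ℝ) < N := by exact_mod_cast hN
  have e : (N : ℝ) * ∑ m ∈ Finset.Icc 1 N, (μ m : ℝ) / m =
      1 + ∑ m ∈ Finset.Icc 1 N, (μ m : ℝ) * ((N : ℝ) / m - ((N / m : ℕ) : ℝ)) := by
    rw [← sum_moebius_mul_div hN, ← Finset.sum_add_distrib, Finset.mul_sum]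
    refine Finset.sum_congr rfl fun m _ => ?_
    ring
  -- The term m = 1 has no fractional part, which saves the 1 needed to reach the bound exactly 1.
  have hb : |∑ m ∈ Finset.Icc 1 N, (μ m : ℝ) * ((N : ℝ) / m - ((N / m : ℕ) : ℝ))| ≤ N - 1 := by
    rw [← Finset.add_sum_Ioc_eq_sum_Icc hN]
    simp only [Nat.cast_one, div_one, Nat.div_one, sub_self, mul_zero, zero_add]
    calc _ ≤ ∑ m ∈ Finset.Ioc 1 N, (1 : ℝ) := by
          refine (Finset.abs_sum_le_sum_abs _ _).trans (Finset.sum_le_sum fun m hm => ?_)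
          have hfl : ((N / m : ℕ) : ℝ) = (⌊(N : ℝ) / m⌋₊ : ℝ) := by rw [Nat.floor_div_eq_div]
          rw [abs_mul, hfl]
          have h1 := Nat.floor_le (show (0 : ℝ) ≤ (N : ℝ) / m by positivity)
          have h2 := Nat.lt_floor_add_one ((N : ℝ) / m)
          refine mul_le_one₀ (abs_moebius_le_one m) (abs_nonneg _) ?_
          rw [abs_le]
          constructor <;> linarith
      _ = N - 1 := by
        simp [Nat.cast_sub hN]
  have h3 : (N : ℝ) * |∑ m ∈ Finset.Icc 1 N, (μ m : ℝ) / m| ≤ N * 1 := by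
    rw [← abs_of_pos hN0, ← abs_mul, abs_of_pos hN0, e]
    calc _ ≤ |(1 : ℝ)| + _ := abs_add_le _ _
      _ ≤ N * 1 := by rw [abs_one]; linarith
  exact le_of_mul_le_mul_left h3 hN0

lemma sum_Ioc_inv_le {x y : ℝ} (hx : 0 < x) (hxy : x ≤ y) :
    ∑ m ∈ Finset.Ioc ⌊x⌋₊ ⌊y⌋₊, (m : ℝ)⁻¹ ≤ 1 + Real.log (y / x) := by
  have hlog : 0 ≤ Real.log (y / x) := Real.log_nonneg (by rwa [one_le_div hx])
  rcases lt_or_ge y 1 with hy | hy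
  · rw [Nat.floor_eq_zero.mpr hy]
    simp; linarith
  · have h1 := sum_Icc_inv_le hy
    have h2 := log_le_sum_Icc_inv hx.le
    have h3 : ∑ m ∈ Finset.Icc 1 ⌊x⌋₊, (m : ℝ)⁻¹ + ∑ m ∈ Finset.Ioc ⌊x⌋₊ ⌊y⌋₊, (m : ℝ)⁻¹ =
        ∑ m ∈ Finset.Icc 1 ⌊y⌋₊, (m : ℝ)⁻¹ := by
      have := Finset.sum_Ioc_consecutive (fun m : ℕ => (m : ℝ)⁻¹) (Nat.zero_le _)
        (Nat.floor_le_floor hxy)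
      exact this
    rw [Real.log_div (by linarith) hx.ne']
    linarith

/-- The ramps present at v move with total slope Σ μ(m)/m, at most 1 in modulus. Those starting
between v and u have total weight at most 1 + (u − v) ≤ 2, and the exponential adds a Lipschitz
constant 1. -/
lemma abs_moebiusErr_sub_le {u v : ℝ} (hvu : v ≤ u) (h : u - v ≤ 1) :
    |moebiusErr u - moebiusErr v| ≤ 4 * (u - v) := by
  have hd : 0 ≤ u - v := by linarith
  have h1 : |logMoebius (Real.exp u) - logMoebius (Real.exp v)| ≤ 3 * (u - v) := by
    have hfl : ⌊Real.exp v⌋₊ ≤ ⌊Real.exp u⌋₊ := Nat.floor_le_floor (Real.exp_le_exp.mpr hvu)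
    rw [logMoebius_exp_eq (u := u) le_rfl, logMoebius_exp_eq hfl, ← Finset.sum_sub_distrib]
    have hsplit := Finset.sum_Ioc_consecutive (fun m : ℕ => (μ m : ℝ) / m * max (u - Real.log m) 0 -
      (μ m : ℝ) / m * max (v - Real.log m) 0) (Nat.zero_le _) hfl
    have hA : ∑ m ∈ Finset.Icc 1 ⌊Real.exp v⌋₊, ((μ m : ℝ) / m * max (u - Real.log m) 0 -
        (μ m : ℝ) / m * max (v - Real.log m) 0) =
        (∑ m ∈ Finset.Icc 1 ⌊Real.exp v⌋₊, (μ m : ℝ) / m) * (u - v) := by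
      rw [Finset.sum_mul]
      refine Finset.sum_congr rfl fun m hm => ?_
      rw [Finset.mem_Icc] at hm
      have e := Real.exp_pos v
      have hv : Real.log m ≤ v := by
        rw [← Real.log_exp v]
        exact Real.log_le_log (by exact_mod_cast hm.1) ((Nat.le_floor_iff e.le).mp hm.2)
      rw [max_eq_left (by linarith), max_eq_left (by linarith)]
      ring
    have hB : |∑ m ∈ Finset.Ioc ⌊Real.exp v⌋₊ ⌊Real.exp u⌋₊, ((μ m : ℝ) / m * max (u - Real.log m) 0 -
        (μ m : ℝ) / m * max (v - Real.log m) 0)| ≤ 2 * (u - v) := by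
      have hs := sum_Ioc_inv_le (Real.exp_pos v) (Real.exp_le_exp.mpr hvu)
      rw [← Real.exp_sub, Real.log_exp] at hs
      calc _ ≤ ∑ m ∈ Finset.Ioc ⌊Real.exp v⌋₊ ⌊Real.exp u⌋₊, (m : ℝ)⁻¹ * (u - v) := by
            refine (Finset.abs_sum_le_sum_abs _ _).trans (Finset.sum_le_sum fun m hm => ?_)
            rw [← mul_sub, abs_mul, abs_div, Nat.abs_cast, div_eq_mul_inv]
            have h2 : |max (u - Real.log m) 0 - max (v - Real.log m) 0| ≤ u - v := by
              refine (abs_max_sub_max_le_abs _ _ _).trans (le_of_eq ?_)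
              rw [sub_sub_sub_cancel_right, abs_of_nonneg hd]
            calc |(μ m : ℝ)| * (m : ℝ)⁻¹ * |max (u - Real.log m) 0 - max (v - Real.log m) 0|
                ≤ 1 * (m : ℝ)⁻¹ * (u - v) := by
                  gcongr
                  exact abs_moebius_le_one m
              _ = _ := by ring
        _ ≤ 2 * (u - v) := by
          rw [← Finset.sum_mul]
          gcongr
          linarith
    have hC := abs_sum_moebius_div_le_one ⌊Real.exp v⌋₊
    change ∑ m ∈ Finset.Icc 1 ⌊Real.exp v⌋₊, _ + _ = ∑ m ∈ Finset.Icc 1 ⌊Real.exp u⌋₊, _ at hsplit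
    rw [← hsplit, hA]
    refine (abs_add_le _ _).trans ?_
    rw [abs_mul, abs_of_nonneg hd]
    nlinarith
  have h2 : |Real.exp (-max u 0) - Real.exp (-max v 0)| ≤ u - v := by
    have hm : max v 0 ≤ max u 0 := max_le_max_right 0 hvu
    have hmd : max u 0 - max v 0 ≤ u - v := by
      have := abs_max_sub_max_le_abs u v 0
      rw [abs_of_nonneg hd] at this
      exact (le_abs_self _).trans this
    rw [abs_sub_comm, abs_of_nonneg (sub_nonneg.mpr (Real.exp_le_exp.mpr (by linarith)))]
    have h3 : Real.exp (-max u 0) = Real.exp (-max v 0) * Real.exp (-(max u 0 - max v 0)) := by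
      rw [← Real.exp_add]; ring_nf
    have h4 := Real.add_one_le_exp (-(max u 0 - max v 0))
    have h5 : Real.exp (-max v 0) ≤ 1 := Real.exp_le_one_iff.mpr (by simp)
    have h6 := Real.exp_pos (-max v 0)
    rw [h3]
    nlinarith
  have e : moebiusErr u - moebiusErr v = (logMoebius (Real.exp u) - logMoebius (Real.exp v)) +
      (Real.exp (-max u 0) - Real.exp (-max v 0)) := by
    rw [moebiusErr, moebiusErr]; ring
  rw [e]
  refine (abs_add_le _ _).trans ?_
  linarith

/-- The weight 1/n is at most twice the length of [log n, log(n+1)], and by the Lipschitz bound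
`moebiusErr` changes by O(1/n) across that interval. -/
lemma inv_mul_moebiusErr_sq_le (L : ℝ) {n : ℕ} (hn : 1 ≤ n) :
    (n : ℝ)⁻¹ * moebiusErr (L - Real.log n) ^ 2 ≤
      4 * (∫ v in Real.log n..Real.log (n + 1), moebiusErr (L - v) ^ 2) + 64 * ((n : ℝ) ^ 3)⁻¹ := by
  have hn1 : (1 : ℝ) ≤ n := by exact_mod_cast hn
  have hn0 : (0 : ℝ) < n := by linarith
  set a := Real.log n
  set b := Real.log (n + 1)
  have hab : a ≤ b := Real.log_le_log hn0 (by linarith)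
  have hba : b - a ≤ (n : ℝ)⁻¹ := by
    rw [← Real.log_div (by linarith) hn0.ne', add_div, div_self hn0.ne', one_div]
    have := Real.log_le_sub_one_of_pos (show 0 < 1 + (n : ℝ)⁻¹ by positivity)
    linarith
  have hn1' : (n : ℝ)⁻¹ ≤ 1 := inv_le_one_of_one_le₀ hn1
  have hba' : (n : ℝ)⁻¹ ≤ 2 * (b - a) := by
    rw [← Real.log_div (by linarith) hn0.ne']
    have := Real.one_sub_inv_le_log_of_pos (show 0 < ((n : ℝ) + 1) / n by positivity)
    have h2 : (n : ℝ)⁻¹ ≤ 2 * (1 - (((n : ℝ) + 1) / n)⁻¹) := by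
      rw [inv_div, one_sub_div (by linarith), add_sub_cancel_left, ← mul_div_assoc, inv_eq_one_div,
        div_le_div_iff₀ hn0 (by linarith)]
      linarith
    linarith
  have hpt : ∀ v ∈ Set.Icc a b, moebiusErr (L - a) ^ 2 ≤
      2 * moebiusErr (L - v) ^ 2 + 32 * ((n : ℝ) ^ 2)⁻¹ := by
    intro v hv
    have h1 := abs_moebiusErr_sub_le (u := L - a) (v := L - v) (by linarith [hv.1]) (by linarith [hv.2])
    have h2 : |moebiusErr (L - a) - moebiusErr (L - v)| ≤ 4 * (n : ℝ)⁻¹ := by linarith [hv.2]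
    have h3 : (moebiusErr (L - a) - moebiusErr (L - v)) ^ 2 ≤ (4 * (n : ℝ)⁻¹) ^ 2 :=
      sq_le_sq' (by linarith [abs_le.mp h2]) (abs_le.mp h2).2
    rw [mul_pow, inv_pow] at h3
    nlinarith [sq_nonneg (moebiusErr (L - v) - (moebiusErr (L - a) - moebiusErr (L - v)))]
  have hc : Continuous fun v => moebiusErr (L - v) ^ 2 :=
    (continuous_moebiusErr.comp (by fun_prop)).pow 2
  have i1 : IntervalIntegrable (fun v => 2 * moebiusErr (L - v) ^ 2) volume a b :=
    (continuous_const.mul hc).intervalIntegrable _ _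
  have i2 : IntervalIntegrable (fun _ : ℝ => 32 * ((n : ℝ) ^ 2)⁻¹) volume a b := by simp
  have i0 : IntervalIntegrable (fun _ : ℝ => moebiusErr (L - a) ^ 2) volume a b := by simp
  have hi := intervalIntegral.integral_mono_on hab i0 (i1.add i2) hpt
  rw [intervalIntegral.integral_const, intervalIntegral.integral_add i1 i2, intervalIntegral.integral_const_mul,
    intervalIntegral.integral_const, smul_eq_mul, smul_eq_mul] at hi
  have h4 : (n : ℝ)⁻¹ * moebiusErr (L - a) ^ 2 ≤ 2 * (b - a) * moebiusErr (L - a) ^ 2 := by gcongr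
  have h5 : (b - a) * (32 * ((n : ℝ) ^ 2)⁻¹) ≤ 32 * ((n : ℝ) ^ 3)⁻¹ := by
    calc _ ≤ (n : ℝ)⁻¹ * (32 * ((n : ℝ) ^ 2)⁻¹) := by gcongr
      _ = _ := by field_simp
  linarith

lemma sum_Icc_one_eq_sum_range (f : ℕ → ℝ) (Q : ℕ) :
    ∑ n ∈ Finset.Icc 1 Q, f n = ∑ k ∈ Finset.range Q, f (k + 1) := by
  rw [Finset.range_eq_Ico, Finset.sum_Ico_add' f 0 Q 1]
  rfl

/-- Mean-square bound for `∑_{m ≤ x} μ(m)/m log(x/m) - 1` along `x = R/n`. -/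
lemma exists_sum_logMoebius_sub_one_sq_le : ∃ C : ℝ, 0 ≤ C ∧ ∀ R : ℝ, 1 ≤ R →
    ∑ n ∈ Finset.Icc 1 ⌊R⌋₊, (n : ℝ)⁻¹ * (logMoebius (R / n) - 1) ^ 2 ≤ C := by
  obtain ⟨C, hC, hI⟩ := exists_integral_moebiusErr_sq_le
  have hs3 : Summable fun n : ℕ => ((n : ℝ) ^ 3)⁻¹ := Real.summable_nat_pow_inv.mpr (by norm_num)
  set Z := ∑' n : ℕ, ((n : ℝ) ^ 3)⁻¹
  have hZ : 0 ≤ Z := tsum_nonneg fun n => by positivity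
  refine ⟨8 * C + 128 * Z + 2, by positivity, fun R hR => ?_⟩
  have hR0 : 0 < R := by linarith
  set L := Real.log R
  have hL : 0 ≤ L := Real.log_nonneg hR
  set Q := ⌊R⌋₊
  have hQ : (Q : ℝ) ≤ R := Nat.floor_le hR0.le
  have hQ' : R < Q + 1 := Nat.lt_floor_add_one R
  have hterm : ∀ n ∈ Finset.Icc 1 Q, (n : ℝ)⁻¹ * (logMoebius (R / n) - 1) ^ 2 ≤
      2 * ((n : ℝ)⁻¹ * moebiusErr (L - Real.log n) ^ 2) + 2 * (n : ℝ) * (R ^ 2)⁻¹ := by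
    intro n hn
    rw [Finset.mem_Icc] at hn
    have hn0 : (0 : ℝ) < n := by exact_mod_cast hn.1
    have hnR : (n : ℝ) ≤ R := le_trans (by exact_mod_cast hn.2) hQ
    have hu : 0 ≤ L - Real.log n := by
      have := Real.log_le_log hn0 hnR; linarith
    have e1 : Real.exp (L - Real.log n) = R / n := by
      rw [Real.exp_sub, Real.exp_log hR0, Real.exp_log hn0]
    -- At u = log(R/n) the term e^{−u} is n/R; its weighted squares are summable with total O(1).
    have e2 : logMoebius (R / n) - 1 = moebiusErr (L - Real.log n) - n / R := by
      rw [moebiusErr, max_eq_left hu, Real.exp_neg, e1, inv_div]; ring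
    rw [e2]
    have h3 : (moebiusErr (L - Real.log n) - n / R) ^ 2 ≤
        2 * moebiusErr (L - Real.log n) ^ 2 + 2 * (n / R) ^ 2 := by
      nlinarith [sq_nonneg (moebiusErr (L - Real.log n) + n / R)]
    calc _ ≤ (n : ℝ)⁻¹ * (2 * moebiusErr (L - Real.log n) ^ 2 + 2 * (n / R) ^ 2) := by gcongr
      _ = _ := by field_simp
  have hint : ∑ n ∈ Finset.Icc 1 Q, (∫ v in Real.log n..Real.log (n + 1), moebiusErr (L - v) ^ 2) ≤ C := by
    have hc : Continuous fun v => moebiusErr (L - v) ^ 2 :=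
      (continuous_moebiusErr.comp (by fun_prop)).pow 2
    rw [sum_Icc_one_eq_sum_range (fun n => ∫ v in Real.log n..Real.log (n + 1), moebiusErr (L - v) ^ 2)]
    have hci : ∀ k < Q, IntervalIntegrable (fun v => moebiusErr (L - v) ^ 2) volume
        (Real.log ((k + 1 : ℕ) : ℝ)) (Real.log ((k + 1 + 1 : ℕ) : ℝ)) :=
      fun k _ => hc.intervalIntegrable _ _
    have := intervalIntegral.sum_integral_adjacent_intervals (n := Q)
      (a := fun k : ℕ => Real.log ((k + 1 : ℕ) : ℝ)) hci
    have e3 : ∑ k ∈ Finset.range Q, ∫ v in Real.log ((k + 1 : ℕ) : ℝ)..Real.log (((k + 1 : ℕ) : ℝ) + 1),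
        moebiusErr (L - v) ^ 2 = ∫ v in Real.log ((0 + 1 : ℕ) : ℝ)..Real.log ((Q + 1 : ℕ) : ℝ),
        moebiusErr (L - v) ^ 2 := by
      rw [← this]
      refine Finset.sum_congr rfl fun k _ => ?_
      push_cast
      rfl
    rw [e3, intervalIntegral.integral_comp_sub_left (fun v => moebiusErr v ^ 2)]
    simp only [zero_add, Nat.cast_one, Real.log_one, sub_zero]
    have hneg : L - Real.log ((Q + 1 : ℕ) : ℝ) ≤ 0 := by
      have := Real.log_le_log hR0 hQ'.le
      push_cast; linarith
    have hc2 : Continuous fun v => moebiusErr v ^ 2 := continuous_moebiusErr.pow 2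
    rw [← intervalIntegral.integral_add_adjacent_intervals (b := 0)
      (hc2.intervalIntegrable _ _) (hc2.intervalIntegrable _ _)]
    -- The intervals overshoot log R, but the excess corresponds to u ≤ 0, where the error vanishes.
    have hz : ∫ v in (L - Real.log ((Q + 1 : ℕ) : ℝ))..0, moebiusErr v ^ 2 = 0 := by
      rw [intervalIntegral.integral_congr (g := fun _ => (0 : ℝ)) (fun v hv => ?_)]
      · simp
      · rw [Set.uIcc_of_le hneg] at hv
        simp [moebiusErr_of_nonpos hv.2]
    rw [hz, zero_add]
    exact hI L hL
  have hcube : ∑ n ∈ Finset.Icc 1 Q, ((n : ℝ) ^ 3)⁻¹ ≤ Z :=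
    hs3.sum_le_tsum _ (fun n _ => by positivity)
  have hlin : ∑ n ∈ Finset.Icc 1 Q, (n : ℝ) ≤ R ^ 2 := by
    calc _ ≤ ∑ n ∈ Finset.Icc 1 Q, R := by
          refine Finset.sum_le_sum fun n hn => le_trans ?_ hQ
          exact_mod_cast (Finset.mem_Icc.mp hn).2
      _ ≤ _ := by
        simp only [Finset.sum_const, Nat.card_Icc, add_tsub_cancel_right, nsmul_eq_mul]
        rw [sq]; gcongr
  have hmid : ∑ n ∈ Finset.Icc 1 Q, (n : ℝ)⁻¹ * moebiusErr (L - Real.log n) ^ 2 ≤ 4 * C + 64 * Z := by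
    refine (Finset.sum_le_sum fun n hn => inv_mul_moebiusErr_sq_le L (Finset.mem_Icc.mp hn).1).trans ?_
    rw [Finset.sum_add_distrib, ← Finset.mul_sum, ← Finset.mul_sum]
    gcongr
  refine (Finset.sum_le_sum hterm).trans ?_
  rw [Finset.sum_add_distrib, ← Finset.mul_sum, ← Finset.sum_mul, ← Finset.mul_sum]
  have h7 : 2 * (∑ n ∈ Finset.Icc 1 Q, (n : ℝ)) * (R ^ 2)⁻¹ ≤ 2 := by
    rw [mul_inv_le_iff₀ (by positivity)]; linarith
  linarith

end SelbergSieve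

end

/-! ### Integers grouped by radical, and G(R) = log R + O(1). -/

section

open Filter UniqueFactorizationMonoid
open scoped ArithmeticFunction.Moebius

namespace SelbergSieve

lemma prime_dvd_radical_iff {p n : ℕ} (hp : p.Prime) (hn : n ≠ 0) : p ∣ radical n ↔ p ∣ n :=
  dvd_radical_iff_of_irreducible hp.prime.irreducible hn

lemma radical_eq_iff_primeFactors {q n : ℕ} (hq : Squarefree q) :
    radical n = q ↔ n.primeFactors = q.primeFactors := by
  constructor
  · rintro rfl
    rw [← primeFactors_eq_natPrimeFactors, primeFactors_radical]
  · intro h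
    rw [Nat.radical_eq_prod_primeFactors, h, Nat.prod_primeFactors_of_squarefree hq]

/-- `1/φ(q) = ∑ 1/n` over the integers `n` with radical `q`. -/
lemma hasSum_inv_radical_eq {q : ℕ} (hq : Squarefree q) :
    HasSum (fun n : ℕ => if radical n = q then (n : ℝ)⁻¹ else 0) ((q.totient : ℝ)⁻¹) := by
  have hq0 : q ≠ 0 := hq.ne_zero
  let f : ℕ →* ℝ :=
    { toFun := fun n => (n : ℝ)⁻¹
      map_one' := by simp
      map_mul' := fun a b => by push_cast; rw [mul_inv] }
  have h1 := (EulerProduct.summable_and_hasSum_factoredNumbers_prod_filter_prime_geometric (f := f)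
    (fun {p} hp => by
      change ‖(p : ℝ)⁻¹‖ < 1
      rw [norm_inv, Real.norm_natCast]
      exact inv_lt_one_of_one_lt₀ (by exact_mod_cast hp.one_lt)) q.primeFactors).2
  have h2 := h1.mul_left (q : ℝ)⁻¹
  have hval : (q : ℝ)⁻¹ * ∏ p ∈ q.primeFactors with p.Prime, (1 - f p)⁻¹ = (q.totient : ℝ)⁻¹ := by
    rw [Finset.filter_true_of_mem (fun p hp => Nat.prime_of_mem_primeFactors hp), Finset.prod_inv_distrib,
      ← mul_inv]
    congr 1
    have := Nat.totient_eq_mul_prod_factors q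
    have h3 := congrArg (fun x : ℚ => (x : ℝ)) this
    push_cast at h3
    rw [h3]
    rfl
  rw [hval] at h2
  -- The integers with radical q are exactly q·m with m composed of primes of q, so the Euler
  -- product yields q⁻¹ ∏ (1 − 1/p)⁻¹ = 1/φ(q).
  let g : Nat.factoredNumbers q.primeFactors → ℕ := fun m => q * m
  have hg : Function.Injective g := by
    intro a b h
    exact Subtype.ext (Nat.eq_of_mul_eq_mul_left (Nat.pos_of_ne_zero hq0) h)
  have hrad : ∀ m : Nat.factoredNumbers q.primeFactors, radical (g m) = q := by
    intro m
    rw [radical_eq_iff_primeFactors hq, Nat.primeFactors_mul hq0 (Nat.ne_zero_of_mem_factoredNumbers m.2)]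
    exact Finset.union_eq_left.mpr (Nat.primeFactors_subset_of_mem_factoredNumbers m.2)
  rw [← hg.hasSum_iff]
  · refine h2.congr_fun fun m => ?_
    simp only [Function.comp_apply, hrad m, if_true]
    change ((q * (m : ℕ) : ℕ) : ℝ)⁻¹ = (q : ℝ)⁻¹ * ((m : ℕ) : ℝ)⁻¹
    push_cast
    rw [mul_inv]
  · intro n hn
    by_cases hn0 : n = 0
    · simp [hn0]
    refine if_neg fun hr => hn ?_
    obtain ⟨m, hm⟩ : q ∣ n := hr ▸ radical_dvd_self
    have hm0 : m ≠ 0 := by rintro rfl; simp at hm; exact hn0 hm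
    refine ⟨⟨m, Nat.mem_factoredNumbers_of_primeFactors_subset hm0 ?_⟩, hm.symm⟩
    rw [← (radical_eq_iff_primeFactors hq).mp hr]
    exact Nat.primeFactors_mono ⟨q, by rw [hm, mul_comm]⟩ hn0

/-- The sum of `1/n` over `n ≤ X` with radical `q`. -/
noncomputable def radSum (X q : ℕ) : ℝ := ∑ n ∈ Finset.Icc 1 X with radical n = q, (n : ℝ)⁻¹

lemma radSum_nonneg (X q : ℕ) : 0 ≤ radSum X q := Finset.sum_nonneg fun n _ => by positivity

lemma radSum_eq_sum_range (X q : ℕ) :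
    radSum X q = ∑ n ∈ Finset.range (X + 1), if radical n = q then (n : ℝ)⁻¹ else 0 := by
  rw [radSum, Finset.sum_filter, Finset.sum_range_succ', sum_Icc_one_eq_sum_range]
  simp

lemma radSum_of_not_squarefree (X : ℕ) {q : ℕ} (hq : ¬ Squarefree q) : radSum X q = 0 := by
  rw [radSum, Finset.filter_false_of_mem, Finset.sum_empty]
  rintro n - rfl
  exact hq squarefree_radical

lemma moebius_sq_div_totient (q : ℕ) :
    (μ q : ℝ) ^ 2 / q.totient = if Squarefree q then (q.totient : ℝ)⁻¹ else 0 := by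
  have h := ArithmeticFunction.moebius_sq (n := q)
  have h2 : (μ q : ℝ) ^ 2 = if Squarefree q then 1 else 0 := by exact_mod_cast h
  rw [h2]
  split_ifs <;> simp

lemma radSum_le (X q : ℕ) : radSum X q ≤ (μ q : ℝ) ^ 2 / q.totient := by
  rw [moebius_sq_div_totient]
  split_ifs with hq
  · rw [radSum_eq_sum_range]
    exact sum_le_hasSum _ (fun n _ => by positivity) (hasSum_inv_radical_eq hq)
  · rw [radSum_of_not_squarefree X hq]

lemma tendsto_radSum (q : ℕ) :
    Tendsto (fun X => radSum X q) atTop (nhds ((μ q : ℝ) ^ 2 / q.totient)) := by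
  rw [moebius_sq_div_totient]
  split_ifs with hq
  · simp_rw [radSum_eq_sum_range]
    exact (hasSum_inv_radical_eq hq).tendsto_sum_nat.comp (tendsto_add_atTop_nat 1)
  · simp_rw [radSum_of_not_squarefree _ hq]
    exact tendsto_const_nhds

lemma sum_radSum (X Q : ℕ) : ∑ q ∈ Finset.Icc 1 Q, radSum X q =
    ∑ n ∈ Finset.Icc 1 X with radical n ≤ Q, (n : ℝ)⁻¹ := by
  simp only [radSum]
  rw [← Finset.sum_fiberwise_of_maps_to (s := {n ∈ Finset.Icc 1 X | radical n ≤ Q}) (t := Finset.Icc 1 Q)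
    (g := fun n => radical n)]
  · refine Finset.sum_congr rfl fun q hq => Finset.sum_congr ?_ fun _ _ => rfl
    rw [Finset.mem_Icc] at hq
    ext n
    simp only [Finset.mem_filter]
    constructor
    · rintro ⟨h1, h2⟩; exact ⟨⟨h1, h2 ▸ hq.2⟩, h2⟩
    · rintro ⟨⟨h1, _⟩, h2⟩; exact ⟨h1, h2⟩
  · intro n hn
    rw [Finset.mem_filter] at hn
    exact Finset.mem_Icc.mpr ⟨Nat.radical_pos n, hn.2⟩

/-- Write n = b²a with a squarefree. A prime of a not dividing b would divide n only once, so a ∣ b;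
with b = ac this gives n = c²a³. -/
lemma exists_sq_mul_cube {n : ℕ} (hn : n ≠ 0) (h : ∀ p : ℕ, p.Prime → p ∣ n → p ^ 2 ∣ n) :
    ∃ a b : ℕ, n = a ^ 2 * b ^ 3 := by
  obtain ⟨a, b, hab, ha⟩ := Nat.sq_mul_squarefree n
  have hb0 : b ≠ 0 := by rintro rfl; simp at hab; exact hn hab.symm
  have key : a ∣ b := by
    rw [← Nat.prod_primeFactors_of_squarefree ha]
    refine dvd_trans ?_ (Nat.prod_primeFactors_dvd b)
    refine Finset.prod_dvd_prod_of_subset _ _ _ fun p hp => ?_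
    have hpp := Nat.prime_of_mem_primeFactors hp
    have hpa := Nat.dvd_of_mem_primeFactors hp
    refine Nat.mem_primeFactors.mpr ⟨hpp, ?_, hb0⟩
    by_contra hpb
    have h2 : p ^ 2 ∣ b ^ 2 * a := hab ▸ h p hpp (hab ▸ hpa.mul_left _)
    have h3 : p ^ 2 ∣ a :=
      (Nat.Coprime.pow 2 2 ((Nat.Prime.coprime_iff_not_dvd hpp).mpr hpb)).dvd_of_dvd_mul_left h2
    rw [sq] at h3
    exact hpp.one_lt.ne' (Nat.isUnit_iff.mp (ha p h3))
  obtain ⟨c, hc⟩ := key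
  refine ⟨c, a, ?_⟩
  rw [← hab, hc]
  ring

lemma primeFactors_mul_radical {k : ℕ} (hk : k ≠ 0) : (k * radical k).primeFactors = k.primeFactors := by
  rw [Nat.primeFactors_mul hk (Nat.radical_pos k).ne']
  have : (radical k).primeFactors = k.primeFactors := by
    rw [← primeFactors_eq_natPrimeFactors, primeFactors_radical]
  rw [this, Finset.union_self]

lemma mul_radical_injOn : Set.InjOn (fun k : ℕ => k * radical k) {k | k ≠ 0} := by
  intro k hk l hl h
  have h : k * radical k = l * radical l := h
  have hr : radical k = radical l := by
    rw [Nat.radical_eq_prod_primeFactors, Nat.radical_eq_prod_primeFactors,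
      ← primeFactors_mul_radical hk, ← primeFactors_mul_radical hl, h]
  rw [hr] at h
  exact Nat.eq_of_mul_eq_mul_right (Nat.radical_pos l) h

/-- The numbers k·rad k are powerful and determine k. The sum is therefore dominated by the double
series of (a²b³)^{−3/4} = a^{−3/2} b^{−9/4}. -/
lemma exists_sum_mul_radical_rpow_le : ∃ C : ℝ, 0 ≤ C ∧ ∀ X : ℕ,
    ∑ k ∈ Finset.Icc 1 X, ((k * radical k : ℕ) : ℝ) ^ (-3 / 4 : ℝ) ≤ C := by
  have hex : ∀ k : ℕ, ∃ ab : ℕ × ℕ, k ≠ 0 → k * radical k = ab.1 ^ 2 * ab.2 ^ 3 := by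
    intro k
    by_cases hk : k = 0
    · exact ⟨0, fun h => absurd hk h⟩
    obtain ⟨a, b, h⟩ := exists_sq_mul_cube (mul_ne_zero hk (Nat.radical_pos k).ne') (fun p hp hpk => by
      have h1 : p ∣ k := by
        rcases hp.dvd_mul.mp hpk with h | h
        · exact h
        · exact (prime_dvd_radical_iff hp hk).mp h
      rw [sq]
      exact mul_dvd_mul h1 ((prime_dvd_radical_iff hp hk).mpr h1))
    exact ⟨(a, b), fun _ => h⟩
  choose φ hφ using hex
  have hs : Summable fun ab : ℕ × ℕ => (ab.1 : ℝ) ^ (-3 / 2 : ℝ) * (ab.2 : ℝ) ^ (-9 / 4 : ℝ) :=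
    Summable.mul_of_nonneg (f := fun a : ℕ => (a : ℝ) ^ (-3 / 2 : ℝ))
      (g := fun a : ℕ => (a : ℝ) ^ (-9 / 4 : ℝ))
      (Real.summable_nat_rpow.mpr (by norm_num)) (Real.summable_nat_rpow.mpr (by norm_num))
      (fun a => by positivity) (fun a => by positivity)
  refine ⟨∑' ab : ℕ × ℕ, (ab.1 : ℝ) ^ (-3 / 2 : ℝ) * (ab.2 : ℝ) ^ (-9 / 4 : ℝ),
    tsum_nonneg fun ab => by positivity, fun X => ?_⟩
  have hne : ∀ k ∈ Finset.Icc 1 X, k ≠ 0 := fun k hk => by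
    have := (Finset.mem_Icc.mp hk).1; omega
  have hinj : Set.InjOn φ (Finset.Icc 1 X : Set ℕ) := by
    intro k hk l hl h
    have hk := hne k hk
    have hl := hne l hl
    refine mul_radical_injOn hk hl ?_
    simp only
    rw [hφ k hk, hφ l hl, h]
  calc _ = ∑ k ∈ Finset.Icc 1 X, ((φ k).1 : ℝ) ^ (-3 / 2 : ℝ) * ((φ k).2 : ℝ) ^ (-9 / 4 : ℝ) := by
        refine Finset.sum_congr rfl fun k hk => ?_
        rw [hφ k (hne k hk)]
        push_cast
        rw [Real.mul_rpow (by positivity) (by positivity), ← Real.rpow_natCast, ← Real.rpow_natCast,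
          ← Real.rpow_mul (by positivity), ← Real.rpow_mul (by positivity)]
        norm_num
    _ = ∑ ab ∈ (Finset.Icc 1 X).image φ, (ab.1 : ℝ) ^ (-3 / 2 : ℝ) * (ab.2 : ℝ) ^ (-9 / 4 : ℝ) :=
      (Finset.sum_image (f := fun ab : ℕ × ℕ => (ab.1 : ℝ) ^ (-3 / 2 : ℝ) * (ab.2 : ℝ) ^ (-9 / 4 : ℝ))
        hinj).symm
    _ ≤ _ := hs.sum_le_tsum _ (fun ab _ => by positivity)

/-- Put r = rad k. Since r divides rad n, one has n = krj and rad n = rj, so the conditions confine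
j to (Q/(kr), Q/r]. The endpoints have ratio k, which produces 1 + log k. -/
lemma sum_inv_div_radical_eq_le {Q k : ℕ} (hQ : 1 ≤ Q) (hk : 1 ≤ k) (S : Finset ℕ)
    (hS : ∀ n ∈ S, Q < n ∧ radical n ≤ Q ∧ n / radical n = k) :
    ∑ n ∈ S, (n : ℝ)⁻¹ ≤ ((k * radical k : ℕ) : ℝ)⁻¹ * (1 + Real.log k) := by
  have hr := Nat.radical_pos k
  set r := radical k with hrdef
  have hkr : 0 < k * r := Nat.mul_pos hk hr
  have hfac : ∀ n ∈ S, ∃ j, n = k * r * j ∧ radical n = r * j := by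
    intro n hn
    obtain ⟨h1, h2, h3⟩ := hS n hn
    have hn0 : n ≠ 0 := by omega
    have e1 : n = radical n * k := by rw [← h3, Nat.mul_div_cancel' radical_dvd_self]
    have hdvd : r ∣ radical n := radical_dvd_radical ⟨radical n, by rw [mul_comm]; exact e1⟩ hn0
    obtain ⟨j, hj⟩ := hdvd
    refine ⟨j, ?_, hj⟩
    rw [e1, hj]; ring
  set x : ℝ := (Q : ℝ) / (k * r : ℕ)
  set y : ℝ := (Q : ℝ) / r
  have hQ0 : (0 : ℝ) < Q := by exact_mod_cast hQ
  have hk0 : (0 : ℝ) < k := by exact_mod_cast hk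
  have hk1 : (1 : ℝ) ≤ k := by exact_mod_cast hk
  have hr0 : (0 : ℝ) < r := by exact_mod_cast hr
  have hkr0 : (0 : ℝ) < (k * r : ℕ) := by exact_mod_cast hkr
  have hyx : y / x = k := by
    simp only [x, y]; push_cast; field_simp
  have hx : 0 < x := by positivity
  have hxy : x ≤ y := by
    rw [← one_le_div hx, hyx]; exact hk1
  have hs := sum_Ioc_inv_le hx hxy
  rw [hyx] at hs
  calc ∑ n ∈ S, (n : ℝ)⁻¹ ≤ ∑ j ∈ Finset.Ioc ⌊x⌋₊ ⌊y⌋₊, ((k * r : ℕ) : ℝ)⁻¹ * (j : ℝ)⁻¹ := by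
        have himg : ∑ n ∈ (Finset.Ioc ⌊x⌋₊ ⌊y⌋₊).image (fun j => k * r * j), (n : ℝ)⁻¹ =
            ∑ j ∈ Finset.Ioc ⌊x⌋₊ ⌊y⌋₊, ((k * r : ℕ) : ℝ)⁻¹ * (j : ℝ)⁻¹ := by
          rw [Finset.sum_image fun a _ b _ h => Nat.eq_of_mul_eq_mul_left hkr h]
          refine Finset.sum_congr rfl fun j _ => ?_
          push_cast
          rw [mul_inv _ (j : ℝ)]
        rw [← himg]
        refine Finset.sum_le_sum_of_subset_of_nonneg ?_ (fun n _ _ => by positivity)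
        intro n hn
        obtain ⟨j, hj, hj2⟩ := hfac n hn
        obtain ⟨h1, h2, h3⟩ := hS n hn
        refine Finset.mem_image.mpr ⟨j, Finset.mem_Ioc.mpr ⟨?_, ?_⟩, hj.symm⟩
        · rw [Nat.floor_lt hx.le, div_lt_iff₀ hkr0]
          rw [hj, mul_comm] at h1
          exact_mod_cast h1
        · rw [Nat.le_floor_iff (by positivity), le_div_iff₀ hr0]
          rw [hj2, mul_comm] at h2
          exact_mod_cast h2
    _ ≤ _ := by
      rw [← Finset.mul_sum]
      gcongr

lemma one_add_log_le_rpow {x y : ℝ} (hx : 1 ≤ x) (hxy : x ≤ y) :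
    1 + Real.log x ≤ 5 * y ^ (1 / 4 : ℝ) := by
  have h1 := Real.log_le_rpow_div (show 0 ≤ x by linarith) (show (0 : ℝ) < 1 / 4 by norm_num)
  have h2 : (1 : ℝ) ≤ x ^ (1 / 4 : ℝ) := Real.one_le_rpow hx (by norm_num)
  have h3 : x ^ (1 / 4 : ℝ) ≤ y ^ (1 / 4 : ℝ) := Real.rpow_le_rpow (by linarith) hxy (by norm_num)
  linarith

/-- Group by k = n / rad n; the factor 1 + log k costs only (k·rad k)^{1/4}. -/
lemma exists_sum_inv_radical_le_le : ∃ C : ℝ, 0 ≤ C ∧ ∀ Q X : ℕ, 1 ≤ Q →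
    ∑ n ∈ Finset.Icc 1 X with radical n ≤ Q ∧ Q < n, (n : ℝ)⁻¹ ≤ C := by
  obtain ⟨C, hC, h⟩ := exists_sum_mul_radical_rpow_le
  refine ⟨5 * C, by positivity, fun Q X hQ => ?_⟩
  rw [← Finset.sum_fiberwise_of_maps_to (t := Finset.Icc 1 X) (g := fun n => n / radical n)]
  · calc _ ≤ ∑ k ∈ Finset.Icc 1 X, 5 * ((k * radical k : ℕ) : ℝ) ^ (-3 / 4 : ℝ) := by
          refine Finset.sum_le_sum fun k hk => ?_
          have hk1 := (Finset.mem_Icc.mp hk).1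
          refine (sum_inv_div_radical_eq_le hQ hk1 _ fun n hn => ?_).trans ?_
          · simp only [Finset.mem_filter] at hn
            exact ⟨hn.1.2.2, hn.1.2.1, hn.2⟩
          · have hkr : k ≤ k * radical k := Nat.le_mul_of_pos_right k (Nat.radical_pos k)
            have hk1' : (1 : ℝ) ≤ k := by exact_mod_cast hk1
            have hl := one_add_log_le_rpow (y := ((k * radical k : ℕ) : ℝ)) hk1' (by exact_mod_cast hkr)
            have hpos : (0 : ℝ) < ((k * radical k : ℕ) : ℝ) := by
              exact_mod_cast Nat.mul_pos hk1 (Nat.radical_pos k)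
            calc _ ≤ ((k * radical k : ℕ) : ℝ)⁻¹ * (5 * ((k * radical k : ℕ) : ℝ) ^ (1 / 4 : ℝ)) := by
                  gcongr
              _ = 5 * (((k * radical k : ℕ) : ℝ) ^ (-1 : ℝ) * ((k * radical k : ℕ) : ℝ) ^ (1 / 4 : ℝ)) := by
                rw [Real.rpow_neg_one]; ring
              _ = _ := by
                rw [← Real.rpow_add hpos]; norm_num
      _ ≤ _ := by
        rw [← Finset.mul_sum]
        gcongr
        exact h X
  · intro n hn
    simp only [Finset.mem_filter, Finset.mem_Icc] at hn
    rw [Finset.mem_Icc]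
    refine ⟨?_, (Nat.div_le_self _ _).trans hn.1.2⟩
    exact Nat.div_pos (Nat.le_of_dvd hn.1.1 radical_dvd_self) (Nat.radical_pos n)

lemma radical_le_of_le {n Q : ℕ} (h1 : 1 ≤ n) (h : n ≤ Q) : radical n ≤ Q :=
  (Nat.le_of_dvd h1 radical_dvd_self).trans h

lemma sum_radSum_self (Q : ℕ) :
    ∑ q ∈ Finset.Icc 1 Q, radSum Q q = ∑ n ∈ Finset.Icc 1 Q, (n : ℝ)⁻¹ := by
  rw [sum_radSum, Finset.filter_true_of_mem]
  intro n hn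
  rw [Finset.mem_Icc] at hn
  exact radical_le_of_le hn.1 hn.2

/-- `∑_{q ≤ Q} μ(q)²/φ(q)` exceeds the harmonic sum by a bounded amount. -/
lemma exists_sum_sub_radSum_le : ∃ C : ℝ, 0 ≤ C ∧ ∀ Q : ℕ, 1 ≤ Q →
    ∑ q ∈ Finset.Icc 1 Q, ((μ q : ℝ) ^ 2 / q.totient - radSum Q q) ≤ C := by
  obtain ⟨C, hC, h⟩ := exists_sum_inv_radical_le_le
  refine ⟨C, hC, fun Q hQ => ?_⟩
  rw [Finset.sum_sub_distrib, sum_radSum_self, sub_le_iff_le_add]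
  have ht : Tendsto (fun X => ∑ q ∈ Finset.Icc 1 Q, radSum X q) atTop
      (nhds (∑ q ∈ Finset.Icc 1 Q, (μ q : ℝ) ^ 2 / q.totient)) :=
    tendsto_finsetSum _ fun q _ => tendsto_radSum q
  refine le_of_tendsto' ht fun X => ?_
  -- For each truncation X, the n ≤ Q contribute at most the harmonic sum, and the n > Q with
  -- radical at most Q contribute O(1).
  rw [sum_radSum, ← Finset.sum_filter_add_sum_filter_not _ (fun n => Q < n), Finset.filter_filter]
  gcongr
  · exact h Q X hQ
  · intro n hn
    simp only [Finset.mem_filter, Finset.mem_Icc] at hn ⊢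
    omega

lemma log_le_G {R : ℝ} (hR : 0 ≤ R) : Real.log R ≤ G R := by
  refine (log_le_sum_Icc_inv hR).trans ?_
  rw [← sum_radSum_self]
  exact Finset.sum_le_sum fun q _ => radSum_le _ q

lemma exists_G_le : ∃ C : ℝ, 0 ≤ C ∧ ∀ R : ℝ, 1 ≤ R → G R ≤ Real.log R + C := by
  obtain ⟨C, hC, h⟩ := exists_sum_sub_radSum_le
  refine ⟨C + 1, by linarith, fun R hR => ?_⟩
  have h1 := h ⌊R⌋₊ (Nat.one_le_floor_iff R |>.mpr hR)
  rw [Finset.sum_sub_distrib, sum_radSum_self] at h1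
  have h2 := sum_Icc_inv_le hR
  rw [G]
  linarith

end SelbergSieve

end

/-! ### The Goldston–Yıldırım coefficients compared with the Selberg ones. -/

section

open Filter UniqueFactorizationMonoid
open scoped ArithmeticFunction.Moebius ArithmeticFunction.zeta

namespace SelbergSieve

lemma sum_moebius_divisors (r : ℕ) : ∑ e ∈ r.divisors, μ e = if r = 1 then 1 else 0 := by
  have h := congrArg (fun f : ArithmeticFunction ℤ => f r) ArithmeticFunction.coe_zeta_mul_moebius
  simp only [ArithmeticFunction.coe_zeta_mul_apply, ArithmeticFunction.one_apply] at h
  exact h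

/-- Only squarefree d matter, so n may be replaced by its radical. If rad n = qr and d = qe,
coprimality leaves Σ_{e ∣ r} μ(e), which detects r = 1. -/
lemma sum_moebius_filter_dvd {q n : ℕ} (hq : Squarefree q) (hn : n ≠ 0) :
    ∑ d ∈ n.divisors with q ∣ d, μ q * μ d = if radical n = q then 1 else 0 := by
  have hr0 := (Nat.radical_pos n).ne'
  have hsub : {d ∈ (radical n).divisors | q ∣ d} ⊆ {d ∈ n.divisors | q ∣ d} := by
    refine Finset.filter_subset_filter _ (Nat.divisors_subset_of_dvd hn radical_dvd_self)
  rw [← Finset.sum_subset hsub]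
  · by_cases hqr : q ∣ radical n
    · obtain ⟨r, hr⟩ := hqr
      have hrne : r ≠ 0 := by rintro rfl; simp at hr
      have hsq : Squarefree (q * r) := hr ▸ squarefree_radical
      have himg : {d ∈ (radical n).divisors | q ∣ d} = r.divisors.image (fun e => q * e) := by
        ext d
        simp only [Finset.mem_filter, Finset.mem_image, Nat.mem_divisors]
        constructor
        · rintro ⟨⟨h1, _⟩, e, rfl⟩
          rw [hr] at h1
          exact ⟨e, ⟨(Nat.mul_dvd_mul_iff_left (Nat.pos_of_ne_zero hq.ne_zero)).mp h1, hrne⟩, rfl⟩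
        · rintro ⟨e, ⟨h1, _⟩, rfl⟩
          exact ⟨⟨hr ▸ mul_dvd_mul_left q h1, hr0⟩, dvd_mul_right q e⟩
      rw [himg, Finset.sum_image fun a _ b _ h =>
        Nat.eq_of_mul_eq_mul_left (Nat.pos_of_ne_zero hq.ne_zero) h]
      have hcop : ∀ e ∈ r.divisors, μ q * μ (q * e) = μ e := by
        intro e he
        have hsqe : Squarefree (q * e) := hsq.squarefree_of_dvd (mul_dvd_mul_left q (Nat.dvd_of_mem_divisors he))
        rw [ArithmeticFunction.isMultiplicative_moebius.map_mul_of_coprime (Nat.coprime_of_squarefree_mul hsqe),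
          ← mul_assoc, ← sq, ArithmeticFunction.moebius_sq_eq_one_of_squarefree hq, one_mul]
      rw [Finset.sum_congr rfl hcop, sum_moebius_divisors r, hr]
      congr 1
      rw [Nat.mul_eq_left hq.ne_zero]
    · rw [Finset.sum_eq_zero, if_neg (fun h : radical n = q => hqr h.symm.dvd)]
      intro d hd
      rw [Finset.mem_filter] at hd
      exact absurd (hd.2.trans (Nat.dvd_of_mem_divisors hd.1)) hqr
  · intro d hd hd'
    simp only [Finset.mem_filter, Nat.mem_divisors] at hd hd'
    refine mul_eq_zero_of_right _ (ArithmeticFunction.moebius_eq_zero_of_not_squarefree fun hsq => ?_)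
    exact hd' ⟨⟨(dvd_radical_iff hsq.isRadical hn).mpr hd.1.1, hr0⟩, hd.2⟩

/-- Möbius inversion of `sum_moebius_filter_dvd`. -/
lemma sum_moebius_radical_eq {q d : ℕ} (hq : Squarefree q) :
    ∑ x ∈ d.divisorsAntidiagonal, (if radical x.1 = q then 1 else 0) * μ x.2 =
      if q ∣ d then μ q * μ d else 0 := by
  let f : ArithmeticFunction ℤ := ⟨fun n => if n ≠ 0 ∧ radical n = q then 1 else 0, by simp⟩
  let h : ArithmeticFunction ℤ := ⟨fun n => if q ∣ n then μ q * μ n else 0, by simp⟩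
  have hf : h * (ζ : ArithmeticFunction ℤ) = f := by
    ext n
    rw [ArithmeticFunction.coe_mul_zeta_apply]
    by_cases hn : n = 0
    · simp [hn]
    · change ∑ d ∈ n.divisors, (if q ∣ d then μ q * μ d else 0) = if n ≠ 0 ∧ radical n = q then 1 else 0
      rw [← Finset.sum_filter, sum_moebius_filter_dvd hq hn]
      simp [hn]
  have hh : f * μ = h := by
    rw [← hf, mul_assoc, ArithmeticFunction.coe_zeta_mul_moebius, mul_one]
  have := congrArg (fun g : ArithmeticFunction ℤ => g d) hh
  simp only [ArithmeticFunction.mul_apply] at this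
  change _ = if q ∣ d then μ q * μ d else 0 at this
  rw [← this]
  refine Finset.sum_congr rfl fun x hx => ?_
  have hx0 : x.1 ≠ 0 := (Nat.ne_zero_of_mem_divisorsAntidiagonal hx).1
  change _ = (if x.1 ≠ 0 ∧ radical x.1 = q then 1 else 0) * μ x.2
  simp [hx0]

lemma sum_divisorsAntidiagonal_eq (F : ℕ → ℕ → ℝ) (Q : ℕ) :
    ∑ n ∈ Finset.Icc 1 Q, ∑ m ∈ Finset.Icc 1 (Q / n), F n m =
      ∑ d ∈ Finset.Icc 1 Q, ∑ x ∈ d.divisorsAntidiagonal, F x.1 x.2 := by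
  rw [Finset.sum_sigma', Finset.sum_sigma']
  refine Finset.sum_nbij' (fun p => ⟨p.1 * p.2, (p.1, p.2)⟩) (fun p => ⟨p.2.1, p.2.2⟩) ?_ ?_ ?_ ?_ ?_
  · rintro ⟨n, m⟩ h
    simp only [Finset.mem_sigma, Finset.mem_Icc, Nat.mem_divisorsAntidiagonal] at h ⊢
    obtain ⟨⟨h1, h2⟩, h3, h4⟩ := h
    have := (Nat.le_div_iff_mul_le h1).mp h4
    have hpos := Nat.mul_pos h1 h3
    refine ⟨⟨hpos, by linarith [mul_comm n m]⟩, by simp, hpos.ne'⟩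
  · rintro ⟨d, n, m⟩ h
    simp only [Finset.mem_sigma, Finset.mem_Icc, Nat.mem_divisorsAntidiagonal] at h ⊢
    obtain ⟨⟨h1, h2⟩, rfl, h3⟩ := h
    have hn : 1 ≤ n := Nat.pos_of_ne_zero (left_ne_zero_of_mul h3)
    have hm : 1 ≤ m := Nat.pos_of_ne_zero (right_ne_zero_of_mul h3)
    refine ⟨⟨hn, (Nat.le_mul_of_pos_right n hm).trans h2⟩, hm, ?_⟩
    rw [Nat.le_div_iff_mul_le hn, mul_comm]
    exact h2
  · rintro ⟨n, m⟩ _; rfl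
  · rintro ⟨d, n, m⟩ h
    simp only [Finset.mem_sigma, Nat.mem_divisorsAntidiagonal] at h
    obtain ⟨_, rfl, _⟩ := h
    rfl
  · rintro ⟨n, m⟩ _; rfl

/-- The coefficient of the Ramanujan sum `c_q` in the Goldston–Yıldırım divisor sum. -/
noncomputable def gyCoeff (R : ℝ) (q : ℕ) : ℝ :=
  ∑ d ∈ Finset.Icc 1 ⌊R⌋₊ with q ∣ d, lambdaGY R d / d

/-- The coefficient of the Ramanujan sum `c_q` in `α_R / G(R)`. -/
noncomputable def selbergCoeff (R : ℝ) (q : ℕ) : ℝ := (μ q : ℝ) / q.totient / G R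

/-- The condition q ∣ d is opened as the convolution of the indicator of radical q with μ. Writing d
= nm, the inner sum over m ≤ R/n is `logMoebius`. -/
lemma moebius_mul_log_mul_gyCoeff {R : ℝ} (hR : 1 < R) {q : ℕ} (hq : Squarefree q) :
    (μ q : ℝ) * (Real.log R * gyCoeff R q) =
      ∑ n ∈ Finset.Icc 1 ⌊R⌋₊ with radical n = q, (n : ℝ)⁻¹ * logMoebius (R / n) := by
  have hlog : Real.log R ≠ 0 := (Real.log_pos hR).ne'
  have hR : ∑ n ∈ Finset.Icc 1 ⌊R⌋₊ with radical n = q, (n : ℝ)⁻¹ * logMoebius (R / n) =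
      ∑ n ∈ Finset.Icc 1 ⌊R⌋₊, ∑ m ∈ Finset.Icc 1 (⌊R⌋₊ / n),
        ((if radical n = q then 1 else 0) * μ m : ℤ) * (((n * m : ℕ) : ℝ)⁻¹ * Real.log (R / (n * m : ℕ))) := by
    rw [Finset.sum_filter]
    refine Finset.sum_congr rfl fun n hn => ?_
    split_ifs
    · rw [logMoebius, Nat.floor_div_natCast, Finset.mul_sum]
      refine Finset.sum_congr rfl fun m _ => ?_
      push_cast
      rw [mul_inv, div_div]
      ring
    · simp
  rw [hR, sum_divisorsAntidiagonal_eq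
    (fun n m => ((if radical n = q then 1 else 0) * μ m : ℤ) * (((n * m : ℕ) : ℝ)⁻¹ * Real.log (R / (n * m : ℕ))))]
  rw [gyCoeff, Finset.mul_sum, Finset.mul_sum, Finset.sum_filter]
  refine Finset.sum_congr rfl fun d _ => ?_
  have : ∑ x ∈ d.divisorsAntidiagonal, (((if radical x.1 = q then 1 else 0) * μ x.2 : ℤ) : ℝ) *
      (((x.1 * x.2 : ℕ) : ℝ)⁻¹ * Real.log (R / (x.1 * x.2 : ℕ))) =
      ((∑ x ∈ d.divisorsAntidiagonal, (if radical x.1 = q then 1 else 0) * μ x.2 : ℤ) : ℝ) *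
        ((d : ℝ)⁻¹ * Real.log (R / d)) := by
    rw [Int.cast_sum, Finset.sum_mul]
    refine Finset.sum_congr rfl fun x hx => ?_
    rw [(Nat.mem_divisorsAntidiagonal.mp hx).1]
  rw [this, sum_moebius_radical_eq hq]
  split_ifs
  · rw [lambdaGY]
    push_cast
    field_simp
  · simp

lemma gyCoeff_of_not_squarefree (R : ℝ) {q : ℕ} (hq : ¬ Squarefree q) : gyCoeff R q = 0 := by
  refine Finset.sum_eq_zero fun d hd => ?_
  have : ¬ Squarefree d := fun h => hq (h.squarefree_of_dvd (Finset.mem_filter.mp hd).2)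
  rw [lambdaGY, ArithmeticFunction.moebius_eq_zero_of_not_squarefree this]
  simp

lemma selbergCoeff_of_not_squarefree (R : ℝ) {q : ℕ} (hq : ¬ Squarefree q) : selbergCoeff R q = 0 := by
  rw [selbergCoeff, ArithmeticFunction.moebius_eq_zero_of_not_squarefree hq]
  simp

/-- With v = 1/φ(q) and w the part of v coming from n ≤ R, the error is A − (v − w). Cauchy–Schwarz
gives A² ≤ wB ≤ vB, and (v − w)² ≤ v(v − w); the factor φ(q) cancels v. -/
lemma totient_mul_gyCoeff_error_sq_le {R : ℝ} (hR : 1 < R) {q : ℕ} (hq : Squarefree q) :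
    (q.totient : ℝ) * ((μ q : ℝ) * (Real.log R * gyCoeff R q) - (q.totient : ℝ)⁻¹) ^ 2 ≤
      2 * (∑ n ∈ Finset.Icc 1 ⌊R⌋₊ with radical n = q, (n : ℝ)⁻¹ * (logMoebius (R / n) - 1) ^ 2) +
      2 * ((μ q : ℝ) ^ 2 / q.totient - radSum ⌊R⌋₊ q) := by
  rw [moebius_mul_log_mul_gyCoeff hR hq]
  have hv : (μ q : ℝ) ^ 2 / q.totient = (q.totient : ℝ)⁻¹ := by
    rw [moebius_sq_div_totient, if_pos hq]
  have hle := radSum_le ⌊R⌋₊ q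
  have hw0 := radSum_nonneg ⌊R⌋₊ q
  rw [hv] at hle ⊢
  have hφ : (0 : ℝ) < q.totient := by
    exact_mod_cast Nat.totient_pos.mpr (Nat.pos_of_ne_zero hq.ne_zero)
  set v : ℝ := (q.totient : ℝ)⁻¹ with hvdef
  have hφv : (q.totient : ℝ) * v = 1 := mul_inv_cancel₀ hφ.ne'
  set S := {n ∈ Finset.Icc 1 ⌊R⌋₊ | radical n = q}
  set w := radSum ⌊R⌋₊ q with hw
  set A := ∑ n ∈ S, (n : ℝ)⁻¹ * (logMoebius (R / n) - 1)
  set B := ∑ n ∈ S, (n : ℝ)⁻¹ * (logMoebius (R / n) - 1) ^ 2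
  have hB0 : 0 ≤ B := Finset.sum_nonneg fun n _ => by positivity
  have e : ∑ n ∈ S, (n : ℝ)⁻¹ * logMoebius (R / n) - v = A - (v - w) := by
    have : A = ∑ n ∈ S, (n : ℝ)⁻¹ * logMoebius (R / n) - w := by
      rw [hw, radSum, ← Finset.sum_sub_distrib]
      refine Finset.sum_congr rfl fun n _ => by ring
    rw [this]; ring
  have hcs : A ^ 2 ≤ w * B := by
    refine Finset.sum_sq_le_sum_mul_sum_of_sq_le_mul S (f := fun n : ℕ => (n : ℝ)⁻¹)
      (g := fun n : ℕ => (n : ℝ)⁻¹ * (logMoebius (R / n) - 1) ^ 2) ?_ ?_ ?_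
    · intro n _; positivity
    · intro n _; positivity
    · intro n _; exact le_of_eq (by ring)
  rw [e]
  have h1 : (A - (v - w)) ^ 2 ≤ 2 * (v * B) + 2 * (v * (v - w)) := by
    have h2 : w * B ≤ v * B := by gcongr
    nlinarith [sq_nonneg (A + (v - w)), mul_nonneg hw0 (sub_nonneg.mpr hle)]
  calc (q.totient : ℝ) * (A - (v - w)) ^ 2 ≤ q.totient * (2 * (v * B) + 2 * (v * (v - w))) := by gcongr
    _ = (q.totient * v) * (2 * B + 2 * (v - w)) := by ring
    _ = _ := by rw [hφv, one_mul]

lemma one_le_G {R : ℝ} (hR : 1 ≤ R) : 1 ≤ G R := by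
  have h1 : 1 ∈ Finset.Icc 1 ⌊R⌋₊ := Finset.mem_Icc.mpr ⟨le_rfl, (Nat.one_le_floor_iff R).mpr hR⟩
  have := Finset.single_le_sum (f := fun m : ℕ => (μ m : ℝ) ^ 2 / (Nat.totient m : ℝ))
    (fun m _ => by positivity) h1
  simpa [G] using this

/-- Both coefficients are compared with the intermediate value μ(q)/(φ(q) log R). -/
lemma totient_mul_coeff_sub_sq_le {R : ℝ} (hR : 1 < R) {q : ℕ} (hq : Squarefree q) :
    (q.totient : ℝ) * (gyCoeff R q - selbergCoeff R q) ^ 2 ≤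
      2 * ((μ q : ℝ) ^ 2 / q.totient) * ((Real.log R)⁻¹ - (G R)⁻¹) ^ 2 +
      2 * ((Real.log R) ^ 2)⁻¹ *
        ((q.totient : ℝ) * ((μ q : ℝ) * (Real.log R * gyCoeff R q) - (q.totient : ℝ)⁻¹) ^ 2) := by
  have hlog : 0 < Real.log R := Real.log_pos hR
  have hG : 0 < G R := by linarith [one_le_G hR.le]
  have hφ : (0 : ℝ) < q.totient := by
    exact_mod_cast Nat.totient_pos.mpr (Nat.pos_of_ne_zero hq.ne_zero)
  have hμ : (μ q : ℝ) ^ 2 = 1 := by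
    exact_mod_cast ArithmeticFunction.moebius_sq_eq_one_of_squarefree hq
  set E := (μ q : ℝ) * (Real.log R * gyCoeff R q) - (q.totient : ℝ)⁻¹ with hE
  have e : (gyCoeff R q - selbergCoeff R q) ^ 2 =
      ((q.totient : ℝ)⁻¹ * ((Real.log R)⁻¹ - (G R)⁻¹) + (Real.log R)⁻¹ * E) ^ 2 := by
    have : (q.totient : ℝ)⁻¹ * ((Real.log R)⁻¹ - (G R)⁻¹) + (Real.log R)⁻¹ * E =
        μ q * (gyCoeff R q - selbergCoeff R q) := by
      rw [hE, selbergCoeff]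
      have hl := mul_inv_cancel₀ hlog.ne'
      field_simp
      linear_combination (Real.log R) * hμ
    rw [this, mul_pow, hμ, one_mul]
  rw [e, hμ]
  have h2 : ((q.totient : ℝ)⁻¹ * ((Real.log R)⁻¹ - (G R)⁻¹) + (Real.log R)⁻¹ * E) ^ 2 ≤
      2 * ((q.totient : ℝ)⁻¹ * ((Real.log R)⁻¹ - (G R)⁻¹)) ^ 2 + 2 * ((Real.log R)⁻¹ * E) ^ 2 := by
    nlinarith [sq_nonneg ((q.totient : ℝ)⁻¹ * ((Real.log R)⁻¹ - (G R)⁻¹) - (Real.log R)⁻¹ * E)]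
  calc _ ≤ (q.totient : ℝ) * (2 * ((q.totient : ℝ)⁻¹ * ((Real.log R)⁻¹ - (G R)⁻¹)) ^ 2 +
        2 * ((Real.log R)⁻¹ * E) ^ 2) := by gcongr
    _ = _ := by
      field_simp

/-- The quadratic form of the difference of the two weights. -/
noncomputable def coeffDist (R : ℝ) : ℝ :=
  ∑ q ∈ Finset.Icc 1 ⌊R⌋₊, (q.totient : ℝ) * (gyCoeff R q - selbergCoeff R q) ^ 2

lemma exists_coeffDist_le : ∃ C : ℝ, 0 ≤ C ∧ ∀ R : ℝ, 1 < R →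
    coeffDist R ≤ C / (Real.log R) ^ 2 := by
  obtain ⟨C₁, hC₁, h₁⟩ := exists_sum_logMoebius_sub_one_sq_le
  obtain ⟨C₂, hC₂, h₂⟩ := exists_sum_sub_radSum_le
  obtain ⟨C₃, hC₃, h₃⟩ := exists_G_le
  refine ⟨2 * C₃ ^ 2 + 4 * (C₁ + C₂), by positivity, fun R hR => ?_⟩
  have hlog : 0 < Real.log R := Real.log_pos hR
  have hG1 := one_le_G hR.le
  have hG : 0 < G R := by linarith
  set Q := ⌊R⌋₊
  have hQ : 1 ≤ Q := (Nat.one_le_floor_iff R).mpr hR.le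
  have hterm : ∀ q ∈ Finset.Icc 1 Q, (q.totient : ℝ) * (gyCoeff R q - selbergCoeff R q) ^ 2 ≤
      2 * ((μ q : ℝ) ^ 2 / q.totient) * ((Real.log R)⁻¹ - (G R)⁻¹) ^ 2 +
      2 * ((Real.log R) ^ 2)⁻¹ *
        (2 * (∑ n ∈ Finset.Icc 1 Q with radical n = q, (n : ℝ)⁻¹ * (logMoebius (R / n) - 1) ^ 2) +
        2 * ((μ q : ℝ) ^ 2 / q.totient - radSum Q q)) := by
    intro q _
    by_cases hq : Squarefree q
    · refine (totient_mul_coeff_sub_sq_le hR hq).trans ?_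
      gcongr
      exact totient_mul_gyCoeff_error_sq_le hR hq
    · rw [gyCoeff_of_not_squarefree R hq, selbergCoeff_of_not_squarefree R hq]
      have h1 := sub_nonneg.mpr (radSum_le Q q)
      have h2 : 0 ≤ ∑ n ∈ Finset.Icc 1 Q with radical n = q, (n : ℝ)⁻¹ * (logMoebius (R / n) - 1) ^ 2 :=
        Finset.sum_nonneg fun n _ => by positivity
      simp only [sub_zero, ne_eq, OfNat.ofNat_ne_zero, not_false_eq_true, zero_pow, mul_zero]
      positivity
  have hfib : ∑ q ∈ Finset.Icc 1 Q, ∑ n ∈ Finset.Icc 1 Q with radical n = q,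
      (n : ℝ)⁻¹ * (logMoebius (R / n) - 1) ^ 2 ≤ C₁ := by
    rw [Finset.sum_fiberwise_of_maps_to]
    · exact h₁ R hR.le
    · intro n hn
      rw [Finset.mem_Icc] at hn ⊢
      exact ⟨Nat.radical_pos n, radical_le_of_le hn.1 hn.2⟩
  have hGsum : ∑ q ∈ Finset.Icc 1 Q, (μ q : ℝ) ^ 2 / q.totient = G R := rfl
  -- Summing over q yields (G − log R)²/(G log² R), where G − log R is bounded and G ≥ 1.
  have hmain : 2 * G R * ((Real.log R)⁻¹ - (G R)⁻¹) ^ 2 ≤ 2 * C₃ ^ 2 * ((Real.log R) ^ 2)⁻¹ := by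
    have hd0 : 0 ≤ G R - Real.log R := sub_nonneg.mpr (log_le_G (by linarith))
    have hd1 : G R - Real.log R ≤ C₃ := by linarith [h₃ R hR.le]
    have e : 2 * G R * ((Real.log R)⁻¹ - (G R)⁻¹) ^ 2 =
        2 * (G R - Real.log R) ^ 2 * ((Real.log R) ^ 2)⁻¹ * (G R)⁻¹ := by
      field_simp
    rw [e]
    calc _ ≤ 2 * C₃ ^ 2 * ((Real.log R) ^ 2)⁻¹ * 1 := by
          gcongr
          exact inv_le_one_of_one_le₀ hG1
      _ = _ := mul_one _
  rw [coeffDist]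
  refine (Finset.sum_le_sum hterm).trans ?_
  rw [Finset.sum_add_distrib, ← Finset.sum_mul, ← Finset.mul_sum, hGsum, ← Finset.mul_sum,
    Finset.sum_add_distrib, ← Finset.mul_sum, ← Finset.mul_sum]
  calc _ ≤ 2 * C₃ ^ 2 * ((Real.log R) ^ 2)⁻¹ + 2 * ((Real.log R) ^ 2)⁻¹ * (2 * C₁ + 2 * C₂) := by
        gcongr
        exact h₂ Q hQ
    _ = _ := by ring

/-- Only q = 1 occurs and both coefficients are 1. This settles the range where log R may be
arbitrarily small. -/
lemma coeffDist_of_lt_two {R : ℝ} (hR : 1 < R) (hR2 : R < 2) : coeffDist R = 0 := by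
  have hfl : ⌊R⌋₊ = 1 := by
    rw [Nat.floor_eq_iff (by linarith)]
    exact ⟨by simpa using hR.le, by norm_num; linarith⟩
  have hlog : Real.log R ≠ 0 := (Real.log_pos hR).ne'
  have h1 : gyCoeff R 1 = 1 := by
    simp [gyCoeff, hfl, lambdaGY, div_self hlog]
  have h2 : selbergCoeff R 1 = 1 := by
    simp [selbergCoeff, hfl, G]
  simp [coeffDist, hfl, h1, h2]

end SelbergSieve

end

/-! ### Ramanujan sums and the expansions of the two sieve sums. -/

section

open scoped ArithmeticFunction.Moebius

namespace SelbergSieve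

lemma e_add (x y : ℝ) : e (x + y) = e x * e y := by
  rw [e, e, e, ← Complex.exp_add]
  push_cast
  ring_nf

lemma e_eq_one_iff (x : ℝ) : e x = 1 ↔ ∃ k : ℤ, x = k := by
  rw [e, Complex.exp_eq_one_iff]
  have h : (2 * Real.pi * Complex.I : ℂ) ≠ 0 := by
    simp [Real.pi_ne_zero]
  refine exists_congr fun k => ?_
  rw [show (2 * Real.pi * x * Complex.I : ℂ) = x * (2 * Real.pi * Complex.I) by ring,
    mul_left_inj' h]
  norm_cast

lemma e_natCast_mul (j : ℕ) (x : ℝ) : e (j * x) = e x ^ j := by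
  rw [e, e, ← Complex.exp_nat_mul]
  push_cast
  ring_nf

lemma norm_e (x : ℝ) : ‖e x‖ = 1 := by
  rw [e, show (2 * Real.pi * x * Complex.I : ℂ) = ((2 * Real.pi * x : ℝ) : ℂ) * Complex.I by push_cast; ring]
  exact Complex.norm_exp_ofReal_mul_I _

lemma conj_e (x : ℝ) : (starRingEnd ℂ) (e x) = e (-x) := by
  rw [e, e, ← Complex.exp_conj]
  simp [Complex.conj_ofNat]

/-- The Ramanujan sum `c_q(n)`. -/
noncomputable def ramanujan (q : ℕ) (n : ℤ) : ℂ := ∑ a ∈ reducedResidues q, e ((a : ℝ) * n / q)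

lemma sum_e_mul_div {d : ℕ} (hd : 0 < d) (n : ℤ) :
    ∑ j ∈ Finset.Icc 1 d, e ((j : ℝ) * n / d) = if (d : ℤ) ∣ n then (d : ℂ) else 0 := by
  have hd0 : (d : ℝ) ≠ 0 := by exact_mod_cast hd.ne'
  set z := e ((n : ℝ) / d) with hz
  have hpow : ∀ j : ℕ, e ((j : ℝ) * n / d) = z ^ j := fun j => by
    rw [hz, ← e_natCast_mul, mul_div_assoc]
  simp_rw [hpow]
  have hz1 : z = 1 ↔ (d : ℤ) ∣ n := by
    rw [hz, e_eq_one_iff]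
    refine exists_congr fun k => ?_
    rw [div_eq_iff hd0, mul_comm]
    norm_cast
  have hzd : z ^ d = 1 := by
    rw [← hpow, mul_div_cancel_left₀ _ hd0, e_eq_one_iff]
    exact ⟨n, rfl⟩
  split_ifs with h
  · rw [hz1.mpr h]; simp
  · have hne : z ≠ 1 := fun h1 => h (hz1.mp h1)
    have h2 : ∑ j ∈ Finset.Icc 1 d, z ^ j = z * ∑ j ∈ Finset.range d, z ^ j := by
      rw [Finset.mul_sum, Finset.range_eq_Ico, ← Finset.Ico_add_one_right_eq_Icc,
        ← Finset.sum_Ico_add' (fun j => z ^ j) 0 d 1]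
      exact Finset.sum_congr rfl fun j _ => pow_succ' z j
    rw [h2, geom_sum_eq hne, hzd]
    simp

/-- The j selected are those for which j/d has denominator q in lowest terms. -/
lemma sum_gcd_fiber {d q : ℕ} (hd : 0 < d) (hq : q ∣ d) (n : ℤ) :
    ∑ j ∈ Finset.Icc 1 d with d / Nat.gcd j d = q, e ((j : ℝ) * n / d) = ramanujan q n := by
  obtain ⟨g, rfl⟩ := hq
  have hq0 : 0 < q := Nat.pos_of_mul_pos_right hd
  have hg0 : 0 < g := Nat.pos_of_mul_pos_left hd
  have hgcd : ∀ j : ℕ, (q * g) / Nat.gcd j (q * g) = q ↔ Nat.gcd j (q * g) = g := by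
    intro j
    have hpos : 0 < Nat.gcd j (q * g) := Nat.gcd_pos_of_pos_right _ hd
    rw [Nat.div_eq_iff_eq_mul_left hpos (Nat.gcd_dvd_right _ _)]
    constructor
    · intro h; exact (Nat.eq_of_mul_eq_mul_left hq0 h).symm
    · intro h; rw [h]
  rw [ramanujan]
  have hset : {j ∈ Finset.Icc 1 (q * g) | (q * g) / Nat.gcd j (q * g) = q} =
      (reducedResidues q).image (fun a => a * g) := by
    ext j
    simp only [Finset.mem_filter, Finset.mem_image, Finset.mem_Icc, hgcd, reducedResidues]
    constructor
    · rintro ⟨⟨h1, h2⟩, h3⟩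
      obtain ⟨a, rfl⟩ : g ∣ j := h3 ▸ Nat.gcd_dvd_left _ _
      rw [mul_comm g a, Nat.gcd_mul_right] at h3
      refine ⟨a, ⟨⟨Nat.pos_of_mul_pos_left h1, ?_⟩, ?_⟩, mul_comm _ _⟩
      · rw [mul_comm q g] at h2; exact Nat.le_of_mul_le_mul_left h2 hg0
      · exact Nat.eq_of_mul_eq_mul_right hg0 (by rw [h3, one_mul])
    · rintro ⟨a, ⟨⟨h1, h2⟩, h3⟩, rfl⟩
      refine ⟨⟨Nat.mul_pos h1 hg0, Nat.mul_le_mul_right g h2⟩, ?_⟩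
      rw [Nat.gcd_mul_right, h3.gcd_eq_one, one_mul]
  rw [hset, Finset.sum_image fun a _ b _ h => Nat.eq_of_mul_eq_mul_right hg0 h]
  refine Finset.sum_congr rfl fun a _ => ?_
  congr 1
  have hg0' : (g : ℝ) ≠ 0 := by exact_mod_cast hg0.ne'
  have hq0' : (q : ℝ) ≠ 0 := by exact_mod_cast hq0.ne'
  push_cast
  field_simp

lemma sum_ramanujan_divisors {d : ℕ} (hd : 0 < d) (n : ℤ) :
    ∑ q ∈ d.divisors, ramanujan q n = if (d : ℤ) ∣ n then (d : ℂ) else 0 := by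
  rw [← sum_e_mul_div hd, ← Finset.sum_fiberwise_of_maps_to (s := Finset.Icc 1 d) (t := d.divisors)
    (g := fun j => d / Nat.gcd j d)]
  · exact (Finset.sum_congr rfl fun q hq => sum_gcd_fiber hd (Nat.dvd_of_mem_divisors hq) n).symm
  · intro j _
    exact Nat.mem_divisors.mpr ⟨Nat.div_dvd_of_dvd (Nat.gcd_dvd_right _ _), hd.ne'⟩

/-- Inverting the divisor sum gives c_q(n) as a sum over common divisors of n and q, and only the
divisor 1 is left. -/
lemma ramanujan_of_coprime {q : ℕ} (hq : 0 < q) {n : ℕ} (h : Nat.Coprime n q) :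
    ramanujan q n = (μ q : ℂ) := by
  have key := (ArithmeticFunction.sum_eq_iff_sum_mul_moebius_eq (R := ℂ)
    (f := fun q => ramanujan q n) (g := fun d => if (d : ℤ) ∣ (n : ℤ) then (d : ℂ) else 0)).mp
    (fun d hd => sum_ramanujan_divisors hd n) q hq
  rw [← key, Finset.sum_eq_single (q, 1)]
  · simp
  · intro x hx hne
    have hx' := Nat.mem_divisorsAntidiagonal.mp hx
    rw [if_neg, mul_zero]
    intro hdvd
    apply hne
    have h2 : x.2 ∣ n := by exact_mod_cast hdvd
    have h3 : x.2 ∣ q := ⟨x.1, by rw [mul_comm, hx'.1]⟩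
    have h4 : x.2 = 1 := Nat.eq_one_of_dvd_coprimes h h2 h3
    have h5 : x.1 = q := by rw [← hx'.1, h4, mul_one]
    exact Prod.ext h5 h4
  · intro h
    exact absurd (Nat.mem_divisorsAntidiagonal.mpr ⟨mul_one q, hq.ne'⟩) h

lemma card_reducedResidues (q : ℕ) : (reducedResidues q).card = q.totient := by
  rw [← Nat.filter_coprime_Ico_eq_totient q 1, add_comm 1 q, Finset.Ico_add_one_right_eq_Icc, reducedResidues]
  simp_rw [Nat.coprime_comm]

lemma s_eq {a q : ℕ} (ha : a ∈ reducedResidues q) : s a q = (μ q : ℂ) / q.totient := by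
  simp only [reducedResidues, Finset.mem_filter, Finset.mem_Icc] at ha
  rw [s, card_reducedResidues]
  congr 1
  rw [← ramanujan_of_coprime (ha.1.1.trans ha.1.2) ha.2, ramanujan]
  refine Finset.sum_congr rfl fun m _ => ?_
  rw [mul_comm (a : ℝ), Int.cast_natCast]

/-- Linear combination of Ramanujan sums. -/
noncomputable def ramanujanSum (b : ℕ → ℝ) (Q n : ℕ) : ℂ :=
  ∑ q ∈ Finset.Icc 1 Q, (b q : ℂ) * ramanujan q (-n)

lemma alpha_div_G (R : ℝ) (n : ℕ) :
    alpha R n / (G R : ℂ) = ramanujanSum (selbergCoeff R) ⌊R⌋₊ n := by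
  rw [alpha, ramanujanSum, Finset.sum_div]
  refine Finset.sum_congr rfl fun q _ => ?_
  rw [ramanujan, Finset.mul_sum, Finset.sum_div]
  refine Finset.sum_congr rfl fun a ha => ?_
  rw [s_eq ha, selbergCoeff]
  push_cast
  rw [mul_neg, neg_div]
  ring

/-- Expand 1_{d ∣ n} = d⁻¹ Σ_{q ∣ d} c_q(−n) and collect the coefficient of each c_q. -/
lemma sum_lambdaGY (R : ℝ) (n : ℕ) :
    ((∑ d ∈ (Finset.Icc 1 ⌊R⌋₊).filter (fun d => d ∣ n), lambdaGY R d : ℝ) : ℂ) =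
      ramanujanSum (gyCoeff R) ⌊R⌋₊ n := by
  have h1 : ∀ q ∈ Finset.Icc 1 ⌊R⌋₊, ((gyCoeff R q : ℝ) : ℂ) * ramanujan q (-n) =
      ∑ d ∈ Finset.Icc 1 ⌊R⌋₊, if q ∣ d then ((lambdaGY R d / d : ℝ) : ℂ) * ramanujan q (-n) else 0 := by
    intro q _
    rw [gyCoeff, Complex.ofReal_sum, Finset.sum_mul, Finset.sum_filter]
  rw [ramanujanSum, Finset.sum_congr rfl h1, Finset.sum_comm, Complex.ofReal_sum, Finset.sum_filter]
  refine Finset.sum_congr rfl fun d hd => ?_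
  rw [Finset.mem_Icc] at hd
  have hset : {q ∈ Finset.Icc 1 ⌊R⌋₊ | q ∣ d} = d.divisors := by
    ext q
    simp only [Finset.mem_filter, Finset.mem_Icc, Nat.mem_divisors]
    constructor
    · rintro ⟨_, h⟩; exact ⟨h, by omega⟩
    · rintro ⟨h, _⟩
      exact ⟨⟨Nat.pos_of_dvd_of_pos h hd.1, (Nat.le_of_dvd hd.1 h).trans hd.2⟩, h⟩
  rw [← Finset.sum_filter, hset, ← Finset.mul_sum, sum_ramanujan_divisors hd.1]
  have hd0 : (d : ℂ) ≠ 0 := by exact_mod_cast (show d ≠ 0 by omega)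
  have hiff : ((d : ℤ) ∣ -(n : ℤ)) ↔ d ∣ n := by
    rw [Int.dvd_neg]; norm_cast
  simp only [hiff]
  split_ifs
  · push_cast
    field_simp
  · simp

end SelbergSieve

end

/-! ### A dual large sieve for Farey fractions. -/

namespace SelbergSieve

/-- The Dirichlet-type kernel `∑_{j < M} e(jθ)`. -/
noncomputable def expKernel (M : ℕ) (θ : ℝ) : ℂ := ∑ j ∈ Finset.range M, e (j * θ)

lemma norm_expKernel_le (M : ℕ) (θ : ℝ) : ‖expKernel M θ‖ ≤ M := by
  refine (norm_sum_le _ _).trans (le_of_eq ?_)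
  simp [norm_e]

lemma conj_expKernel (M : ℕ) (θ : ℝ) : (starRingEnd ℂ) (expKernel M θ) = expKernel M (-θ) := by
  rw [expKernel, expKernel, map_sum]
  refine Finset.sum_congr rfl fun j _ => ?_
  rw [conj_e, mul_neg]

lemma norm_expKernel_neg (M : ℕ) (θ : ℝ) : ‖expKernel M (-θ)‖ = ‖expKernel M θ‖ := by
  rw [← conj_expKernel, Complex.norm_conj]

lemma four_mul_abs_le_norm_e_sub_one {t : ℝ} (ht : |t| ≤ 1 / 2) : 4 * |t| ≤ ‖e t - 1‖ := by
  have h1 : e t = Complex.exp (Complex.I * ((2 * Real.pi * t : ℝ) : ℂ)) := by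
    rw [e]; push_cast; ring_nf
  rw [h1, Complex.norm_exp_I_mul_ofReal_sub_one, norm_mul, Real.norm_two, Real.norm_eq_abs]
  have h2 := Real.mul_abs_le_abs_sin (x := 2 * Real.pi * t / 2) (by
    rw [show 2 * Real.pi * t / 2 = Real.pi * t by ring, abs_mul, abs_of_pos Real.pi_pos]
    nlinarith [Real.pi_pos])
  have h3 : 2 / Real.pi * |2 * Real.pi * t / 2| = 2 * |t| := by
    rw [show 2 * Real.pi * t / 2 = Real.pi * t by ring, abs_mul, abs_of_pos Real.pi_pos]
    field_simp
  linarith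

/-- The geometric sum gives |K(θ)| ≤ 2/|e(θ) − 1|, and |e(t) − 1| ≥ 4|t| for |t| ≤ 1/2. -/
lemma norm_expKernel_sq_mul_le (M : ℕ) (θ : ℝ) :
    ‖expKernel M θ‖ ^ 2 * (4 * (θ - round θ) ^ 2) ≤ 1 := by
  set t := θ - round θ with ht
  have he : e θ = e t := by
    have : θ = t + (round θ : ℤ) := by rw [ht]; ring
    conv_lhs => rw [this]
    rw [e_add, (e_eq_one_iff _).mpr ⟨round θ, rfl⟩, mul_one]
  have hsum : expKernel M θ * (e θ - 1) = e θ ^ M - 1 := by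
    rw [expKernel, ← geom_sum_mul]
    congr 1
    exact Finset.sum_congr rfl fun j _ => e_natCast_mul j θ
  have h1 : ‖expKernel M θ‖ * ‖e θ - 1‖ ≤ 2 := by
    rw [← norm_mul, hsum]
    refine (norm_sub_le _ _).trans ?_
    rw [norm_pow, norm_e, one_pow, norm_one]
    norm_num
  have h2 : 4 * |t| ≤ ‖e θ - 1‖ := by
    rw [he]
    exact four_mul_abs_le_norm_e_sub_one (abs_sub_round θ)
  have h3 : ‖expKernel M θ‖ * (4 * |t|) ≤ 2 :=
    (mul_le_mul_of_nonneg_left h2 (norm_nonneg _)).trans h1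
  have h4 : (‖expKernel M θ‖ * (4 * |t|)) ^ 2 ≤ 2 ^ 2 := by gcongr
  have h5 : (‖expKernel M θ‖ * (4 * |t|)) ^ 2 = 4 * (‖expKernel M θ‖ ^ 2 * (4 * t ^ 2)) := by
    rw [mul_pow, mul_pow, sq_abs]; ring
  linarith

/-- The majorant used to sum the squared kernel over spaced points. -/
noncomputable def kernelMajorant (M : ℕ) (δ : ℝ) (k : ℤ) : ℝ :=
  ((if k = 0 then (M : ℝ) ^ 2 else 0) + (if k = -1 then (M : ℝ) ^ 2 else 0)) +
    ((4 * δ ^ 2)⁻¹ * ((k : ℝ) ^ 2)⁻¹ + (4 * δ ^ 2)⁻¹ * (((k + 1 : ℤ) : ℝ) ^ 2)⁻¹)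

lemma norm_expKernel_sq_le_majorant (M : ℕ) {δ : ℝ} (hδ : 0 < δ) (θ : ℝ) :
    ‖expKernel M θ‖ ^ 2 ≤ kernelMajorant M δ ⌊(θ - round θ) / δ⌋ := by
  set t := θ - round θ with ht
  set k := ⌊t / δ⌋ with hk
  have h1 : (k : ℝ) * δ ≤ t := by
    rw [← le_div_iff₀ hδ]; exact Int.floor_le _
  have h2 : t < ((k + 1 : ℤ) : ℝ) * δ := by
    rw [← div_lt_iff₀ hδ]; push_cast; exact Int.lt_floor_add_one _
  have hM : ‖expKernel M θ‖ ^ 2 ≤ (M : ℝ) ^ 2 := by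
    gcongr; exact norm_expKernel_le M θ
  have hp1 : 0 ≤ (4 * δ ^ 2)⁻¹ * ((k : ℝ) ^ 2)⁻¹ := by positivity
  have hp2 : 0 ≤ (4 * δ ^ 2)⁻¹ * (((k + 1 : ℤ) : ℝ) ^ 2)⁻¹ := by positivity
  have hM2 : (0 : ℝ) ≤ (M : ℝ) ^ 2 := by positivity
  have hp3 : 0 ≤ (if k = 0 then (M : ℝ) ^ 2 else 0) := by split_ifs <;> simp
  have hp4 : 0 ≤ (if k = -1 then (M : ℝ) ^ 2 else 0) := by split_ifs <;> simp
  have key := norm_expKernel_sq_mul_le M θ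
  have gen : ∀ m : ℝ, m ≠ 0 → (m * δ) ^ 2 ≤ t ^ 2 → ‖expKernel M θ‖ ^ 2 ≤ (4 * δ ^ 2)⁻¹ * (m ^ 2)⁻¹ := by
    intro m hm hmt
    have hm2 : 0 < m ^ 2 := by positivity
    rw [← mul_inv, ← one_div, le_div_iff₀ (by positivity)]
    refine le_trans ?_ key
    have : 4 * δ ^ 2 * m ^ 2 ≤ 4 * t ^ 2 := by nlinarith
    gcongr
  rw [kernelMajorant]
  -- Only in the buckets k = 0 and k = −1 can t be near 0; there the summand M² is used, since the
  -- matching inverse square is 0⁻¹ = 0.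
  rcases lt_trichotomy k 0 with h | h | h
  · rcases eq_or_ne k (-1) with h' | h'
    · rw [if_pos h'] at *; linarith
    · have hk1 : k + 1 ≤ -1 := by omega
      have hk1r : ((k + 1 : ℤ) : ℝ) ≤ -1 := by exact_mod_cast hk1
      have := gen ((k + 1 : ℤ) : ℝ) (by intro h0; rw [h0] at hk1r; linarith) (by
        have : ((k + 1 : ℤ) : ℝ) * δ ≤ 0 := by nlinarith
        nlinarith)
      linarith
  · rw [if_pos h] at *; linarith
  · have hk1r : (1 : ℝ) ≤ k := by exact_mod_cast h
    have := gen k (by linarith) (by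
      have : 0 ≤ (k : ℝ) * δ := by positivity
      nlinarith)
    linarith

lemma summable_int_sq_inv : Summable fun k : ℤ => ((k : ℝ) ^ 2)⁻¹ := by
  simpa using Real.summable_one_div_int_pow.mpr (show 1 < 2 by norm_num)

lemma summable_int_add_one_sq_inv : Summable fun k : ℤ => (((k + 1 : ℤ) : ℝ) ^ 2)⁻¹ :=
  summable_int_sq_inv.comp_injective (i := fun k : ℤ => k + 1) (add_left_injective 1)

lemma exists_sum_kernelMajorant_le : ∃ Z : ℝ, 0 ≤ Z ∧ ∀ (M : ℕ) (δ : ℝ) (J : Finset ℤ),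
    ∑ k ∈ J, kernelMajorant M δ k ≤ 2 * (M : ℝ) ^ 2 + Z * (δ ^ 2)⁻¹ := by
  set Z₁ := ∑' k : ℤ, ((k : ℝ) ^ 2)⁻¹
  set Z₂ := ∑' k : ℤ, (((k + 1 : ℤ) : ℝ) ^ 2)⁻¹
  have h1 : 0 ≤ Z₁ := tsum_nonneg fun k => by positivity
  have h2 : 0 ≤ Z₂ := tsum_nonneg fun k => by positivity
  refine ⟨(Z₁ + Z₂) / 4, by positivity, fun M δ J => ?_⟩
  have hs1 := summable_int_sq_inv.sum_le_tsum J (fun k _ => by positivity)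
  have hs2 := summable_int_add_one_sq_inv.sum_le_tsum J (fun k _ => by positivity)
  have hM : (0 : ℝ) ≤ (M : ℝ) ^ 2 := by positivity
  have hi : ∀ a : ℤ, ∑ k ∈ J, (if k = a then (M : ℝ) ^ 2 else 0) ≤ (M : ℝ) ^ 2 := by
    intro a
    rw [Finset.sum_ite_eq']
    split_ifs <;> simp
  simp only [kernelMajorant]
  rw [Finset.sum_add_distrib, Finset.sum_add_distrib, Finset.sum_add_distrib, ← Finset.mul_sum,
    ← Finset.mul_sum]
  have e : (Z₁ + Z₂) / 4 * (δ ^ 2)⁻¹ = (4 * δ ^ 2)⁻¹ * Z₁ + (4 * δ ^ 2)⁻¹ * Z₂ := by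
    rw [mul_inv]; ring
  rw [e]
  have h3 : (4 * δ ^ 2)⁻¹ * ∑ k ∈ J, ((k : ℝ) ^ 2)⁻¹ ≤ (4 * δ ^ 2)⁻¹ * Z₁ := by gcongr
  have h4 : (4 * δ ^ 2)⁻¹ * ∑ k ∈ J, (((k + 1 : ℤ) : ℝ) ^ 2)⁻¹ ≤ (4 * δ ^ 2)⁻¹ * Z₂ := by gcongr
  linarith [hi 0, hi (-1)]

section LargeSieve

variable {ι : Type*} (I : Finset ι) (x : ι → ℝ) (c : ι → ℝ)

/-- The exponential sum `∑ c_i e(t x_i)` at an integer `t`. -/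
noncomputable def expSum (t : ℤ) : ℂ := ∑ i ∈ I, (c i : ℂ) * e (t * x i)

lemma sum_norm_expSum_sq_eq (M : ℕ) :
    ((∑ j ∈ Finset.range M, ∑ k ∈ Finset.range M, ‖expSum I x c ((j : ℤ) - k)‖ ^ 2 : ℝ) : ℂ) =
      ((∑ i ∈ I, ∑ l ∈ I, c i * c l * ‖expKernel M (x i - x l)‖ ^ 2 : ℝ) : ℂ) := by
  have h1 : ∀ t : ℤ, ((‖expSum I x c t‖ ^ 2 : ℝ) : ℂ) =
      ∑ i ∈ I, ∑ l ∈ I, (c i : ℂ) * c l * e (t * (x i - x l)) := by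
    intro t
    rw [Complex.ofReal_pow, ← Complex.mul_conj', expSum, map_sum, Finset.sum_mul_sum]
    refine Finset.sum_congr rfl fun i _ => Finset.sum_congr rfl fun l _ => ?_
    rw [map_mul, Complex.conj_ofReal, conj_e, mul_sub, sub_eq_add_neg (_ * _), e_add]
    ring
  have h2 : ∀ θ : ℝ, ((‖expKernel M θ‖ ^ 2 : ℝ) : ℂ) =
      ∑ j ∈ Finset.range M, ∑ k ∈ Finset.range M, e (((j : ℤ) - k : ℤ) * θ) := by
    intro θ
    rw [Complex.ofReal_pow, ← Complex.mul_conj', conj_expKernel, expKernel, expKernel, Finset.sum_mul_sum]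
    refine Finset.sum_congr rfl fun j _ => Finset.sum_congr rfl fun k _ => ?_
    rw [← e_add]
    congr 1
    push_cast
    ring
  simp only [Complex.ofReal_sum, h1, Complex.ofReal_mul, h2, Finset.mul_sum]
  calc _ = ∑ j ∈ Finset.range M, ∑ i ∈ I, ∑ k ∈ Finset.range M, ∑ l ∈ I,
        (c i : ℂ) * c l * e (((j : ℤ) - k : ℤ) * (x i - x l)) :=
        Finset.sum_congr rfl fun j _ => Finset.sum_comm
    _ = ∑ i ∈ I, ∑ j ∈ Finset.range M, ∑ k ∈ Finset.range M, ∑ l ∈ I,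
        (c i : ℂ) * c l * e (((j : ℤ) - k : ℤ) * (x i - x l)) := Finset.sum_comm
    _ = _ := by
      refine Finset.sum_congr rfl fun i _ => ?_
      rw [Finset.sum_comm]
      calc _ = ∑ k ∈ Finset.range M, ∑ l ∈ I, ∑ j ∈ Finset.range M,
            (c i : ℂ) * c l * e (((j : ℤ) - k : ℤ) * (x i - x l)) :=
            Finset.sum_congr rfl fun k _ => Finset.sum_comm
        _ = ∑ l ∈ I, ∑ k ∈ Finset.range M, ∑ j ∈ Finset.range M,
            (c i : ℂ) * c l * e (((j : ℤ) - k : ℤ) * (x i - x l)) := Finset.sum_comm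
        _ = _ := Finset.sum_congr rfl fun l _ => Finset.sum_comm

/-- Schur's test: c_i c_l ≤ (c_i² + c_l²)/2 together with the symmetry of the kernel. -/
lemma sum_norm_expSum_sq_le (M : ℕ) (B : ℝ)
    (hB : ∀ i ∈ I, ∑ l ∈ I, ‖expKernel M (x l - x i)‖ ^ 2 ≤ B) :
    ∑ j ∈ Finset.range M, ∑ k ∈ Finset.range M, ‖expSum I x c ((j : ℤ) - k)‖ ^ 2 ≤
      B * ∑ i ∈ I, c i ^ 2 := by
  have h := Complex.ofReal_injective (sum_norm_expSum_sq_eq I x c M)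
  rw [h]
  have hsymm : ∀ i l, ‖expKernel M (x l - x i)‖ = ‖expKernel M (x i - x l)‖ := fun i l => by
    rw [← norm_expKernel_neg, neg_sub]
  have hA : ∑ i ∈ I, ∑ l ∈ I, c i ^ 2 * ‖expKernel M (x i - x l)‖ ^ 2 ≤ B * ∑ i ∈ I, c i ^ 2 := by
    rw [Finset.mul_sum]
    refine Finset.sum_le_sum fun i hi => ?_
    rw [← Finset.mul_sum, mul_comm B]
    refine mul_le_mul_of_nonneg_left ?_ (sq_nonneg _)
    refine le_of_eq_of_le (Finset.sum_congr rfl fun l _ => ?_) (hB i hi)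
    rw [hsymm]
  have hA' : ∑ i ∈ I, ∑ l ∈ I, c l ^ 2 * ‖expKernel M (x i - x l)‖ ^ 2 =
      ∑ i ∈ I, ∑ l ∈ I, c i ^ 2 * ‖expKernel M (x i - x l)‖ ^ 2 := by
    rw [Finset.sum_comm]
    refine Finset.sum_congr rfl fun i _ => Finset.sum_congr rfl fun l _ => ?_
    rw [hsymm]
  calc _ ≤ ∑ i ∈ I, ∑ l ∈ I, (c i ^ 2 * ‖expKernel M (x i - x l)‖ ^ 2 +
        c l ^ 2 * ‖expKernel M (x i - x l)‖ ^ 2) / 2 := by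
        refine Finset.sum_le_sum fun i _ => Finset.sum_le_sum fun l _ => ?_
        have h2 : c i * c l ≤ (c i ^ 2 + c l ^ 2) / 2 := by nlinarith [sq_nonneg (c i - c l)]
        have h3 := mul_le_mul_of_nonneg_right h2 (sq_nonneg ‖expKernel M (x i - x l)‖)
        linarith
    _ = (∑ i ∈ I, ∑ l ∈ I, c i ^ 2 * ‖expKernel M (x i - x l)‖ ^ 2 +
        ∑ i ∈ I, ∑ l ∈ I, c l ^ 2 * ‖expKernel M (x i - x l)‖ ^ 2) / 2 := by
      simp only [← Finset.sum_div, Finset.sum_add_distrib]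
    _ ≤ _ := by rw [hA']; linarith

/-- Every n in [1, N] equals j − k for at least N pairs j, k < 2N, one for each k < N. Averaging
over pairs turns the kernel into the nonnegative |K|². -/
lemma mul_sum_norm_expSum_sq_le (N : ℕ) :
    (N : ℝ) * ∑ n ∈ Finset.Icc 1 N, ‖expSum I x c n‖ ^ 2 ≤
      ∑ j ∈ Finset.range (2 * N), ∑ k ∈ Finset.range (2 * N), ‖expSum I x c ((j : ℤ) - k)‖ ^ 2 := by
  rw [Finset.sum_comm]
  calc (N : ℝ) * ∑ n ∈ Finset.Icc 1 N, ‖expSum I x c n‖ ^ 2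
      = ∑ k ∈ Finset.range N, ∑ n ∈ Finset.Icc 1 N, ‖expSum I x c n‖ ^ 2 := by
        rw [Finset.sum_const, Finset.card_range, nsmul_eq_mul]
    _ ≤ ∑ k ∈ Finset.range N, ∑ j ∈ Finset.range (2 * N), ‖expSum I x c ((j : ℤ) - k)‖ ^ 2 := by
      refine Finset.sum_le_sum fun k hk => ?_
      have hk' := Finset.mem_range.mp hk
      have e : ∑ n ∈ Finset.Icc 1 N, ‖expSum I x c n‖ ^ 2 =
          ∑ j ∈ (Finset.Icc 1 N).image (fun n => n + k), ‖expSum I x c ((j : ℤ) - k)‖ ^ 2 := by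
        rw [Finset.sum_image fun a _ b _ h => Nat.add_right_cancel h]
        refine Finset.sum_congr rfl fun n _ => ?_
        push_cast
        rw [add_sub_cancel_right]
      rw [e]
      refine Finset.sum_le_sum_of_subset_of_nonneg ?_ (fun _ _ _ => by positivity)
      intro j hj
      obtain ⟨n, hn, rfl⟩ := Finset.mem_image.mp hj
      rw [Finset.mem_Icc] at hn
      exact Finset.mem_range.mpr (by omega)
    _ ≤ _ := by
      refine Finset.sum_le_sum_of_subset_of_nonneg (Finset.range_subset_range.mpr (by omega)) ?_
      exact fun _ _ _ => Finset.sum_nonneg fun _ _ => by positivity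

/-- Points δ-separated modulo 1 lie in distinct buckets of length δ, so the majorant is summed over
distinct integers. -/
lemma sum_norm_expKernel_sq_le {Z : ℝ} (hZ : ∀ (M : ℕ) (δ : ℝ) (J : Finset ℤ),
      ∑ k ∈ J, kernelMajorant M δ k ≤ 2 * (M : ℝ) ^ 2 + Z * (δ ^ 2)⁻¹) (M : ℕ) {δ : ℝ} (hδ : 0 < δ)
    (hsep : ∀ i ∈ I, ∀ l ∈ I, i ≠ l → ∀ k : ℤ, δ ≤ |x i - x l - k|) (i : ι) :
    ∑ l ∈ I, ‖expKernel M (x l - x i)‖ ^ 2 ≤ 2 * (M : ℝ) ^ 2 + Z * (δ ^ 2)⁻¹ := by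
  classical
  set t : ι → ℝ := fun l => (x l - x i) - round (x l - x i) with ht
  set κ : ι → ℤ := fun l => ⌊t l / δ⌋ with hκ
  have hinj : Set.InjOn κ (I : Set ι) := by
    intro l hl m hm h
    by_contra hne
    have h1 := hsep l hl m hm hne (round (x l - x i) - round (x m - x i))
    have h2 : x l - x m - ((round (x l - x i) - round (x m - x i) : ℤ) : ℝ) = t l - t m := by
      simp only [ht]; push_cast; ring
    rw [h2] at h1
    have h3 := Int.abs_sub_lt_one_of_floor_eq_floor h
    rw [← sub_div, abs_div, abs_of_pos hδ, div_lt_one hδ] at h3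
    linarith
  calc _ ≤ ∑ l ∈ I, kernelMajorant M δ (κ l) :=
        Finset.sum_le_sum fun l _ => norm_expKernel_sq_le_majorant M hδ _
    _ = ∑ k ∈ I.image κ, kernelMajorant M δ k := (Finset.sum_image hinj).symm
    _ ≤ _ := hZ M δ _

end LargeSieve

/-- A form of the (dual) large sieve inequality for well-spaced points. -/
lemma exists_sum_norm_expSum_sq_le : ∃ Z : ℝ, 0 ≤ Z ∧ ∀ {ι : Type} (I : Finset ι) (x c : ι → ℝ) (N : ℕ)
    (δ : ℝ), 1 ≤ N → 0 < δ → (∀ i ∈ I, ∀ l ∈ I, i ≠ l → ∀ k : ℤ, δ ≤ |x i - x l - k|) →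
    ∑ n ∈ Finset.Icc 1 N, ‖expSum I x c n‖ ^ 2 ≤ (8 * N + Z * (δ ^ 2 * N)⁻¹) * ∑ i ∈ I, c i ^ 2 := by
  obtain ⟨Z, hZ0, hZ⟩ := exists_sum_kernelMajorant_le
  refine ⟨Z, hZ0, fun {ι} I x c N δ hN hδ hsep => ?_⟩
  have hN0 : (0 : ℝ) < N := by exact_mod_cast hN
  have h1 := (mul_sum_norm_expSum_sq_le I x c N).trans (sum_norm_expSum_sq_le I x c (2 * N) _
    (fun i _ => sum_norm_expKernel_sq_le I x hZ (2 * N) hδ hsep i))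
  rw [← le_div_iff₀' hN0] at h1
  refine h1.trans (le_of_eq ?_)
  push_cast
  field_simp
  ring

/-- Distinct Farey fractions of order `Q` are `1/Q²`-separated modulo one. -/
lemma farey_separated {Q a q a' q' : ℕ} (hq : q ∈ Finset.Icc 1 Q) (hq' : q' ∈ Finset.Icc 1 Q)
    (ha : a ∈ reducedResidues q) (ha' : a' ∈ reducedResidues q') (hne : ¬ (q = q' ∧ a = a')) (k : ℤ) :
    ((Q : ℝ) ^ 2)⁻¹ ≤ |(a : ℝ) / q - (a' : ℝ) / q' - k| := by
  simp only [reducedResidues, Finset.mem_filter, Finset.mem_Icc] at hq hq' ha ha'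
  have hq0 : (0 : ℝ) < q := by exact_mod_cast hq.1
  have hq0' : (0 : ℝ) < q' := by exact_mod_cast hq'.1
  have hz : (a : ℤ) * q' - a' * q - k * q * q' ≠ 0 := by
    intro h
    apply hne
    have h1 : (q : ℤ) ∣ a * q' := ⟨a' + k * q', by linear_combination h⟩
    have h2 : (q' : ℤ) ∣ a' * q := ⟨a - k * q, by linear_combination -h⟩
    have h1' : q ∣ a * q' := by exact_mod_cast h1
    have h2' : q' ∣ a' * q := by exact_mod_cast h2
    have hqq : q = q' := Nat.dvd_antisymm
      (Nat.Coprime.dvd_of_dvd_mul_left ha.2.symm h1') (Nat.Coprime.dvd_of_dvd_mul_left ha'.2.symm h2')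
    subst hqq
    refine ⟨rfl, ?_⟩
    have hqz : (q : ℤ) ≠ 0 := by exact_mod_cast (show q ≠ 0 by omega)
    have h3 : (a : ℤ) - a' = k * q := by
      apply mul_right_cancel₀ hqz
      linear_combination h
    have h4 : |(a : ℤ) - a'| < q := by rw [abs_lt]; constructor <;> omega
    have h5 : (a : ℤ) - a' = 0 := Int.eq_zero_of_abs_lt_dvd ⟨k, by rw [h3, mul_comm]⟩ h4
    omega
  have e : (a : ℝ) / q - (a' : ℝ) / q' - k =
      (((a : ℤ) * q' - a' * q - k * q * q' : ℤ) : ℝ) / (q * q') := by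
    push_cast
    field_simp
  have h1 : (1 : ℝ) ≤ |(((a : ℤ) * q' - a' * q - k * q * q' : ℤ) : ℝ)| := by
    exact_mod_cast Int.one_le_abs hz
  have hQ1 : (q : ℝ) ≤ Q := by exact_mod_cast hq.2
  have hQ2 : (q' : ℝ) ≤ Q := by exact_mod_cast hq'.2
  rw [e, abs_div, abs_of_pos (mul_pos hq0 hq0'), ← one_div]
  calc 1 / (Q : ℝ) ^ 2 ≤ 1 / (q * q') := by
        rw [sq]; gcongr
    _ ≤ _ := by gcongr

lemma exists_sum_norm_ramanujanSum_sq_le : ∃ Z : ℝ, 0 ≤ Z ∧ ∀ (b : ℕ → ℝ) (Q N : ℕ) (A : ℝ),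
    1 ≤ Q → 1 ≤ N → (Q : ℝ) ^ 2 ≤ A * N →
    ∑ n ∈ Finset.Icc 1 N, ‖ramanujanSum b Q n‖ ^ 2 ≤
      (8 + Z * A ^ 2) * N * ∑ q ∈ Finset.Icc 1 Q, (q.totient : ℝ) * b q ^ 2 := by
  obtain ⟨Z, hZ0, hZ⟩ := exists_sum_norm_expSum_sq_le
  refine ⟨Z, hZ0, fun b Q N A hQ hN hA => ?_⟩
  have hQ0 : (0 : ℝ) < Q := by exact_mod_cast hQ
  have hN0 : (0 : ℝ) < N := by exact_mod_cast hN
  set I := (Finset.Icc 1 Q).sigma reducedResidues with hI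
  set x : (_ : ℕ) × ℕ → ℝ := fun p => -((p.2 : ℝ) / p.1) with hx
  have key := hZ I x (fun p => b p.1) N ((Q : ℝ) ^ 2)⁻¹ hN (by positivity) (by
    rintro ⟨q, a⟩ hp ⟨q', a'⟩ hp' hne k
    simp only [hI, Finset.mem_sigma] at hp hp'
    have := farey_separated hp.1 hp'.1 hp.2 hp'.2 (fun h => hne (by rw [h.1, h.2])) (-k)
    refine this.trans (le_of_eq ?_)
    rw [← abs_neg]
    congr 1
    simp only [hx]
    push_cast
    ring)
  have e1 : ∀ n : ℕ, expSum I x (fun p => b p.1) n = ramanujanSum b Q n := by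
    intro n
    rw [expSum, hI, Finset.sum_sigma, ramanujanSum]
    refine Finset.sum_congr rfl fun q _ => ?_
    rw [ramanujan, Finset.mul_sum]
    refine Finset.sum_congr rfl fun a _ => ?_
    congr 2
    simp only [hx]
    push_cast
    ring
  have e2 : ∑ p ∈ I, b p.1 ^ 2 = ∑ q ∈ Finset.Icc 1 Q, (q.totient : ℝ) * b q ^ 2 := by
    rw [hI, Finset.sum_sigma]
    refine Finset.sum_congr rfl fun q _ => ?_
    change ∑ _s ∈ reducedResidues q, b q ^ 2 = _
    rw [Finset.sum_const, card_reducedResidues, nsmul_eq_mul]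
  simp_rw [e1] at key
  rw [e2] at key
  refine key.trans ?_
  have hpos : 0 ≤ ∑ q ∈ Finset.Icc 1 Q, (q.totient : ℝ) * b q ^ 2 :=
    Finset.sum_nonneg fun q _ => by positivity
  gcongr
  -- With δ = Q⁻² the second large sieve term is Z Q⁴/N, and Q² ≤ AN makes it at most Z A² N.
  have h4 : ((Q : ℝ) ^ 2) ^ 2 ≤ (A * N) ^ 2 := by gcongr
  have h5 : ((((Q : ℝ) ^ 2)⁻¹) ^ 2 * N)⁻¹ ≤ A ^ 2 * N := by
    have : ((((Q : ℝ) ^ 2)⁻¹) ^ 2 * N)⁻¹ = ((Q : ℝ) ^ 2) ^ 2 / N := by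
      field_simp
    rw [this, div_le_iff₀ hN0]
    linarith
  nlinarith

end SelbergSieve

/-! ### The L¹ distance and the conclusion. -/

namespace SelbergSieve

lemma ramanujanSum_sub (b b' : ℕ → ℝ) (Q n : ℕ) :
    ramanujanSum (fun q => b q - b' q) Q n = ramanujanSum b Q n - ramanujanSum b' Q n := by
  rw [ramanujanSum, ramanujanSum, ramanujanSum, ← Finset.sum_sub_distrib]
  refine Finset.sum_congr rfl fun q _ => ?_
  push_cast
  ring

lemma betaGY_eq (R : ℝ) (n : ℕ) :
    betaGY R n = G R * ‖ramanujanSum (gyCoeff R) ⌊R⌋₊ n‖ ^ 2 := by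
  rw [← sum_lambdaGY, Complex.norm_real, Real.norm_eq_abs, sq_abs, betaGY]

lemma beta_eq {R : ℝ} (hR : 1 ≤ R) (n : ℕ) :
    beta R n = G R * ‖ramanujanSum (selbergCoeff R) ⌊R⌋₊ n‖ ^ 2 := by
  have hG : 0 < G R := by linarith [one_le_G hR]
  rw [← alpha_div_G, norm_div, Complex.norm_real, Real.norm_eq_abs, abs_of_pos hG, beta]
  field_simp

lemma sum_totient_mul_selbergCoeff_sq {R : ℝ} (hR : 1 ≤ R) :
    ∑ q ∈ Finset.Icc 1 ⌊R⌋₊, (q.totient : ℝ) * selbergCoeff R q ^ 2 = (G R)⁻¹ := by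
  have hG : 0 < G R := by linarith [one_le_G hR]
  have h : ∑ q ∈ Finset.Icc 1 ⌊R⌋₊, (q.totient : ℝ) * selbergCoeff R q ^ 2 =
      G R / G R ^ 2 := by
    rw [G, Finset.sum_div]
    refine Finset.sum_congr rfl fun q hq => ?_
    have hq' : (0 : ℝ) < q.totient := by
      exact_mod_cast Nat.totient_pos.2 (Finset.mem_Icc.1 hq).1
    rw [selbergCoeff, ← G]
    field_simp
  rw [h]
  field_simp

lemma sum_abs_norm_sq_sub_norm_sq_le {ι : Type*} (I : Finset ι) (f g : ι → ℂ) :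
    ∑ i ∈ I, |‖f i‖ ^ 2 - ‖g i‖ ^ 2| ≤
      2 * (√(∑ i ∈ I, ‖f i - g i‖ ^ 2) * √(∑ i ∈ I, ‖g i‖ ^ 2)) +
        ∑ i ∈ I, ‖f i - g i‖ ^ 2 := by
  have hcs := Real.sum_mul_le_sqrt_mul_sqrt I (fun i => ‖f i - g i‖) fun i => ‖g i‖
  have hpt : ∀ i ∈ I, |‖f i‖ ^ 2 - ‖g i‖ ^ 2| ≤
      2 * (‖f i - g i‖ * ‖g i‖) + ‖f i - g i‖ ^ 2 := fun i _ => by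
    have h1 := abs_norm_sub_norm_le (f i) (g i)
    have h2 : ‖f i‖ + ‖g i‖ ≤ 2 * ‖g i‖ + ‖f i - g i‖ := by
      linarith [norm_sub_norm_le (f i) (g i)]
    calc |‖f i‖ ^ 2 - ‖g i‖ ^ 2| = |‖f i‖ - ‖g i‖| * (‖f i‖ + ‖g i‖) := by
          have h3 : |‖f i‖ + ‖g i‖| = ‖f i‖ + ‖g i‖ := abs_of_nonneg (by positivity)
          rw [sq_sub_sq, abs_mul, h3, mul_comm]
      _ ≤ ‖f i - g i‖ * (2 * ‖g i‖ + ‖f i - g i‖) := by gcongr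
      _ = _ := by ring
  refine (Finset.sum_le_sum hpt).trans ?_
  rw [Finset.sum_add_distrib, ← Finset.mul_sum]
  linarith

/-- The `L¹` distance of the two majorants is controlled by the weighted `ℓ²` distance of their
Ramanujan coefficients. -/
lemma sum_abs_betaGY_sub_beta_le {R T : ℝ} {N : ℕ} (hR : 1 ≤ R) (hT : 0 ≤ T)
    (hls : ∀ b : ℕ → ℝ, ∑ n ∈ Finset.Icc 1 N, ‖ramanujanSum b ⌊R⌋₊ n‖ ^ 2 ≤
      T * ∑ q ∈ Finset.Icc 1 ⌊R⌋₊, (q.totient : ℝ) * b q ^ 2) :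
    ∑ n ∈ Finset.Icc 1 N, |betaGY R n - beta R n| ≤
      T * (2 * √(G R * coeffDist R) + G R * coeffDist R) := by
  have hG : 0 < G R := by linarith [one_le_G hR]
  have h1 : ∑ n ∈ Finset.Icc 1 N, |betaGY R n - beta R n| =
      G R * ∑ n ∈ Finset.Icc 1 N, |‖ramanujanSum (gyCoeff R) ⌊R⌋₊ n‖ ^ 2 -
        ‖ramanujanSum (selbergCoeff R) ⌊R⌋₊ n‖ ^ 2| := by
    rw [Finset.mul_sum]
    refine Finset.sum_congr rfl fun n _ => ?_
    rw [betaGY_eq, beta_eq hR, ← mul_sub, abs_mul, abs_of_pos hG]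
  have hd := hls fun q => gyCoeff R q - selbergCoeff R q
  simp only [ramanujanSum_sub] at hd
  rw [← coeffDist] at hd
  have hs := hls (selbergCoeff R)
  rw [sum_totient_mul_selbergCoeff_sq hR] at hs
  have hD : 0 ≤ coeffDist R := Finset.sum_nonneg fun q _ => by positivity
  rw [h1]
  calc _ ≤ G R * (2 * (√(T * coeffDist R) * √(T * (G R)⁻¹)) + T * coeffDist R) := by
        gcongr
        refine (sum_abs_norm_sq_sub_norm_sq_le _ _ _).trans ?_
        gcongr
    _ = _ := by
      have h2 : G R * (√(T * coeffDist R) * √(T * (G R)⁻¹)) = T * √(G R * coeffDist R) := by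
        rw [← Real.sqrt_mul (by positivity)]
        have h3 : T * coeffDist R * (T * (G R)⁻¹) =
            (T / G R) ^ 2 * (G R * coeffDist R) := by
          field_simp
        rw [h3, Real.sqrt_mul (by positivity), Real.sqrt_sq (by positivity)]
        field_simp
      rw [mul_add, mul_left_comm, h2]
      ring

lemma exists_G_mul_coeffDist_le :
    ∃ C, 0 ≤ C ∧ ∀ R, 1 < R → G R * coeffDist R ≤ C / Real.log R := by
  obtain ⟨C₁, hC₁, hG⟩ := exists_G_le
  obtain ⟨C₂, hC₂, hD⟩ := exists_coeffDist_le
  have hl2 : 0 < Real.log 2 := Real.log_pos one_lt_two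
  refine ⟨(1 + C₁ / Real.log 2) * C₂, by positivity, fun R hR => ?_⟩
  have hl : 0 < Real.log R := Real.log_pos hR
  -- The bound G ≪ log R fails as R tends to 1, so that range uses D = 0.
  rcases lt_or_ge R 2 with h | h
  · rw [coeffDist_of_lt_two hR h, mul_zero]
    positivity
  · have hle : Real.log 2 ≤ Real.log R := Real.log_le_log two_pos h
    have h1 : G R ≤ (1 + C₁ / Real.log 2) * Real.log R := by
      have : C₁ ≤ C₁ / Real.log 2 * Real.log R := by
        rw [div_mul_eq_mul_div, le_div_iff₀ hl2]
        gcongr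
      linarith [hG R hR.le]
    have hD0 : 0 ≤ coeffDist R := Finset.sum_nonneg fun q _ => by positivity
    calc G R * coeffDist R
        ≤ ((1 + C₁ / Real.log 2) * Real.log R) * (C₂ / Real.log R ^ 2) := by
          gcongr
          exact hD R hR
      _ = _ := by field_simp

end SelbergSieve

theorem mainTheorem8 (C : ℝ) (hC : 0 < C) :
    ∃ K : ℝ, 0 < K ∧ ∀ ε : ℝ, 0 < ε → ∀ N : ℕ, 1 ≤ N → ∀ R : ℝ, 1 < R →
      R ≤ C * (N : ℝ) ^ (1 / 2 - ε) →
        (∑ n ∈ Finset.Icc 1 N, |SelbergSieve.betaGY R n - SelbergSieve.beta R n|) / (N : ℝ)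
          ≤ K * Real.log R ^ (-(1 / 2) : ℝ) := by
  obtain ⟨Z, hZ, hls⟩ := SelbergSieve.exists_sum_norm_ramanujanSum_sq_le
  obtain ⟨B, hB, hGD⟩ := SelbergSieve.exists_G_mul_coeffDist_le
  have hl2 : 0 < Real.log 2 := Real.log_pos one_lt_two
  -- The large sieve is applied with A = C², as ⌊R⌋² ≤ C²N. The factor √(log 2) converts B/log R
  -- into a multiple of (log R)^{−1/2} when R ≥ 2, and the + 1 ensures positivity.
  refine ⟨(8 + Z * (C ^ 2) ^ 2) * (2 * √B + B / √(Real.log 2)) + 1, by positivity,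
    fun ε hε N hN R hR hRN => ?_⟩
  have hN0 : (0 : ℝ) < N := by exact_mod_cast hN
  have hN1 : (1 : ℝ) ≤ N := by exact_mod_cast hN
  have hl : 0 < Real.log R := Real.log_pos hR
  have hQ : ((⌊R⌋₊ : ℝ)) ^ 2 ≤ C ^ 2 * N := by
    have h1 : (N : ℝ) ^ (1 / 2 - ε) ≤ √N := by
      rw [Real.sqrt_eq_rpow]
      exact Real.rpow_le_rpow_of_exponent_le hN1 (by linarith)
    calc ((⌊R⌋₊ : ℝ)) ^ 2 ≤ (C * √N) ^ 2 := by
          gcongr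
          exact (Nat.floor_le (by linarith)).trans (hRN.trans (by gcongr))
      _ = C ^ 2 * N := by rw [mul_pow, Real.sq_sqrt hN0.le]
  have hpow : Real.log R ^ (-(1 / 2) : ℝ) = (√(Real.log R))⁻¹ := by
    rw [Real.rpow_neg hl.le, Real.sqrt_eq_rpow]
  have key := SelbergSieve.sum_abs_betaGY_sub_beta_le (N := N) hR.le
    (by positivity : 0 ≤ (8 + Z * (C ^ 2) ^ 2) * (N : ℝ))
    fun b => hls b ⌊R⌋₊ N (C ^ 2) (Nat.le_floor (by exact_mod_cast hR.le)) hN hQ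
  rw [hpow, div_le_iff₀ hN0]
  have hS : 0 < √(Real.log R) := Real.sqrt_pos.2 hl
  rcases lt_or_ge R 2 with h2 | h2
  · rw [SelbergSieve.coeffDist_of_lt_two hR h2] at key
    simp only [mul_zero, Real.sqrt_zero, add_zero] at key
    exact key.trans (by positivity)
  have h1 : √(SelbergSieve.G R * SelbergSieve.coeffDist R) ≤ √B * (√(Real.log R))⁻¹ := by
    rw [← div_eq_mul_inv, ← Real.sqrt_div hB]
    exact Real.sqrt_le_sqrt (hGD R hR)
  have h3 : SelbergSieve.G R * SelbergSieve.coeffDist R ≤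
      B / √(Real.log 2) * (√(Real.log R))⁻¹ := by
    refine (hGD R hR).trans ?_
    rw [← div_eq_mul_inv, div_div]
    gcongr
    calc √(Real.log 2) * √(Real.log R) ≤ √(Real.log R) * √(Real.log R) := by gcongr
      _ = Real.log R := Real.mul_self_sqrt hl.le
  have h4 : 0 ≤ (√(Real.log R))⁻¹ * N := by positivity
  calc _ ≤ (8 + Z * (C ^ 2) ^ 2) * N * (2 * (√B * (√(Real.log R))⁻¹) +
        B / √(Real.log 2) * (√(Real.log R))⁻¹) := key.trans (by gcongr)
    _ ≤ _ := by linarith
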